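/- Let $b\neq 0$ and $s$ be real with $27s-38b^2>0$, let $\varepsilon>0$ and $\omega\in(-\tfrac12,\tfrac12)$ be such that $k^2:=1+2\varepsilon\omega>0$, and let $\tilde u=\tilde u(x)$ be a roll, that is, a real $2\pi$-periodic stationary solution of $$\partial_t u=-(1+k^2\partial_x^2+\partial_y^2)^2u+\varepsilon^2u+bu^2-su^3 .$$ Put $$\mathcal L=-(1+k^2\partial_x^2+\partial_y^2)^2+\varepsilon^2+2b\tilde u-3s\tilde u^2\quad\text{on }L^2(\mathbb R^2)\text{ with domain }H^4(\mathbb R^2),$$ and, for $\sigma=(\sigma_1,\sigma_2)\in\mathbb R^2$, $$B(\sigma)=-\big[1+k^2(\partial_x+i\sigma_1)^2-\sigma_2^2\big]^2+\varepsilon^2+2b\tilde u-3s\tilde u^2\quad\text{on }L^2(\mathbb T),\ \mathbb T=\mathbb R/2\pi\mathbb Z,\text{ with domain }H^4(\mathbb T).$$ Let $\bar\sigma\in\mathbb R^2$ be a most unstable Bloch wave vector: there are an open neighbourhood $\mathcal N$ of $\bar\sigma$ and a real analytic $\lambda:\mathcal N\to(0,\infty)$ such that $\lambda(\sigma)$ is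 an eigenvalue of $B(\sigma)$ for every $\sigma\in\mathcal N$, and $\lambda_M:=\lambda(\bar\sigma)$ is the largest of all eigenvalues of all the operators $B(\sigma)$, $\sigma\in\mathbb R^2$. Then there is $\bar c>0$ such that for every $c_0\in(0,\bar c]$ the square $Q=[\bar\sigma_1,\bar\sigma_1+c_0]\times[\bar\sigma_2,\bar\sigma_2+c_0]$ is contained in $\mathcal N$ and the following holds. Let $W(\cdot,\sigma)$, $\sigma\in Q$, be eigenfunctions of $B(\sigma)$ for the eigenvalues $\lambda(\sigma)$, depending continuously on $\sigma$ in $H^2(\mathbb T)$, and put $$U(x,y)=\int_{Q}e^{i(\sigma_1x+\sigma_2y)}W(x,\sigma)\,d\sigma,\qquad e(t)=\Big(\int_{Q}e^{2(\lambda(\sigma)-\lambda_M)t}\,d\sigma\Big)^{1/2}.$$ There is a constant $\rho>0$ such that, for every $N\in\mathbb N$, if $V_1,\dots,V_N$ are the (complex-valued) classical solutions for $t\ge0$ in $L^2(\mathbb R^2)$ of the recursively defined linear problems $$\partial_tV_1-\mathcal LV_1=0,\quad V_1(0)=U,$$ $$\partial_tV_j-\mathcal LV_j=-(3s\tilde u-b)\sum_{k+p=j}V_kV_p-s\sum_{k+p+q=j}V_kV_pV_q,\quad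 V_j(0)=0\qquad(2\le j\le N),$$ with indices $k,p,q\ge1$ (so for $j=2$ the cubic sum is empty), then $$\|V_j(t)\|_{H^2(\mathbb R^2)}\le\big(\rho\,e^{\lambda_Mt}e(t)\big)^j\qquad\text{for all }1\le j\le N,\ t\ge0 .$$ Here a classical solution of $\partial_tv=\mathcal Lv+g$, $v(0)=v_0$, is a function $v$ that is continuous on $[0,\infty)$ and continuously differentiable on $(0,\infty)$ with values in $L^2(\mathbb R^2)$, with $v(0)=v_0$, $v(t)\in H^4(\mathbb R^2)$ and $\partial_tv(t)=\mathcal Lv(t)+g(t)$ for $t>0$. -/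

import Mathlib

open MeasureTheory Set Filter Topology
open scoped FourierTransform SchwartzMap LineDeriv ENNReal

noncomputable section

namespace GSHE

/-- The physical plane, with coordinates `z 0 = x` and `z 1 = y`. -/
abbrev Plane : Type := EuclideanSpace ℝ (Fin 2)

/-- The complex Lebesgue space `L²(ℝ²)`. -/
abbrev L2 : Type := Lp ℂ 2 (volume : Measure Plane)

/-- The Sobolev norm of order `p` on `L²(ℝ²)`, with value `∞` outside `H^p(ℝ²)`:
`‖u‖²_{H^p} = ∫ (1 + |2πξ|²)^p |û(ξ)|² dξ`, where `û(ξ) = ∫ e^{-2πi z·ξ} u(z) dz`. -/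
def sobolevNorm (p : ℕ) (u : L2) : ℝ≥0∞ :=
  (∫⁻ ξ : Plane, ENNReal.ofReal ((1 + (2 * Real.pi * ‖ξ‖) ^ 2) ^ p) *
    ‖((𝓕 u : L2) : Plane → ℂ) ξ‖ₑ ^ 2) ^ (1 / 2 : ℝ)

/-- The square of the Sobolev norm of order `p` on the torus, for functions on `[0, 2π]`:
`∑_j (1 + j²)^p |ĥ(j)|²`, where `ĥ(j) = (2π)⁻¹ ∫_0^{2π} e^{-ijx} h(x) dx`. -/
def torusSobolevNormSq (p : ℕ) (h : ℝ → ℂ) : ℝ≥0∞ :=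
  ∑' j : ℤ, ENNReal.ofReal
    ((1 + (j : ℝ) ^ 2) ^ p * ‖fourierCoeffOn Real.two_pi_pos h j‖ ^ 2)

/-- The constants of the equation
`∂ₜu = -(1 + (1 + 2εω)∂ₓ² + ∂_y²)² u + ε² u + b u² - s u³`. -/
structure Params where
  s : ℝ
  b : ℝ
  ε : ℝ
  ω : ℝ

namespace Params

variable (P : Params)

/-- The squared wave number `k² = 1 + 2εω`. -/
def kSq : ℝ := 1 + 2 * P.ε * P.ω

/-- `f(v) = ε² v + b v² - s v³`. -/
def f (v : ℝ) : ℝ := P.ε ^ 2 * v + P.b * v ^ 2 - P.s * v ^ 3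

/-- `f'(v) = ε² + 2 b v - 3 s v²`, the potential of the linearization when `v` is the roll. -/
def potential (v : ℝ) : ℝ := P.ε ^ 2 + 2 * P.b * v - 3 * P.s * v ^ 2

/-- The ordinary differential operator `1 + k² ∂ₓ²`, on functions of `x` alone. -/
def rollOp (u : ℝ → ℝ) (x : ℝ) : ℝ := u x + P.kSq * deriv (deriv u) x

/-- A roll: a `2π`-periodic function of `x` alone that is a stationary (classical) solution. -/
structure IsRoll (u : ℝ → ℝ) : Prop where
  contDiff : ContDiff ℝ 4 u
  periodic : Function.Periodic u (2 * Real.pi)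
  stationary : ∀ x, -(P.rollOp (P.rollOp u) x) + P.f (u x) = 0

/-! ### Bloch operators -/

/-- `∂ₓ + iτ`. -/
def blochDeriv (τ : ℝ) (w : ℝ → ℂ) (x : ℝ) : ℂ := deriv w x + Complex.I * τ * w x

/-- `1 + k² (∂ₓ + iσ₁)² - σ₂²`. -/
def blochA (σ : ℝ × ℝ) (w : ℝ → ℂ) (x : ℝ) : ℂ :=
  (1 - (σ.2 : ℂ) ^ 2) * w x + P.kSq * blochDeriv σ.1 (blochDeriv σ.1 w) x

/-- The Bloch operator
`B(σ) = -[1 + k² (∂ₓ + iσ₁)² - σ₂²]² + ε² + 2bũ - 3sũ²` for the roll `ũ = u`. -/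
def bloch (u : ℝ → ℝ) (σ : ℝ × ℝ) (w : ℝ → ℂ) (x : ℝ) : ℂ :=
  -(P.blochA σ (P.blochA σ w) x) + (P.potential (u x) : ℂ) * w x

/-- `w` is an eigenfunction of `B(σ)` on the torus for the eigenvalue `μ`. Eigenfunctions of this
elliptic ordinary differential operator with domain `H⁴` are four times continuously
differentiable, so that they are classical. -/
structure IsBlochEigenfunction (u : ℝ → ℝ) (σ : ℝ × ℝ) (μ : ℝ) (w : ℝ → ℂ) : Prop where
  contDiff : ContDiff ℝ 4 w
  periodic : Function.Periodic w (2 * Real.pi)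
  ne_zero : w ≠ 0
  eigen : ∀ x, P.bloch u σ w x = (μ : ℂ) * w x

/-- `μ` is an eigenvalue of `B(σ)`. -/
def IsBlochEigenvalue (u : ℝ → ℝ) (σ : ℝ × ℝ) (μ : ℝ) : Prop :=
  ∃ w, P.IsBlochEigenfunction u σ μ w

/-- `σbar` is a most unstable Bloch wave vector, and `lam` is a real analytic branch of unstable
eigenvalues of `B(σ)` for `σ` in the open neighbourhood `S` of `σbar`, whose value at `σbar` is the
largest of all eigenvalues of all Bloch operators. -/
structure IsMostUnstableBranch (u : ℝ → ℝ) (σbar : ℝ × ℝ) (S : Set (ℝ × ℝ))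
    (lam : ℝ × ℝ → ℝ) : Prop where
  isOpen : IsOpen S
  mem : σbar ∈ S
  analytic : AnalyticOnNhd ℝ lam S
  unstable : ∀ σ ∈ S, 0 < lam σ ∧ P.IsBlochEigenvalue u σ (lam σ)
  maximal : ∀ σ μ, P.IsBlochEigenvalue u σ μ → μ ≤ lam σbar

/-- The square `[σbar₁, σbar₁ + c] × [σbar₂, σbar₂ + c]` of Bloch wave vectors. -/
def square (σbar : ℝ × ℝ) (c : ℝ) : Set (ℝ × ℝ) :=
  Icc σbar.1 (σbar.1 + c) ×ˢ Icc σbar.2 (σbar.2 + c)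

/-- `W σ`, `σ ∈ Q`, is a family of eigenfunctions for the eigenvalues `lam σ`, continuous in `σ`
as a map into `H²` of the torus. -/
structure IsEigenfamily (u : ℝ → ℝ) (lam : ℝ × ℝ → ℝ) (Q : Set (ℝ × ℝ))
    (W : ℝ × ℝ → ℝ → ℂ) : Prop where
  eigenfunction : ∀ σ ∈ Q, P.IsBlochEigenfunction u σ (lam σ) (W σ)
  continuous : ∀ σ₀ ∈ Q,
    Tendsto (fun σ => torusSobolevNormSq 2 (fun x => W σ x - W σ₀ x)) (𝓝[Q] σ₀) (𝓝 0)

/-- `U(x, y) = ∫_Q e^{i(σ₁ x + σ₂ y)} W(x, σ) dσ`. -/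
def wavePacket (Q : Set (ℝ × ℝ)) (W : ℝ × ℝ → ℝ → ℂ) (z : Plane) : ℂ :=
  ∫ σ in Q, Complex.exp (Complex.I * (σ.1 * z 0 + σ.2 * z 1)) * W σ (z 0)

/-- The prefactor `e(t) = (∫_Q e^{2 (lam σ - lamM) t} dσ)^{1/2}`. -/
def prefactor (Q : Set (ℝ × ℝ)) (lam : ℝ × ℝ → ℝ) (lamM t : ℝ) : ℝ :=
  Real.sqrt (∫ σ in Q, Real.exp (2 * (lam σ - lamM) * t))

/-! ### The linearized evolution on the plane -/

/-- `1 + k² ∂ₓ² + ∂_y²`, acting on tempered distributions on the plane. -/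
def planeA (T : 𝓢'(Plane, ℂ)) : 𝓢'(Plane, ℂ) :=
  T + (P.kSq : ℂ) • (∂_{EuclideanSpace.single (0 : Fin 2) (1 : ℝ)}
        (∂_{EuclideanSpace.single (0 : Fin 2) (1 : ℝ)} T))
    + ∂_{EuclideanSpace.single (1 : Fin 2) (1 : ℝ)}
        (∂_{EuclideanSpace.single (1 : Fin 2) (1 : ℝ)} T)

/-- The graph of the linearization `𝓛 = -(1 + k² ∂ₓ² + ∂_y²)² + ε² + 2bũ - 3sũ²` about the roll
`ũ = u`, with domain `H⁴(ℝ²)`: it says that `v` is in `H⁴(ℝ²)` and `𝓛 v = w`. -/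
def IsLinearization (u : ℝ → ℝ) (v w : L2) : Prop :=
  TemperedDistribution.MemSobolev 4 2 (v : 𝓢'(Plane, ℂ)) ∧
  ∃ a : L2, (a : 𝓢'(Plane, ℂ)) = P.planeA (P.planeA (v : 𝓢'(Plane, ℂ))) ∧
    ∀ᵐ z : Plane, w z = -a z + (P.potential (u (z 0)) : ℂ) * v z

/-- `v` is a classical solution, for `t ≥ 0`, of the abstract Cauchy problem `∂ₜv = 𝓛v + g`,
`v(0) = v₀` in `L²(ℝ²)`: it is continuous on `[0, ∞)` and continuously differentiable on `(0, ∞)`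
as a map into `L²(ℝ²)`, takes values in `H⁴(ℝ²)` on `(0, ∞)`, and solves the equation there. -/
def IsSolution (u : ℝ → ℝ) (g : ℝ → Plane → ℂ) (v₀ : Plane → ℂ) (v : ℝ → L2) : Prop :=
  ContinuousOn v (Ici 0) ∧ (∀ᵐ z : Plane, v 0 z = v₀ z) ∧
  ∃ v' : ℝ → L2, ContinuousOn v' (Ioi 0) ∧ ∀ t : ℝ, 0 < t → HasDerivAt v (v' t) t ∧
    ∃ w : L2, P.IsLinearization u (v t) w ∧ ∀ᵐ z : Plane, v' t z = w z + g t z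

/-- The forcing term of the `j`-th correction,
`-(3sũ - b) ∑_{k+p=j} V_k V_p - s ∑_{k+p+q=j} V_k V_p V_q` with `k, p, q ≥ 1`
(for `j = 2` the second sum is empty). -/
def forcing (u : ℝ → ℝ) (V : ℕ → ℝ → L2) (j : ℕ) (t : ℝ) (z : Plane) : ℂ :=
  -(3 * P.s * u (z 0) - P.b) *
      (∑ m ∈ (Finset.Icc 1 j ×ˢ Finset.Icc 1 j).filter (fun m => m.1 + m.2 = j),
        V m.1 t z * V m.2 t z)
    - P.s *
      (∑ m ∈ (Finset.Icc 1 j ×ˢ Finset.Icc 1 j ×ˢ Finset.Icc 1 j).filter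
          (fun m => m.1 + m.2.1 + m.2.2 = j),
        V m.1 t z * V m.2.1 t z * V m.2.2 t z)

/-- `V 1, …, V N` are the terms of the approximate solution of order `N`: `V 1` solves the
linearized equation with initial value `U`, and for `2 ≤ j ≤ N` the term `V j` solves the linear
inhomogeneous problem with the forcing given by the previous terms and with initial value `0`. -/
structure AreCorrections (u : ℝ → ℝ) (U : Plane → ℂ) (N : ℕ) (V : ℕ → ℝ → L2) : Prop where
  first : 1 ≤ N → P.IsSolution u (fun _ _ => 0) U (V 1)
  higher : ∀ j, 2 ≤ j → j ≤ N → P.IsSolution u (P.forcing u V j) (fun _ => 0) (V j)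

end Params

end GSHE

end

/-! Write `E(t) = e^{λ_M t} e(t)`; by `growth_eq` this is the `L²(Q)` norm of `e^{λ(σ)t}`. The bound
is an induction on `j` through Duhamel-type estimates in `H²`, an algebra in dimension two. For one
`ρ` to serve all `j` and `N`, three facts are combined.

Sharp linear growth. A periodic multiplier only couples frequencies differing by lattice vectors, so
Plancherel splits `⟨𝓛v, v⟩` into fibres, each the quadratic form of one Bloch operator on `ℓ²(ℤ)`.
If a fibre form exceeded `λ_M`, its supremum would be attained by compactness
(`exists_eigenvector_of_form_gt`) and would be a Bloch eigenvalue above `λ_M`; hence `Re⟨𝓛v, v⟩ ≤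
λ_M‖v‖²` (`bloch_form_le`, `res_form_le`). This one-sided bound and the symmetry of `𝓛` replace a
semigroup: it gives uniqueness, and the energy `Re⟨-𝓛v, v⟩ + Λ‖v‖²`, which controls the `H²` norm,
grows at rate at most `2λ_M` up to forcing. Consequently a forcing bounded in `H²` by `κe^{-μ(T-t)}`
with `μ > λ_M` yields an `H²` norm at most `Bκ/(μ-λ_M)` at time `T` (`IsDissipative.exists_bound`).

The first term. The packet with amplitude `e^{λ(σ)t}` on `Q` solves the linear problem
(`res_packet`), so by uniqueness it is `V_1`, and Plancherel bounds its `H²` norm by a multiple of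
`E(t)` (`IsEigenfamily.exists_first`).

Closing the recursion. On a small square `λ ≥ (3/4)λ_M`, so `E(t)^j` gains the rate `(3/4)jλ_M ≥
(3/2)λ_M` for `j ≥ 2`, and the gap to `λ_M` is at least `λ_M/2`. The inductive claim is `θ
j⁻²(ρE)^j`: the weights `j⁻²` are stable under the convolution sums up to a fixed factor, and the
forcing carries `θ²` instead of `θ`, so a small `θ` absorbs all constants
(`AreCorrections.exists_bound`).

Throughout, an element of `H²` is represented as `iota h` with `h ∈ L²`, which turns `H²` estimates
into estimates of `‖h‖`. -/

noncomputable section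

namespace GSHE

/-! ### Multiplication by bounded measurable functions on `L²` -/

/-- `a` is a bounded measurable function on the plane. -/
structure BddMeas (a : Plane → ℂ) : Prop where
  meas : Measurable a
  bdd : ∃ C : ℝ, ∀ ξ, ‖a ξ‖ ≤ C

theorem BddMeas.memLp {a : Plane → ℂ} (h : BddMeas a) (v : L2) :
    MemLp (fun ξ => a ξ * v ξ) 2 volume := by
  obtain ⟨C, hC⟩ := h.bdd
  refine MemLp.of_le_mul (c := C) (Lp.memLp v)
    (h.meas.aestronglyMeasurable.mul (Lp.aestronglyMeasurable v)) (Eventually.of_forall fun ξ => ?_)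
  rw [norm_mul]
  exact mul_le_mul_of_nonneg_right (hC ξ) (norm_nonneg _)

/-- Multiplication by a bounded measurable function, as an operator on `L²`. -/
def mulCLM {a : Plane → ℂ} (h : BddMeas a) : L2 →L[ℂ] L2 :=
  LinearMap.mkContinuousOfExistsBound
    { toFun := fun v => (h.memLp v).toLp
      map_add' := fun v w => by
        apply Lp.ext
        filter_upwards [(h.memLp (v + w)).coeFn_toLp, (h.memLp v).coeFn_toLp,
          (h.memLp w).coeFn_toLp, Lp.coeFn_add v w,
          Lp.coeFn_add ((h.memLp v).toLp) ((h.memLp w).toLp)] with ξ h1 h2 h3 h4 h5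
        rw [h1, h5, Pi.add_apply, h2, h3, h4, Pi.add_apply, mul_add]
      map_smul' := fun c v => by
        apply Lp.ext
        filter_upwards [(h.memLp (c • v)).coeFn_toLp, (h.memLp v).coeFn_toLp,
          Lp.coeFn_smul c v, Lp.coeFn_smul c ((h.memLp v).toLp)] with ξ h1 h2 h4 h5
        rw [h1, RingHom.id_apply, h5, Pi.smul_apply, h2, h4, Pi.smul_apply, smul_eq_mul,
          smul_eq_mul, mul_left_comm] }
    (by
      obtain ⟨C, hC⟩ := h.bdd
      refine ⟨C, fun v => ?_⟩
      refine Lp.norm_le_mul_norm_of_ae_le_mul ?_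
      filter_upwards [(h.memLp v).coeFn_toLp] with ξ h1
      change ‖((h.memLp v).toLp : L2) ξ‖ ≤ _
      rw [h1, norm_mul]
      exact mul_le_mul_of_nonneg_right (hC ξ) (norm_nonneg _))

theorem mulCLM_ae {a : Plane → ℂ} (h : BddMeas a) (v : L2) :
    mulCLM h v =ᵐ[volume] fun ξ => a ξ * v ξ :=
  (h.memLp v).coeFn_toLp

theorem norm_mulCLM_apply_le {a : Plane → ℂ} (h : BddMeas a) {C : ℝ} (hC : ∀ ξ, ‖a ξ‖ ≤ C)
    (v : L2) : ‖mulCLM h v‖ ≤ C * ‖v‖ := by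
  refine Lp.norm_le_mul_norm_of_ae_le_mul ?_
  filter_upwards [mulCLM_ae h v] with ξ h1
  rw [h1, norm_mul]
  exact mul_le_mul_of_nonneg_right (hC ξ) (norm_nonneg _)

theorem norm_mulCLM_le {a : Plane → ℂ} (h : BddMeas a) {C : ℝ} (hC : ∀ ξ, ‖a ξ‖ ≤ C) :
    ‖mulCLM h‖ ≤ C :=
  ContinuousLinearMap.opNorm_le_bound _ ((norm_nonneg _).trans (hC 0))
    (norm_mulCLM_apply_le h hC)

theorem mulCLM_mulCLM {a b c : Plane → ℂ} (ha : BddMeas a) (hb : BddMeas b) (hc : BddMeas c)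
    (habc : ∀ ξ, a ξ * b ξ = c ξ) (v : L2) : mulCLM ha (mulCLM hb v) = mulCLM hc v := by
  apply Lp.ext
  filter_upwards [mulCLM_ae ha (mulCLM hb v), mulCLM_ae hb v, mulCLM_ae hc v] with ξ h1 h2 h3
  rw [h1, h2, h3, ← habc, mul_assoc]

theorem mulCLM_symm {a : Plane → ℂ} (ha : BddMeas a) (hreal : ∀ ξ, (starRingEnd ℂ) (a ξ) = a ξ)
    (v w : L2) : inner ℂ (mulCLM ha v) w = inner ℂ v (mulCLM ha w) := by
  rw [L2.inner_def, L2.inner_def]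
  refine integral_congr_ae ?_
  filter_upwards [mulCLM_ae ha v, mulCLM_ae ha w] with ξ h1 h2
  rw [h1, h2]
  simp only [RCLike.inner_apply, map_mul, hreal]
  ring

/-! ### Fourier transform on `L²` and on `L¹ ∩ L²` -/

/-- Two elements of `L²` that agree when tested against smooth compactly supported functions. -/
theorem ae_eq_of_schwartz_test {f f' : Plane → ℂ} (hf : LocallyIntegrable f)
    (hf' : LocallyIntegrable f') (h : ∀ g : 𝓢(Plane, ℂ), ∫ x, g x * f x = ∫ x, g x * f' x) :
    f =ᵐ[volume] f' := by
  refine ae_eq_of_integral_contDiff_smul_eq hf hf' fun g hg hgc => ?_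
  have hg' : ContDiff ℝ (⊤ : ℕ∞) (fun x => (g x : ℂ)) := Complex.ofRealCLM.contDiff.comp hg
  have hgc' : HasCompactSupport (fun x => (g x : ℂ)) :=
    hgc.comp_left (g := fun r : ℝ => (r : ℂ)) (by simp)
  have := h (hgc'.toSchwartzMap hg')
  exact this

theorem fourierInv_eq_vectorFourier (f : Plane → ℂ) :
    𝓕⁻ f = VectorFourier.fourierIntegral Real.fourierChar volume (-(innerₗ Plane)) f := by
  ext w
  rw [Real.fourierInv_eq, VectorFourier.fourierIntegral]
  simp

theorem continuous_neg_innerₗ :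
    Continuous fun p : Plane × Plane => (-(innerₗ Plane)) p.1 p.2 := by
  simp only [LinearMap.neg_apply, innerₗ_apply_apply]
  fun_prop

theorem continuous_fourierInv {f : Plane → ℂ} (hf : Integrable f) : Continuous (𝓕⁻ f) := by
  rw [fourierInv_eq_vectorFourier]
  exact VectorFourier.fourierIntegral_continuous Real.continuous_fourierChar
    continuous_neg_innerₗ hf

/-- The inverse Fourier transform on `L²` is given by the integral for integrable functions. -/
theorem fourierInv_ae_eq {F : L2} (hF : Integrable (F : Plane → ℂ)) :
    ((𝓕⁻ F : L2) : Plane → ℂ) =ᵐ[volume] 𝓕⁻ (F : Plane → ℂ) := by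
  refine ae_eq_of_schwartz_test ?_ (continuous_fourierInv hF).locallyIntegrable fun g => ?_
  · exact (Lp.memLp _).locallyIntegrable (by norm_num)
  · have h1 := congrArg (fun T : 𝓢'(Plane, ℂ) => T g) (Lp.fourierInv_toTemperedDistribution_eq F)
    simp only [TemperedDistribution.fourierInv_apply, Lp.toTemperedDistribution_apply,
      smul_eq_mul] at h1
    rw [← h1]
    -- Fubini moves the transform onto the Schwartz function; the bilinear form is symmetric, so
    -- flipping it changes nothing.
    have h2 := VectorFourier.integral_fourierIntegral_smul_eq_flip (μ := (volume : Measure Plane))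
      (ν := (volume : Measure Plane))
      Real.continuous_fourierChar continuous_neg_innerₗ g.integrable hF
    have h3 : (-(innerₗ Plane)).flip = -(innerₗ Plane) := by
      ext x y
      simp [real_inner_comm]
    simp only [smul_eq_mul, h3] at h2
    rw [← fourierInv_eq_vectorFourier, ← fourierInv_eq_vectorFourier] at h2
    rw [SchwartzMap.fourierInv_coe]
    exact h2

/-! ### Translations in Fourier space and modulations -/

theorem measurePreserving_add_const (c : Plane) :
    MeasurePreserving (fun ξ : Plane => ξ + c) volume volume :=
  measurePreserving_add_right volume c

/-- Translation `F ↦ F(· + c)` on `L²`. -/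
def transL (c : Plane) : L2 →ₗᵢ[ℂ] L2 :=
  Lp.compMeasurePreservingₗᵢ ℂ (fun ξ : Plane => ξ + c) (measurePreserving_add_const c)

theorem transL_ae (c : Plane) (F : L2) : transL c F =ᵐ[volume] fun ξ => F (ξ + c) :=
  Lp.coeFn_compMeasurePreserving F (measurePreserving_add_const c)

theorem norm_char (c z : Plane) : ‖(Real.fourierChar (inner ℝ c z) : ℂ)‖ = 1 :=
  Circle.norm_coe _

theorem bddMeas_char (c : Plane) :
    BddMeas fun z => (Real.fourierChar (inner ℝ c z) : ℂ) :=
  ⟨by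
    have := Real.continuous_fourierChar
    refine Continuous.measurable ?_
    fun_prop, 1, fun z => (norm_char c z).le⟩

/-- Multiplication by the character `e^{2πi c·z}`, as an operator on `L²`. -/
def charL (c : Plane) : L2 →L[ℂ] L2 := mulCLM (bddMeas_char c)

theorem charL_ae (c : Plane) (v : L2) :
    charL c v =ᵐ[volume] fun z => (Real.fourierChar (inner ℝ c z) : ℂ) * v z :=
  mulCLM_ae _ v

theorem norm_charL_le (c : Plane) : ‖charL c‖ ≤ 1 :=
  norm_mulCLM_le _ fun z => (norm_char c z).le

theorem fourierInv_comp_add (c : Plane) (f : Plane → ℂ) (z : Plane) :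
    𝓕⁻ (fun ξ => f (ξ - c)) z = (Real.fourierChar (inner ℝ c z) : ℂ) * 𝓕⁻ f z := by
  rw [Real.fourierInv_eq, Real.fourierInv_eq, ← integral_add_right_eq_self _ c,
    ← integral_const_mul]
  congr 1
  ext ξ
  rw [add_sub_cancel_right, inner_add_left, AddChar.map_add_eq_mul, Circle.smul_def,
    Circle.smul_def, Circle.coe_mul, smul_eq_mul, smul_eq_mul]
  ring

/-- For Schwartz functions both transforms are integrals and the identity is a change of variables;
both sides are continuous on `L²`, so density finishes. -/
theorem fourierInv_transL (c : Plane) (F : L2) :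
    (𝓕⁻ (transL (-c) F) : L2) = charL c (𝓕⁻ F) := by
  refine DenseRange.induction_on
    (p := fun F : L2 => (𝓕⁻ (transL (-c) F) : L2) = charL c (𝓕⁻ F))
    (SchwartzMap.denseRange_toLpCLM (p := 2) (F := ℂ) (E := Plane) (μ := volume)
      ENNReal.ofNat_ne_top) F ?_ ?_
  · have hc : Continuous fun F : L2 => (𝓕⁻ F : L2) :=
      (Lp.fourierTransformₗᵢ Plane ℂ).symm.continuous
    exact isClosed_eq (hc.comp (transL (-c)).continuous) ((charL c).continuous.comp hc)
  · intro φ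
    set F : L2 := SchwartzMap.toLpCLM ℝ ℂ 2 volume φ
    have hF : (F : Plane → ℂ) =ᵐ[volume] φ := φ.coeFn_toLp 2 volume
    have hFi : Integrable (F : Plane → ℂ) := φ.integrable.congr hF.symm
    have hT := transL_ae (-c) F
    simp only [← sub_eq_add_neg] at hT
    have hTi : Integrable (transL (-c) F : Plane → ℂ) :=
      ((measurePreserving_add_const (-c)).integrable_comp_of_integrable hFi).congr
        (transL_ae (-c) F).symm
    apply Lp.ext
    filter_upwards [fourierInv_ae_eq hFi, fourierInv_ae_eq hTi, charL_ae c (𝓕⁻ F)] with z h1 h2 h3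
    rw [h2, h3, h1, Real.fourierInv_congr_ae hT]
    exact fourierInv_comp_add c F z

theorem fourier_charL (c : Plane) (v : L2) :
    (𝓕 (charL c v) : L2) = transL (-c) (𝓕 v) := by
  rw [← FourierTransform.fourierInv_fourier_eq (E := L2) (F := L2) v, ← fourierInv_transL]
  simp

/-! ### Fourier multipliers with bounded symbols -/

/-- The Fourier multiplier with a bounded measurable symbol, as an operator on `L²`. -/
def fmul {a : Plane → ℂ} (h : BddMeas a) : L2 →L[ℂ] L2 :=
  ((Lp.fourierTransformₗᵢ Plane ℂ).symm.toContinuousLinearEquiv : L2 →L[ℂ] L2) ∘L mulCLM h ∘L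
    ((Lp.fourierTransformₗᵢ Plane ℂ).toContinuousLinearEquiv : L2 →L[ℂ] L2)

theorem fmul_apply {a : Plane → ℂ} (h : BddMeas a) (v : L2) :
    fmul h v = (𝓕⁻ (mulCLM h (𝓕 v)) : L2) := rfl

theorem fourier_fmul {a : Plane → ℂ} (h : BddMeas a) (v : L2) :
    (𝓕 (fmul h v) : L2) = mulCLM h (𝓕 v) := by
  rw [fmul_apply]
  exact FourierTransform.fourier_fourierInv_eq _

theorem fourier_injective {v w : L2} (h : (𝓕 v : L2) = 𝓕 w) : v = w :=
  (Lp.fourierTransformₗᵢ Plane ℂ).injective h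

theorem norm_fmul_apply_le {a : Plane → ℂ} (h : BddMeas a) {C : ℝ} (hC : ∀ ξ, ‖a ξ‖ ≤ C)
    (v : L2) : ‖fmul h v‖ ≤ C * ‖v‖ := by
  rw [← Lp.norm_fourier_eq, fourier_fmul, ← Lp.norm_fourier_eq v]
  exact norm_mulCLM_apply_le h hC _

theorem fmul_fmul {a b c : Plane → ℂ} (ha : BddMeas a) (hb : BddMeas b) (hc : BddMeas c)
    (habc : ∀ ξ, a ξ * b ξ = c ξ) (v : L2) : fmul ha (fmul hb v) = fmul hc v := by
  apply fourier_injective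
  rw [fourier_fmul, fourier_fmul, fourier_fmul, mulCLM_mulCLM ha hb hc habc]

theorem fmul_symm {a : Plane → ℂ} (ha : BddMeas a) (hreal : ∀ ξ, (starRingEnd ℂ) (a ξ) = a ξ)
    (v w : L2) : inner ℂ (fmul ha v) w = inner ℂ v (fmul ha w) := by
  rw [← Lp.inner_fourier_eq, ← Lp.inner_fourier_eq v, fourier_fmul, fourier_fmul,
    mulCLM_symm ha hreal]

/-- The symbol `1 + |2πξ|²` of `1 - Δ`. -/
def jap (ξ : Plane) : ℝ := 1 + (2 * Real.pi * ‖ξ‖) ^ 2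

theorem one_le_jap (ξ : Plane) : 1 ≤ jap ξ := by unfold jap; nlinarith [sq_nonneg (2 * Real.pi * ‖ξ‖)]

theorem jap_pos (ξ : Plane) : 0 < jap ξ := one_pos.trans_le (one_le_jap ξ)

theorem continuous_jap : Continuous jap := by unfold jap; fun_prop

theorem bddMeas_ofReal {a : Plane → ℝ} (ha : Continuous a) {C : ℝ} (hC : ∀ ξ, |a ξ| ≤ C) :
    BddMeas fun ξ => (a ξ : ℂ) :=
  ⟨(Complex.continuous_ofReal.comp ha).measurable, C, fun ξ => by
    rw [Complex.norm_real]; exact hC ξ⟩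

theorem bddMeas_invJap : BddMeas fun ξ => ((1 / jap ξ : ℝ) : ℂ) :=
  bddMeas_ofReal (continuous_const.div continuous_jap fun ξ => (jap_pos ξ).ne') (C := 1) fun ξ => by
    rw [abs_of_pos (by have := jap_pos ξ; positivity), div_le_one (jap_pos ξ)]
    exact one_le_jap ξ

/-- The Bessel potential `(1 - Δ)⁻¹ : L² → H²`, an isometry onto `H²(ℝ²)`. -/
def iota : L2 →L[ℂ] L2 := fmul bddMeas_invJap

theorem fourier_iota_ae (h : L2) :
    (𝓕 (iota h) : L2) =ᵐ[volume] fun ξ => ((1 / jap ξ : ℝ) : ℂ) * (𝓕 h : L2) ξ := by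
  rw [iota, fourier_fmul]
  exact mulCLM_ae _ _

theorem iota_injective : Function.Injective iota := by
  intro h k hk
  apply fourier_injective
  apply Lp.ext
  have h1 := fourier_iota_ae h
  rw [hk] at h1
  filter_upwards [h1, fourier_iota_ae k] with ξ h2 h3
  rw [h2] at h3
  refine mul_left_cancel₀ ?_ h3
  have := jap_pos ξ
  exact_mod_cast (by positivity : (1 / jap ξ : ℝ) ≠ 0)

theorem norm_L2_eq (f : L2) : ENNReal.ofReal ‖f‖ = (∫⁻ ξ, ‖f ξ‖ₑ ^ 2) ^ (1 / 2 : ℝ) := by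
  rw [Lp.norm_def, ENNReal.ofReal_toReal (Lp.eLpNorm_ne_top f),
    eLpNorm_eq_lintegral_rpow_enorm_toReal (by norm_num) (by norm_num)]
  simp

/-- This is what makes `iota` useful: the weight `jap²` in the `H²` norm cancels the squared symbol
of `iota`, and Plancherel does the rest. -/
theorem sobolevNorm_iota (h : L2) : sobolevNorm 2 (iota h) = ENNReal.ofReal ‖h‖ := by
  rw [← Lp.norm_fourier_eq, norm_L2_eq, sobolevNorm]
  congr 1
  refine lintegral_congr_ae ?_
  filter_upwards [fourier_iota_ae h] with ξ h1
  rw [h1, enorm_mul, mul_pow ‖((1 / jap ξ : ℝ) : ℂ)‖ₑ, ← mul_assoc]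
  have h2 := jap_pos ξ
  have h3 : ‖((1 / jap ξ : ℝ) : ℂ)‖ₑ ^ 2 = ENNReal.ofReal ((1 / jap ξ) ^ 2) := by
    rw [← ofReal_norm, Complex.norm_real, Real.norm_of_nonneg (by positivity),
      ENNReal.ofReal_pow (by positivity)]
  rw [h3, ← ENNReal.ofReal_mul (by positivity)]
  change ENNReal.ofReal (jap ξ ^ 2 * _) * _ = _
  rw [← mul_pow, mul_one_div_cancel h2.ne']
  simp

/-! ### Ellipticity of `1 + (1 + k²∂ₓ² + ∂_y²)²` -/

namespace Params

variable (P : Params)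

/-- The symbol of `1 + k² ∂ₓ² + ∂_y²`. -/
def msym (ξ : Plane) : ℝ := 1 - P.kSq * (2 * Real.pi * ξ 0) ^ 2 - (2 * Real.pi * ξ 1) ^ 2

theorem continuous_msym : Continuous P.msym := by unfold msym; fun_prop

theorem jap_eq (ξ : Plane) : jap ξ = 1 + (2 * Real.pi * ξ 0) ^ 2 + (2 * Real.pi * ξ 1) ^ 2 := by
  rw [jap, mul_pow, EuclideanSpace.norm_sq_eq, Fin.sum_univ_two]
  simp only [Real.norm_eq_abs, sq_abs]
  ring

/-- Ellipticity, where `k² > 0` is essential: with `m` the symbol, `min(1, k²)·jap ≤ 1 + k²a + b = 2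
- m`, and `(2 - m)² ≤ 8(1 + m²)`. -/
theorem jap_sq_le (hk : 0 < P.kSq) (ξ : Plane) :
    jap ξ ^ 2 ≤ 8 / (min 1 P.kSq) ^ 2 * (1 + P.msym ξ ^ 2) := by
  have hκ : 0 < min 1 P.kSq := lt_min one_pos hk
  set κ := min 1 P.kSq
  have h1 : κ ≤ 1 := min_le_left _ _
  have h2 : κ ≤ P.kSq := min_le_right _ _
  rw [div_mul_eq_mul_div, le_div_iff₀ (by positivity), ← mul_pow]
  rw [jap_eq, msym]
  set a := (2 * Real.pi * ξ 0) ^ 2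
  set b := (2 * Real.pi * ξ 1) ^ 2
  have ha : 0 ≤ a := sq_nonneg _
  have hb : 0 ≤ b := sq_nonneg _
  have h3 : 0 ≤ (1 + a + b) * κ := by positivity
  have h4 : (1 + a + b) * κ ≤ 2 - (1 - P.kSq * a - b) := by nlinarith
  nlinarith [sq_nonneg (1 - P.kSq * a - b + 1), sq_nonneg (1 - P.kSq * a - b - 1)]

theorem one_add_msym_sq_le (hk : 0 < P.kSq) (ξ : Plane) :
    1 + P.msym ξ ^ 2 ≤ (1 + (1 + P.kSq) ^ 2) * jap ξ ^ 2 := by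
  rw [jap_eq, msym]
  set a := (2 * Real.pi * ξ 0) ^ 2
  set b := (2 * Real.pi * ξ 1) ^ 2
  have ha : 0 ≤ a := sq_nonneg _
  have hb : 0 ≤ b := sq_nonneg _
  have h0 : 0 ≤ P.kSq * a := by positivity
  have h0' : 0 ≤ P.kSq * b := by positivity
  have h1 : |1 - P.kSq * a - b| ≤ (1 + P.kSq) * (1 + a + b) := by
    rw [abs_le]; constructor <;> nlinarith
  have h2 := sq_le_sq' (neg_le_of_abs_le (h1.trans_eq rfl)) ((le_abs_self _).trans h1)
  rw [mul_pow] at h2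
  nlinarith [mul_nonneg (add_nonneg ha hb) (add_nonneg ha hb)]

theorem one_add_msym_sq_pos (ξ : Plane) : 0 < 1 + P.msym ξ ^ 2 := by positivity

theorem bddMeas_res : BddMeas fun ξ => ((1 / (1 + P.msym ξ ^ 2) : ℝ) : ℂ) :=
  bddMeas_ofReal (continuous_const.div (continuous_const.add (P.continuous_msym.pow 2))
    fun ξ => (P.one_add_msym_sq_pos ξ).ne') (C := 1) fun ξ => by
    rw [abs_of_pos (by positivity), div_le_one (by positivity)]
    nlinarith [sq_nonneg (P.msym ξ)]

theorem bddMeas_S (hk : 0 < P.kSq) : BddMeas fun ξ => ((jap ξ / (1 + P.msym ξ ^ 2) : ℝ) : ℂ) :=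
  bddMeas_ofReal (continuous_jap.div (continuous_const.add (P.continuous_msym.pow 2))
    fun ξ => (P.one_add_msym_sq_pos ξ).ne') (C := 8 / (min 1 P.kSq) ^ 2) fun ξ => by
    have := jap_pos ξ
    rw [abs_of_pos (by positivity), div_le_iff₀ (by positivity)]
    refine le_trans ?_ (P.jap_sq_le hk ξ)
    nlinarith [one_le_jap ξ]

theorem bddMeas_D (hk : 0 < P.kSq) :
    BddMeas fun ξ => (((1 + P.msym ξ ^ 2) / jap ξ ^ 2 : ℝ) : ℂ) :=
  bddMeas_ofReal ((continuous_const.add (P.continuous_msym.pow 2)).div (continuous_jap.pow 2)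
    fun ξ => (pow_pos (jap_pos ξ) 2).ne') (C := 1 + (1 + P.kSq) ^ 2) fun ξ => by
    have := jap_pos ξ
    rw [abs_of_pos (by positivity), div_le_iff₀ (by positivity)]
    exact P.one_add_msym_sq_le hk ξ

/-- The resolvent `(1 + (1 + k² ∂ₓ² + ∂_y²)²)⁻¹` on `L²`. -/
def res : L2 →L[ℂ] L2 := fmul P.bddMeas_res

/-- The operator `(1 - Δ)(1 + (1 + k² ∂ₓ² + ∂_y²)²)⁻¹` on `L²`. -/
def resS (hk : 0 < P.kSq) : L2 →L[ℂ] L2 := fmul (P.bddMeas_S hk)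

/-- The operator `(1 + (1 + k² ∂ₓ² + ∂_y²)²)(1 - Δ)⁻²` on `L²`. -/
def resD (hk : 0 < P.kSq) : L2 →L[ℂ] L2 := fmul (P.bddMeas_D hk)

theorem iota_resS (hk : 0 < P.kSq) (h : L2) : iota (P.resS hk h) = P.res h := by
  refine fmul_fmul _ _ _ (fun ξ => ?_) h
  have := (jap_pos ξ).ne'
  have := (P.one_add_msym_sq_pos ξ).ne'
  norm_cast
  field_simp

theorem resD_resS (hk : 0 < P.kSq) (h : L2) : P.resD hk (P.resS hk h) = iota h := by
  refine fmul_fmul _ _ _ (fun ξ => ?_) h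
  have := (jap_pos ξ).ne'
  have := (P.one_add_msym_sq_pos ξ).ne'
  norm_cast
  field_simp

theorem iota_symm (v w : L2) : inner ℂ (iota v) w = inner ℂ v (iota w) :=
  fmul_symm _ (fun _ => Complex.conj_ofReal _) v w

theorem res_symm (v w : L2) : inner ℂ (P.res v) w = inner ℂ v (P.res w) :=
  fmul_symm _ (fun _ => Complex.conj_ofReal _) v w

theorem fourier_res_ae (h : L2) :
    (𝓕 (P.res h) : L2) =ᵐ[volume]
      fun ξ => ((1 / (1 + P.msym ξ ^ 2) : ℝ) : ℂ) * (𝓕 h : L2) ξ := by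
  rw [res, fourier_fmul]
  exact mulCLM_ae _ _

/-- For `v = P.res h` the left side is the squared `H²` norm of `v` and the inner product is the
form of `1 + (1 + k²∂ₓ² + ∂_y²)²` at `v`. By Plancherel the coercivity reduces to a pointwise
comparison of symbols, namely `jap_sq_le` divided by `(1 + m²)²`. -/
theorem norm_resS_sq_le (hk : 0 < P.kSq) (h : L2) :
    ‖P.resS hk h‖ ^ 2 ≤ 8 / (min 1 P.kSq) ^ 2 * (inner ℂ h (P.res h)).re := by
  set C := 8 / (min 1 P.kSq) ^ 2
  rw [← Lp.norm_fourier_eq, ← inner_self_eq_norm_sq (𝕜 := ℂ), ← Lp.inner_fourier_eq h, L2.inner_def,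
    L2.inner_def, resS, res, fourier_fmul, fourier_fmul]
  have hi1 := L2.integrable_inner (𝕜 := ℂ) (𝓕 h : L2) (mulCLM P.bddMeas_res (𝓕 h))
  have hi2 := L2.integrable_inner (𝕜 := ℂ) (mulCLM (P.bddMeas_S hk) (𝓕 h))
    (mulCLM (P.bddMeas_S hk) (𝓕 h))
  change RCLike.re (K := ℂ) _ ≤ C * RCLike.re (K := ℂ) _
  rw [← integral_re hi1, ← integral_re hi2, ← integral_const_mul]
  refine integral_mono_ae hi2.re (hi1.re.const_mul _) ?_
  filter_upwards [mulCLM_ae (P.bddMeas_S hk) (𝓕 h), mulCLM_ae P.bddMeas_res (𝓕 h)] with ξ h1 h2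
  rw [h1, h2]
  set f := (𝓕 h : L2) ξ
  have e1 : inner ℂ (((jap ξ / (1 + P.msym ξ ^ 2) : ℝ) : ℂ) * f)
      (((jap ξ / (1 + P.msym ξ ^ 2) : ℝ) : ℂ) * f) =
      (((jap ξ / (1 + P.msym ξ ^ 2)) ^ 2 * ‖f‖ ^ 2 : ℝ) : ℂ) := by
    rw [inner_self_eq_norm_sq_to_K, norm_mul, Complex.norm_real, Real.norm_eq_abs]
    simp only [Complex.coe_algebraMap]
    rw [← Complex.ofReal_pow, mul_pow, sq_abs]
  have e2 : inner ℂ f (((1 / (1 + P.msym ξ ^ 2) : ℝ) : ℂ) * f) =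
      ((1 / (1 + P.msym ξ ^ 2) * ‖f‖ ^ 2 : ℝ) : ℂ) := by
    rw [← smul_eq_mul, inner_smul_right, inner_self_eq_norm_sq_to_K]
    push_cast
    rfl
  rw [e1, e2]
  simp only [RCLike.re_to_complex, Complex.ofReal_re]
  rw [← mul_assoc]
  refine mul_le_mul_of_nonneg_right ?_ (sq_nonneg _)
  rw [div_pow, mul_one_div, div_le_div_iff₀ (by positivity) (by positivity)]
  have := P.jap_sq_le hk ξ
  have h3 := P.one_add_msym_sq_pos ξ
  nlinarith [mul_le_mul_of_nonneg_right this h3.le]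

end Params

/-! ### The algebra property of `H²(ℝ²)` -/

theorem fourierInv_mul_convolution {F G : Plane → ℂ} (hF : Integrable F) (hG : Integrable G)
    (z : Plane) :
    𝓕⁻ (convolution F G (ContinuousLinearMap.mul ℂ ℂ) volume) z = 𝓕⁻ F z * 𝓕⁻ G z := by
  rw [Real.fourierInv_eq_fourier_neg, Real.fourierInv_eq_fourier_neg,
    Real.fourierInv_eq_fourier_neg, Real.fourier_mul_convolution_eq hF hG]

/-- Cauchy–Schwarz applied to the splitting `a·b = a^{1/2}·(a^{1/2}b)`. -/
theorem sq_lintegral_mul_le {a b : Plane → ℝ≥0∞} (ha : AEMeasurable a) (hb : AEMeasurable b) :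
    (∫⁻ η, a η * b η) ^ 2 ≤ (∫⁻ η, a η) * ∫⁻ η, a η * b η ^ 2 := by
  have h := ENNReal.lintegral_mul_le_Lp_mul_Lq volume (p := 2) (q := 2)
    Real.HolderConjugate.two_two (f := fun η => a η ^ (1 / 2 : ℝ))
    (g := fun η => a η ^ (1 / 2 : ℝ) * b η) (ha.pow_const _) ((ha.pow_const _).mul hb)
  have e1 : ∀ η, a η ^ (1 / 2 : ℝ) * (a η ^ (1 / 2 : ℝ) * b η) = a η * b η := fun η => by
    rw [← mul_assoc, ← ENNReal.rpow_add_of_nonneg _ _ (by norm_num) (by norm_num)]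
    norm_num
  have e2 : ∀ η, (a η ^ (1 / 2 : ℝ)) ^ (2 : ℝ) = a η := fun η => by
    rw [← ENNReal.rpow_mul]; norm_num
  have e3 : ∀ η, (a η ^ (1 / 2 : ℝ) * b η) ^ (2 : ℝ) = a η * b η ^ 2 := fun η => by
    rw [ENNReal.mul_rpow_of_nonneg _ _ (by norm_num), e2]; norm_num
  simp only [Pi.mul_apply, e1, e2, e3] at h
  calc (∫⁻ η, a η * b η) ^ 2 ≤ ((∫⁻ η, a η) ^ (1 / 2 : ℝ) *
        (∫⁻ η, a η * b η ^ 2) ^ (1 / 2 : ℝ)) ^ 2 := by gcongr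
    _ = _ := by
      rw [mul_pow, ← ENNReal.rpow_natCast, ← ENNReal.rpow_natCast, ← ENNReal.rpow_mul,
        ← ENNReal.rpow_mul]
      norm_num

/-- Young's inequality `L¹ * L² ⊂ L²`. -/
theorem lintegral_sq_convolution_le {a b : Plane → ℝ≥0∞} (ha : Measurable a) (hb : Measurable b) :
    ∫⁻ ξ, (∫⁻ η, a η * b (ξ - η)) ^ 2 ≤ (∫⁻ η, a η) ^ 2 * ∫⁻ η, b η ^ 2 := by
  calc ∫⁻ ξ, (∫⁻ η, a η * b (ξ - η)) ^ 2
      ≤ ∫⁻ ξ, (∫⁻ η, a η) * ∫⁻ η, a η * b (ξ - η) ^ 2 := by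
        refine lintegral_mono fun ξ => sq_lintegral_mul_le ha.aemeasurable ?_
        exact (hb.comp (measurable_const.sub measurable_id)).aemeasurable
    _ = (∫⁻ η, a η) * ∫⁻ ξ, ∫⁻ η, a η * b (ξ - η) ^ 2 := by
        rw [lintegral_const_mul]
        refine Measurable.lintegral_prod_right' (f := fun p : Plane × Plane =>
          a p.2 * b (p.1 - p.2) ^ 2) ?_
        exact (ha.comp measurable_snd).mul
          ((hb.comp (measurable_fst.sub measurable_snd)).pow_const 2)
    _ = (∫⁻ η, a η) * ∫⁻ η, a η * ∫⁻ ξ, b ξ ^ 2 := by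
        rw [lintegral_lintegral_swap]
        · congr 1
          refine lintegral_congr fun η => ?_
          have hm : Measurable fun ξ => b (ξ - η) ^ 2 :=
            (hb.comp (measurable_id.sub measurable_const)).pow_const 2
          rw [lintegral_const_mul _ hm]
          congr 1
          exact lintegral_sub_right_eq_self (fun ξ => b ξ ^ 2) η
        · exact ((ha.comp measurable_snd).mul
            ((hb.comp (measurable_fst.sub measurable_snd)).pow_const 2)).aemeasurable
    _ = _ := by
        rw [lintegral_mul_const _ ha]
        ring

/-- Lets the weight `jap` be moved under a convolution onto one of the two factors. -/
theorem jap_add_le (ξ η : Plane) : jap (ξ + η) ≤ 2 * (jap ξ + jap η) := by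
  unfold jap
  have h1 := norm_add_le ξ η
  have h2 : ‖ξ + η‖ ^ 2 ≤ 2 * (‖ξ‖ ^ 2 + ‖η‖ ^ 2) := by
    nlinarith [norm_nonneg (ξ + η), norm_nonneg ξ, norm_nonneg η, sq_nonneg (‖ξ‖ - ‖η‖)]
  have h3 : 0 ≤ (2 * Real.pi) ^ 2 := sq_nonneg _
  nlinarith [mul_le_mul_of_nonneg_left h2 h3]

/-- The square decays like `|ξ|⁻⁴`, integrable in dimension two; this is the source of the embedding
of `H²` into functions with integrable Fourier transform. -/
theorem one_div_jap_memLp : MemLp (fun ξ : Plane => 1 / jap ξ) 2 volume := by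
  have h : Integrable (fun ξ : Plane => (1 + ‖ξ‖ ^ 2) ^ (-(4 : ℝ) / 2)) volume :=
    integrable_rpow_neg_one_add_norm_sq (by simp; norm_num)
  have hm : AEStronglyMeasurable (fun ξ : Plane => 1 / jap ξ) volume :=
    (continuous_const.div continuous_jap fun ξ => (jap_pos ξ).ne').aestronglyMeasurable
  rw [memLp_two_iff_integrable_sq hm]
  refine h.mono' (hm.pow 2) (Eventually.of_forall fun ξ => ?_)
  have hp := jap_pos ξ
  have h2 : 1 + ‖ξ‖ ^ 2 ≤ jap ξ := by
    unfold jap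
    have h3 : 1 ≤ 2 * Real.pi := by linarith [Real.pi_gt_three]
    have h4 : ‖ξ‖ ≤ 2 * Real.pi * ‖ξ‖ := le_mul_of_one_le_left (norm_nonneg _) h3
    have := pow_le_pow_left₀ (norm_nonneg _) h4 2
    linarith
  rw [Real.norm_of_nonneg (by positivity), show (-(4 : ℝ) / 2) = -((2 : ℕ) : ℝ) by norm_num,
    Real.rpow_neg (by positivity), Real.rpow_natCast, div_pow, one_pow, one_div]
  gcongr

/-- Constant of the embedding `H²(ℝ²) ⊂ 𝓕L¹`. -/
def japC : ℝ≥0∞ := (∫⁻ ξ : Plane, ‖1 / jap ξ‖ₑ ^ 2) ^ (1 / 2 : ℝ)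

theorem japC_ne_top : japC ≠ ∞ := by
  have := one_div_jap_memLp.2.ne
  rw [eLpNorm_eq_lintegral_rpow_enorm_toReal (by norm_num) (by norm_num)] at this
  simpa only [japC, ENNReal.toReal_ofNat, ENNReal.rpow_ofNat] using this

theorem lintegral_fourier_iota_le (h : L2) :
    ∫⁻ ξ, ‖(𝓕 (iota h) : L2) ξ‖ₑ ≤ japC * ENNReal.ofReal ‖h‖ := by
  have h1 : ∫⁻ ξ, ‖(𝓕 (iota h) : L2) ξ‖ₑ = ∫⁻ ξ, ‖1 / jap ξ‖ₑ * ‖(𝓕 h : L2) ξ‖ₑ := by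
    refine lintegral_congr_ae ?_
    filter_upwards [fourier_iota_ae h] with ξ h1
    rw [h1, enorm_mul, ← ofReal_norm, Complex.norm_real, ofReal_norm]
  rw [h1, ← Lp.norm_fourier_eq h, norm_L2_eq]
  have := ENNReal.lintegral_mul_le_Lp_mul_Lq volume (p := 2) (q := 2)
    Real.HolderConjugate.two_two (f := fun ξ : Plane => ‖1 / jap ξ‖ₑ)
    (g := fun ξ => ‖(𝓕 h : L2) ξ‖ₑ) one_div_jap_memLp.1.enorm
    (Lp.aestronglyMeasurable _).enorm
  simpa [japC] using this

theorem integrable_fourier_iota (h : L2) : Integrable ((𝓕 (iota h) : L2) : Plane → ℂ) :=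
  ⟨Lp.aestronglyMeasurable _, (lintegral_fourier_iota_le h).trans_lt
    (ENNReal.mul_lt_top japC_ne_top.lt_top ENNReal.ofReal_lt_top)⟩

theorem iota_ae_eq (h : L2) :
    (iota h : Plane → ℂ) =ᵐ[volume] 𝓕⁻ ((𝓕 (iota h) : L2) : Plane → ℂ) := by
  have := fourierInv_ae_eq (integrable_fourier_iota h)
  rwa [FourierTransform.fourierInv_fourier_eq] at this

theorem exists_iota_of_fourier {H : Plane → ℂ}
    (hJ : MemLp (fun ξ => (jap ξ : ℂ) * H ξ) 2 volume) :
    ∃ b : L2, (iota b : Plane → ℂ) =ᵐ[volume] 𝓕⁻ H ∧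
      ENNReal.ofReal ‖b‖ = (∫⁻ ξ, ‖(jap ξ : ℂ) * H ξ‖ₑ ^ 2) ^ (1 / 2 : ℝ) := by
  refine ⟨(𝓕⁻ hJ.toLp : L2), ?_, ?_⟩
  · have e : ((𝓕 (iota (𝓕⁻ hJ.toLp : L2)) : L2) : Plane → ℂ) =ᵐ[volume] H := by
      filter_upwards [fourier_iota_ae (𝓕⁻ hJ.toLp : L2), hJ.coeFn_toLp] with ξ h1 h2
      rw [h1, FourierTransform.fourier_fourierInv_eq, h2, ← mul_assoc]
      have := (jap_pos ξ).ne'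
      norm_cast
      rw [one_div_mul_cancel this, Complex.ofReal_one, one_mul]
    filter_upwards [iota_ae_eq (𝓕⁻ hJ.toLp : L2)] with z h1
    rw [h1, Real.fourierInv_congr_ae e]
  · rw [← Lp.norm_fourier_eq, FourierTransform.fourier_fourierInv_eq, norm_L2_eq]
    congr 1
    refine lintegral_congr_ae ?_
    filter_upwards [hJ.coeFn_toLp] with ξ h2
    rw [h2]

/-- The Fourier transform of a product is a convolution. The weight `jap` falls on one factor, which
is then in `L²`, while the other stays in `L¹` by `lintegral_fourier_iota_le`; Young's inequality
gives the bound. -/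
theorem exists_iota_mul (h k : L2) :
    ∃ b : L2, (iota b : Plane → ℂ) =ᵐ[volume] (fun z => iota h z * iota k z) ∧
      ‖b‖ ≤ (4 * japC.toReal) * ‖h‖ * ‖k‖ := by
  set F : Plane → ℂ := ((𝓕 (iota h) : L2) : Plane → ℂ)
  set G : Plane → ℂ := ((𝓕 (iota k) : L2) : Plane → ℂ)
  have hFm : StronglyMeasurable F := Lp.stronglyMeasurable _
  have hGm : StronglyMeasurable G := Lp.stronglyMeasurable _
  have hFi : Integrable F := integrable_fourier_iota h
  have hGi : Integrable G := integrable_fourier_iota k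
  set H := convolution F G (ContinuousLinearMap.mul ℂ ℂ) volume
  have hHi : Integrable H := hFi.integrable_convolution (ContinuousLinearMap.mul ℂ ℂ) hGi
  set a : Plane → ℝ≥0∞ := fun ξ => ‖F ξ‖ₑ
  set b : Plane → ℝ≥0∞ := fun ξ => ‖G ξ‖ₑ
  set J : Plane → ℝ≥0∞ := fun ξ => ENNReal.ofReal (jap ξ)
  have ham : Measurable a := hFm.measurable.enorm
  have hbm : Measurable b := hGm.measurable.enorm
  have hJm : Measurable J := (continuous_jap.measurable).ennreal_ofReal
  have hJn : ∀ ξ, ‖(jap ξ : ℂ)‖ₑ = J ξ := fun ξ => by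
    rw [← ofReal_norm, Complex.norm_real, Real.norm_of_nonneg (jap_pos ξ).le]
  have hnorm : ∀ l : L2, ∫⁻ ξ, (J ξ * ‖(𝓕 (iota l) : L2) ξ‖ₑ) ^ 2 = ENNReal.ofReal ‖l‖ ^ 2 := by
    intro l
    rw [← Lp.norm_fourier_eq l, norm_L2_eq, ← ENNReal.rpow_natCast, ← ENNReal.rpow_mul]
    norm_num
    refine lintegral_congr_ae ?_
    filter_upwards [fourier_iota_ae l] with ξ h1
    rw [h1, ← hJn, ← enorm_mul, ← mul_assoc]
    have := (jap_pos ξ).ne'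
    norm_cast
    rw [mul_one_div_cancel this, Complex.ofReal_one, one_mul]
  have hpt : ∀ ξ, ‖(jap ξ : ℂ) * H ξ‖ₑ ≤
      2 * ((∫⁻ η, a η * (J (ξ - η) * b (ξ - η))) + ∫⁻ η, b η * (J (ξ - η) * a (ξ - η))) := by
    intro ξ
    have e1 : ‖H ξ‖ₑ ≤ ∫⁻ η, a η * b (ξ - η) := by
      simp only [H]
      rw [convolution_def]
      refine (enorm_integral_le_lintegral_enorm _).trans_eq (lintegral_congr fun η => ?_)
      rw [ContinuousLinearMap.mul_apply', enorm_mul]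
    have e2 : ∫⁻ η, b η * (J (ξ - η) * a (ξ - η)) = ∫⁻ η, b (ξ - η) * (J η * a η) := by
      rw [← lintegral_sub_left_eq_self _ ξ]
      simp
    rw [enorm_mul, hJn, e2, ← lintegral_add_left, ← lintegral_const_mul]
    · refine (mul_le_mul_right e1 _).trans ?_
      rw [← lintegral_const_mul]
      · refine lintegral_mono fun η => ?_
        have e3 : J ξ ≤ 2 * (J η + J (ξ - η)) := by
          have := jap_add_le η (ξ - η)
          rw [add_sub_cancel] at this
          calc J ξ ≤ ENNReal.ofReal (2 * (jap η + jap (ξ - η))) := ENNReal.ofReal_le_ofReal this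
            _ = _ := by
              rw [ENNReal.ofReal_mul (by norm_num),
                ENNReal.ofReal_add (jap_pos _).le (jap_pos _).le]
              norm_num [J]
        calc J ξ * (a η * b (ξ - η)) ≤ 2 * (J η + J (ξ - η)) * (a η * b (ξ - η)) := by gcongr
          _ = _ := by ring
      · exact ham.mul (hbm.comp (measurable_const.sub measurable_id))
    · exact (ham.mul (((hJm.mul hbm).comp (measurable_const.sub measurable_id)))).add
        ((hbm.comp (measurable_const.sub measurable_id)).mul (hJm.mul ham))
    · exact ham.mul (((hJm.mul hbm).comp (measurable_const.sub measurable_id)))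
  have hmeas : AEStronglyMeasurable (fun ξ => (jap ξ : ℂ) * H ξ) volume :=
    (Complex.continuous_ofReal.comp continuous_jap).aestronglyMeasurable.mul hHi.1
  have hsq : (∫⁻ ξ, ‖(jap ξ : ℂ) * H ξ‖ₑ ^ 2) ^ (1 / 2 : ℝ) ≤
      4 * japC * ENNReal.ofReal ‖h‖ * ENNReal.ofReal ‖k‖ := by
    -- Squaring the pointwise bound `2(x + y)` costs `8x² + 8y²`, and each of the two integrals is
    -- at most `(japC‖h‖‖k‖)²`; the total `16` is the square of the constant `4`.
    have e4 : ∫⁻ ξ, ‖(jap ξ : ℂ) * H ξ‖ₑ ^ 2 ≤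
        (4 * japC * ENNReal.ofReal ‖h‖ * ENNReal.ofReal ‖k‖) ^ 2 := by
      calc ∫⁻ ξ, ‖(jap ξ : ℂ) * H ξ‖ₑ ^ 2
          ≤ ∫⁻ ξ, (8 * (∫⁻ η, a η * (J (ξ - η) * b (ξ - η))) ^ 2 +
              8 * (∫⁻ η, b η * (J (ξ - η) * a (ξ - η))) ^ 2) := by
            refine lintegral_mono fun ξ => ?_
            refine (pow_le_pow_left' (hpt ξ) 2).trans ?_
            rw [mul_pow]
            have key : ∀ x y : ℝ≥0∞, (x + y) ^ 2 ≤ 2 * (x ^ 2 + y ^ 2) := fun x y => by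
              have := ENNReal.rpow_add_le_mul_rpow_add_rpow x y (p := 2) (by norm_num)
              norm_num at this
              exact this
            calc _ ≤ (2 : ℝ≥0∞) ^ 2 * (2 * (_ ^ 2 + _ ^ 2)) := by gcongr; exact key _ _
              _ = _ := by ring
        _ = 8 * (∫⁻ ξ, (∫⁻ η, a η * (J (ξ - η) * b (ξ - η))) ^ 2) +
              8 * ∫⁻ ξ, (∫⁻ η, b η * (J (ξ - η) * a (ξ - η))) ^ 2 := by
            have m1 : Measurable fun ξ => ∫⁻ η, a η * (J (ξ - η) * b (ξ - η)) :=
              Measurable.lintegral_prod_right' (f := fun p : Plane × Plane =>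
                a p.2 * (J (p.1 - p.2) * b (p.1 - p.2))) ((ham.comp measurable_snd).mul
                  ((hJm.mul hbm).comp (measurable_fst.sub measurable_snd)))
            have m2 : Measurable fun ξ => ∫⁻ η, b η * (J (ξ - η) * a (ξ - η)) :=
              Measurable.lintegral_prod_right' (f := fun p : Plane × Plane =>
                b p.2 * (J (p.1 - p.2) * a (p.1 - p.2))) ((hbm.comp measurable_snd).mul
                  ((hJm.mul ham).comp (measurable_fst.sub measurable_snd)))
            rw [lintegral_add_left ((m1.pow_const 2).const_mul 8),
              lintegral_const_mul _ (m1.pow_const 2), lintegral_const_mul _ (m2.pow_const 2)]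
        _ ≤ 8 * ((japC * ENNReal.ofReal ‖h‖) ^ 2 * ENNReal.ofReal ‖k‖ ^ 2) +
              8 * ((japC * ENNReal.ofReal ‖k‖) ^ 2 * ENNReal.ofReal ‖h‖ ^ 2) := by
            gcongr
            · refine (lintegral_sq_convolution_le ham (hJm.mul hbm)).trans ?_
              have := hnorm k
              simp only [Pi.mul_apply] 
              rw [this]
              gcongr
              exact lintegral_fourier_iota_le h
            · refine (lintegral_sq_convolution_le hbm (hJm.mul ham)).trans ?_
              have := hnorm h
              simp only [Pi.mul_apply] 
              rw [this]
              gcongr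
              exact lintegral_fourier_iota_le k
        _ = _ := by ring
    calc _ ≤ ((4 * japC * ENNReal.ofReal ‖h‖ * ENNReal.ofReal ‖k‖) ^ 2) ^ (1 / 2 : ℝ) := by gcongr
      _ = _ := by
        rw [← ENNReal.rpow_natCast, ← ENNReal.rpow_mul]
        norm_num
  have hfin : 4 * japC * ENNReal.ofReal ‖h‖ * ENNReal.ofReal ‖k‖ < ∞ :=
    ENNReal.mul_lt_top (ENNReal.mul_lt_top (ENNReal.mul_lt_top (by norm_num) japC_ne_top.lt_top)
      ENNReal.ofReal_lt_top) ENNReal.ofReal_lt_top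
  have hmem : MemLp (fun ξ => (jap ξ : ℂ) * H ξ) 2 volume := by
    refine ⟨hmeas, ?_⟩
    rw [eLpNorm_eq_lintegral_rpow_enorm_toReal (by norm_num) (by norm_num)]
    simpa using hsq.trans_lt hfin
  obtain ⟨c, hc1, hc2⟩ := exists_iota_of_fourier hmem
  refine ⟨c, ?_, ?_⟩
  · filter_upwards [hc1, iota_ae_eq h, iota_ae_eq k] with z h1 h2 h3
    rw [h1, h2, h3]
    exact fourierInv_mul_convolution hFi hGi z
  · rw [← hc2] at hsq
    have := ENNReal.toReal_mono hfin.ne hsq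
    simpa [ENNReal.toReal_mul] using this

/-- Two elements of `H²` that agree almost everywhere have the same preimage under `iota`. -/
theorem iota_inj_ae {h k : L2} (e : (iota h : Plane → ℂ) =ᵐ[volume] iota k) : h = k :=
  iota_injective (Lp.ext e)

/-- The preimage under `iota` of the product of two elements of `H²(ℝ²)`. -/
def mulHFun (h k : L2) : L2 := (exists_iota_mul h k).choose

theorem iota_mulHFun_ae (h k : L2) :
    (iota (mulHFun h k) : Plane → ℂ) =ᵐ[volume] fun z => iota h z * iota k z :=
  (exists_iota_mul h k).choose_spec.1

/-- The multiplication of `H²(ℝ²)`, transported by `iota`. -/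
def mulH : L2 →L[ℂ] L2 →L[ℂ] L2 :=
  LinearMap.mkContinuous₂
    (LinearMap.mk₂ ℂ mulHFun
      (fun h h' k => iota_inj_ae (by
        rw [map_add]
        filter_upwards [iota_mulHFun_ae (h + h') k,
          iota_mulHFun_ae h k, iota_mulHFun_ae h' k,
          Lp.coeFn_add (iota (mulHFun h k)) (iota (mulHFun h' k)),
          Lp.coeFn_add (iota h) (iota h')] with z h1 h2 h3 h4 h5
        rw [h1, h4, Pi.add_apply, h2, h3, map_add, h5, Pi.add_apply, add_mul]))
      (fun c h k => iota_inj_ae (by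
        rw [map_smul]
        filter_upwards [iota_mulHFun_ae (c • h) k,
          iota_mulHFun_ae h k,
          Lp.coeFn_smul c (iota (mulHFun h k)),
          Lp.coeFn_smul c (iota h)] with z h1 h2 h4 h5
        rw [h1, h4, Pi.smul_apply, h2, map_smul, h5, Pi.smul_apply, smul_eq_mul, smul_eq_mul,
          mul_assoc]))
      (fun h k k' => iota_inj_ae (by
        rw [map_add]
        filter_upwards [iota_mulHFun_ae h (k + k'),
          iota_mulHFun_ae h k, iota_mulHFun_ae h k',
          Lp.coeFn_add (iota (mulHFun h k)) (iota (mulHFun h k')),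
          Lp.coeFn_add (iota k) (iota k')] with z h1 h2 h3 h4 h5
        rw [h1, h4, Pi.add_apply, h2, h3, map_add, h5, Pi.add_apply, mul_add]))
      (fun c h k => iota_inj_ae (by
        rw [map_smul]
        filter_upwards [iota_mulHFun_ae h (c • k),
          iota_mulHFun_ae h k,
          Lp.coeFn_smul c (iota (mulHFun h k)),
          Lp.coeFn_smul c (iota k)] with z h1 h2 h4 h5
        rw [h1, h4, Pi.smul_apply, h2, map_smul, h5, Pi.smul_apply, smul_eq_mul, smul_eq_mul,
          mul_left_comm])))
    (4 * japC.toReal) (fun h k => (exists_iota_mul h k).choose_spec.2)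

theorem iota_mulH_ae (h k : L2) :
    (iota (mulH h k) : Plane → ℂ) =ᵐ[volume] fun z => iota h z * iota k z :=
  iota_mulHFun_ae h k

/-! ### Fourier series of `2π`-periodic functions -/

/-- The exponential `x ↦ e^{inx}`. -/
def ex (n : ℤ) (x : ℝ) : ℂ := Complex.exp (Complex.I * n * x)

theorem norm_ex (n : ℤ) (x : ℝ) : ‖ex n x‖ = 1 := by
  rw [ex, show Complex.I * n * x = ((n * x : ℝ) : ℂ) * Complex.I by push_cast; ring]
  exact Complex.norm_exp_ofReal_mul_I _

theorem continuous_ex (n : ℤ) : Continuous (ex n) := by unfold ex; fun_prop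

theorem ex_add (m n : ℤ) (x : ℝ) : ex (m + n) x = ex m x * ex n x := by
  rw [ex, ex, ex, ← Complex.exp_add]
  push_cast
  ring_nf

theorem ex_zero (x : ℝ) : ex 0 x = 1 := by simp [ex]

theorem periodic_ex (n : ℤ) : Function.Periodic (ex n) (2 * Real.pi) := by
  intro x
  rw [ex, ex, Complex.exp_eq_exp_iff_exists_int]
  exact ⟨n, by push_cast; ring⟩

theorem hasDerivAt_ex (n : ℤ) (x : ℝ) : HasDerivAt (ex n) (Complex.I * n * ex n x) x := by
  have h1 : HasDerivAt (fun x : ℝ => Complex.I * n * (x : ℂ)) (Complex.I * n) x := by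
    simpa using (Complex.ofRealCLM.hasDerivAt (x := x)).const_mul (Complex.I * n)
  have := h1.cexp
  rw [mul_comm (Complex.exp _)] at this
  exact this

/-- The Fourier coefficients of a function on `[0, 2π]`. -/
def coef (f : ℝ → ℂ) (n : ℤ) : ℂ := fourierCoeffOn Real.two_pi_pos f n

theorem coef_eq_integral (f : ℝ → ℂ) (n : ℤ) :
    coef f n = (1 / (2 * Real.pi) : ℝ) * ∫ x in (0 : ℝ)..2 * Real.pi, ex (-n) x * f x := by
  rw [coef, fourierCoeffOn_eq_integral, Complex.real_smul, sub_zero]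
  congr 1
  refine intervalIntegral.integral_congr fun x _ => ?_
  simp only [smul_eq_mul]
  rw [fourier_coe_apply, ex]
  congr 2
  have : (Real.pi : ℂ) ≠ 0 := by exact_mod_cast Real.pi_ne_zero
  push_cast
  field_simp

theorem norm_coef_le {f : ℝ → ℂ} {C : ℝ} (hC : ∀ x, ‖f x‖ ≤ C) (n : ℤ) : ‖coef f n‖ ≤ C := by
  rw [coef_eq_integral, norm_mul, Complex.norm_real, Real.norm_of_nonneg (by positivity)]
  have h := intervalIntegral.norm_integral_le_of_norm_le_const (a := 0) (b := 2 * Real.pi)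
    (f := fun x => ex (-n) x * f x) (C := C) fun x _ => by
      rw [norm_mul, norm_ex, one_mul]; exact hC x
  rw [sub_zero, abs_of_pos Real.two_pi_pos] at h
  calc _ ≤ 1 / (2 * Real.pi) * (C * (2 * Real.pi)) := by gcongr
    _ = C := by field_simp

theorem coef_add {f g : ℝ → ℂ} (hf : Continuous f) (hg : Continuous g) (n : ℤ) :
    coef (fun x => f x + g x) n = coef f n + coef g n := by
  rw [coef_eq_integral, coef_eq_integral, coef_eq_integral, ← mul_add]
  simp only [mul_add (ex _ _)]
  rw [intervalIntegral.integral_add (f := fun x => ex (-n) x * f x) (g := fun x => ex (-n) x * g x)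
    (((continuous_ex _).mul hf).intervalIntegrable _ _)
    (((continuous_ex _).mul hg).intervalIntegrable _ _)]

theorem coef_const_mul (c : ℂ) (f : ℝ → ℂ) (n : ℤ) :
    coef (fun x => c * f x) n = c * coef f n := by
  rw [coef_eq_integral, coef_eq_integral]
  simp only [mul_left_comm _ c]
  rw [intervalIntegral.integral_const_mul, mul_left_comm]

theorem coef_ex_mul (m n : ℤ) (f : ℝ → ℂ) :
    coef (fun x => ex m x * f x) n = coef f (n - m) := by
  rw [coef_eq_integral, coef_eq_integral]
  congr 1
  refine intervalIntegral.integral_congr fun x _ => ?_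
  rw [← mul_assoc, ← ex_add, neg_sub, sub_eq_add_neg, add_comm]

theorem coef_deriv {f f' : ℝ → ℂ} (hf : ∀ x, HasDerivAt f (f' x) x) (hf' : Continuous f')
    (hp : Function.Periodic f (2 * Real.pi)) (n : ℤ) :
    coef f' n = Complex.I * n * coef f n := by
  rw [coef_eq_integral, coef_eq_integral]
  have h1 := intervalIntegral.integral_eq_sub_of_hasDerivAt (a := 0) (b := 2 * Real.pi)
    (f := fun x => ex (-n) x * f x)
    (f' := fun x => Complex.I * (-n : ℤ) * ex (-n) x * f x + ex (-n) x * f' x)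
    (fun x _ => (hasDerivAt_ex (-n) x).mul (hf x)) (by
      have : Continuous f := continuous_iff_continuousAt.2 fun x => (hf x).continuousAt
      have := continuous_ex (-n)
      refine Continuous.intervalIntegrable ?_ _ _
      fun_prop)
  have hfc : Continuous f := continuous_iff_continuousAt.2 fun x => (hf x).continuousAt
  rw [intervalIntegral.integral_add] at h1
  · have e1 : (∫ x in (0 : ℝ)..2 * Real.pi, Complex.I * (-n : ℤ) * ex (-n) x * f x) =
        Complex.I * (-n : ℤ) * ∫ x in (0 : ℝ)..2 * Real.pi, ex (-n) x * f x := by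
      rw [← intervalIntegral.integral_const_mul]
      simp only [mul_assoc]
    have e2 : ex (-n) (2 * Real.pi) * f (2 * Real.pi) - ex (-n) 0 * f 0 = 0 := by
      have := hp 0
      have h3 := periodic_ex (-n) 0
      rw [zero_add] at this h3
      rw [this, h3, sub_self]
    rw [e1, e2] at h1
    push_cast at h1
    linear_combination ((1 / (2 * Real.pi) : ℝ) : ℂ) * h1
  · have := continuous_ex (-n)
    refine Continuous.intervalIntegrable ?_ _ _
    fun_prop
  · have := continuous_ex (-n)
    refine Continuous.intervalIntegrable ?_ _ _
    fun_prop

theorem hasSum_coef {f : ℝ → ℂ} (hf : Continuous f) (hp : Function.Periodic f (2 * Real.pi))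
    (hs : Summable fun n => ‖coef f n‖) (x : ℝ) :
    HasSum (fun n => coef f n * ex n x) (f x) := by
  have : Fact (0 < 2 * Real.pi) := ⟨Real.two_pi_pos⟩
  let F : C(AddCircle (2 * Real.pi), ℂ) := ⟨hp.lift, by
    refine continuous_coinduced_dom.2 ?_
    exact hf⟩
  have hcoef : ∀ n, fourierCoeff F n = coef f n := fun n => by
    rw [fourierCoeff_eq_intervalIntegral _ n 0, coef_eq_integral, zero_add, Complex.real_smul]
    congr 1
    refine intervalIntegral.integral_congr fun x _ => ?_
    simp only [smul_eq_mul]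
    rw [fourier_coe_apply, ex]
    have : (Real.pi : ℂ) ≠ 0 := by exact_mod_cast Real.pi_ne_zero
    congr 2
    push_cast
    field_simp
  have h := has_pointwise_sum_fourier_series_of_summable (f := F)
    (by rw [show fourierCoeff F = coef f from funext hcoef]; exact hs.of_norm) (x : AddCircle (2 * Real.pi))
  have e : F (x : AddCircle (2 * Real.pi)) = f x := rfl
  rw [e] at h
  convert h using 2 with n
  rw [hcoef, smul_eq_mul, fourier_coe_apply, ex]
  have : (Real.pi : ℂ) ≠ 0 := by exact_mod_cast Real.pi_ne_zero
  congr 2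
  push_cast
  field_simp

theorem periodic_deriv {f : ℝ → ℂ} {T : ℝ} (hp : Function.Periodic f T) :
    Function.Periodic (deriv f) T := fun x => by
  rw [← deriv_comp_add_const, show (fun x => f (x + T)) = f from funext hp]

theorem exists_bound_of_periodic {f : ℝ → ℂ} (hf : Continuous f)
    (hp : Function.Periodic f (2 * Real.pi)) : ∃ C, ∀ x, ‖f x‖ ≤ C := by
  obtain ⟨C, hC⟩ := (isCompact_Icc (a := (0 : ℝ)) (b := 2 * Real.pi)).exists_bound_of_continuousOn
    hf.continuousOn
  refine ⟨C, fun x => ?_⟩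
  obtain ⟨y, hy, hxy⟩ := hp.exists_mem_Ico₀ Real.two_pi_pos x
  rw [hxy]
  exact hC y (Ico_subset_Icc_self hy)

/-- Integration by parts `k` times: each derivative multiplies the coefficient by `in`. -/
theorem exists_coef_bound (k : ℕ) : ∀ {f : ℝ → ℂ}, ContDiff ℝ k f →
    Function.Periodic f (2 * Real.pi) → ∃ C, ∀ n : ℤ, |(n : ℝ)| ^ k * ‖coef f n‖ ≤ C := by
  induction k with
  | zero =>
    intro f hf hp
    obtain ⟨C, hC⟩ := exists_bound_of_periodic hf.continuous hp
    exact ⟨C, fun n => by simpa using norm_coef_le hC n⟩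
  | succ k ih =>
    intro f hf hp
    have hf' : ContDiff ℝ k (deriv f) := by
      rw [show ((k + 1 : ℕ) : WithTop ℕ∞) = (k : WithTop ℕ∞) + 1 by push_cast; rfl] at hf
      exact (contDiff_succ_iff_deriv.1 hf).2.2
    have hd : Differentiable ℝ f := hf.differentiable (by simp)
    obtain ⟨C, hC⟩ := ih hf' (periodic_deriv hp)
    refine ⟨C, fun n => ?_⟩
    have := hC n
    rw [coef_deriv (fun x => (hd x).hasDerivAt) hf'.continuous hp, norm_mul, norm_mul,
      Complex.norm_I, one_mul, Complex.norm_intCast] at this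
    rw [pow_succ, mul_assoc]
    exact this

theorem summable_one_div_one_add_sq : Summable fun n : ℤ => 1 / (1 + (n : ℝ) ^ 2) := by
  have h := (Real.summable_one_div_int_pow (p := 2)).2 (by norm_num)
  have h2 : Summable fun n : ℤ => 1 / (n : ℝ) ^ 2 + if n = 0 then 1 else 0 :=
    h.add (summable_of_ne_finset_zero (s := {0}) (by intro b hb; simp at hb; simp [hb]))
  refine Summable.of_nonneg_of_le (fun n => by positivity) (fun n => ?_) h2
  by_cases hn : n = 0
  · simp [hn]
  · simp only [hn, if_false, add_zero]
    have : 0 < (n : ℝ) ^ 2 := by positivity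
    gcongr
    linarith

/-- The Fourier coefficients of a `C⁴` periodic function are summable with weight `1 + n²`. -/
theorem summable_coef {f : ℝ → ℂ} (hf : ContDiff ℝ 4 f)
    (hp : Function.Periodic f (2 * Real.pi)) :
    Summable fun n : ℤ => (1 + (n : ℝ) ^ 2) * ‖coef f n‖ := by
  obtain ⟨C, hC⟩ := exists_coef_bound 4 hf hp
  obtain ⟨C', hC'⟩ := exists_coef_bound 0 (hf.of_le (by norm_num)) hp
  refine Summable.of_nonneg_of_le (fun n => by positivity) (fun n => ?_)
    (summable_one_div_one_add_sq.mul_left (2 * (C + C')))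
  have h1 := hC n
  have h2 := hC' n
  rw [Even.pow_abs (by decide)] at h1
  simp only [pow_zero, one_mul] at h2
  -- Uses `(1 + n²)² ≤ 2(1 + n⁴)`, with the bounds of orders four and zero.
  rw [mul_one_div, le_div_iff₀ (by positivity)]
  nlinarith [norm_nonneg (coef f n), mul_nonneg (sq_nonneg ((n : ℝ) ^ 2 - 1)) (norm_nonneg (coef f n))]

theorem summable_norm_coef {f : ℝ → ℂ} (hf : ContDiff ℝ 4 f)
    (hp : Function.Periodic f (2 * Real.pi)) : Summable fun n : ℤ => ‖coef f n‖ :=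
  Summable.of_nonneg_of_le (fun n => norm_nonneg _)
    (fun n => le_mul_of_one_le_left (norm_nonneg _) (by nlinarith [sq_nonneg (n : ℝ)]))
    (summable_coef hf hp)

/-- The coefficients of a product are given by the convolution of the coefficients. -/
theorem hasSum_coef_mul {f g : ℝ → ℂ} {a : ℤ → ℂ} (ha : Summable fun n => ‖a n‖)
    (hf : ∀ x, HasSum (fun n => a n * ex n x) (f x)) (hg : Continuous g)
    (hp : Function.Periodic g (2 * Real.pi)) (n : ℤ) :
    HasSum (fun m => a m * coef g (n - m)) (coef (fun x => f x * g x) n) := by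
  obtain ⟨C, hC⟩ := exists_bound_of_periodic hg hp
  have h := intervalIntegral.hasSum_integral_of_dominated_convergence (μ := volume)
    (a := 0) (b := 2 * Real.pi) (F := fun m x => ex (-n) x * (a m * ex m x * g x))
    (f := fun x => ex (-n) x * (f x * g x)) (fun m _ => ‖a m‖ * C)
    (fun m => by
      have h1 := continuous_ex (-n)
      have h2 := continuous_ex m
      refine Continuous.aestronglyMeasurable ?_
      fun_prop)
    (fun m => Eventually.of_forall fun x _ => by
      rw [norm_mul, norm_mul, norm_mul, norm_ex, norm_ex, one_mul, mul_one]
      exact mul_le_mul_of_nonneg_left (hC x) (norm_nonneg _))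
    (Eventually.of_forall fun x _ => ha.mul_right C)
    (by simp)
    (Eventually.of_forall fun x _ => ((hf x).mul_right _).mul_left _)
  rw [coef_eq_integral]
  refine (h.mul_left ((1 / (2 * Real.pi) : ℝ) : ℂ)).congr_fun fun m => ?_
  rw [← coef_ex_mul m n g, ← coef_const_mul, coef_eq_integral]
  simp only [mul_assoc]

theorem coef_one (n : ℤ) : coef (fun _ => 1) n = if n = 0 then 1 else 0 := by
  split_ifs with h
  · subst h
    rw [coef_eq_integral]
    simp only [neg_zero, ex_zero, mul_one]
    rw [intervalIntegral.integral_const]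
    have : (Real.pi : ℂ) ≠ 0 := by exact_mod_cast Real.pi_ne_zero
    simp
    field_simp
  · have := coef_deriv (f := fun _ => 1) (f' := fun _ => 0) (fun x => hasDerivAt_const x _)
      continuous_const (fun _ => rfl) n
    have h0 : coef (fun _ => (0 : ℂ)) n = 0 := by simp [coef_eq_integral]
    rw [h0] at this
    have hn : (n : ℂ) ≠ 0 := by exact_mod_cast h
    simpa [hn] using this.symm

theorem coef_of_hasSum {f : ℝ → ℂ} {a : ℤ → ℂ} (ha : Summable fun n => ‖a n‖)
    (hf : ∀ x, HasSum (fun n => a n * ex n x) (f x)) (n : ℤ) : coef f n = a n := by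
  -- Multiplying by the constant `1`, whose only nonzero coefficient is at `0`, collapses the
  -- convolution to one term.
  have h := hasSum_coef_mul ha hf (g := fun _ => 1) continuous_const (fun _ => rfl) n
  simp only [mul_one, coef_one] at h
  refine h.unique ?_
  convert hasSum_single n (fun m hm => ?_) using 1
  · simp
  · have : n - m ≠ 0 := sub_ne_zero.2 (Ne.symm hm)
    simp [this]

/-! ### Trigonometric series -/

/-- The trigonometric series with coefficients `c`. -/
def ser (c : ℤ → ℂ) (x : ℝ) : ℂ := ∑' n, c n * ex n x

theorem hasSum_ser {c : ℤ → ℂ} (hc : Summable fun n => ‖c n‖) (x : ℝ) :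
    HasSum (fun n => c n * ex n x) (ser c x) :=
  (Summable.of_norm (by simpa [norm_ex] using hc)).hasSum

theorem continuous_ser {c : ℤ → ℂ} (hc : Summable fun n => ‖c n‖) : Continuous (ser c) :=
  continuous_tsum (fun n => continuous_const.mul (continuous_ex n)) hc fun n x => by
    rw [norm_mul, norm_ex, mul_one]

theorem periodic_ser (c : ℤ → ℂ) : Function.Periodic (ser c) (2 * Real.pi) := fun x => by
  simp only [ser, periodic_ex _ x]

theorem hasDerivAt_ser {c : ℤ → ℂ} (hc : Summable fun n => ‖c n‖)
    (hc' : Summable fun n => ‖Complex.I * n * c n‖) (x : ℝ) :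
    HasDerivAt (ser c) (ser (fun n => Complex.I * n * c n) x) x := by
  refine hasDerivAt_tsum (𝕜 := ℝ) (F := ℂ) (g := fun n x => c n * ex n x)
    (g' := fun n x => Complex.I * n * c n * ex n x)
    (u := fun n => ‖Complex.I * n * c n‖) (y₀ := 0) hc'
    (fun n y => ?_) (fun n y => ?_) ?_ x
  · exact ((hasDerivAt_ex n y).const_mul (c n)).congr_deriv (by ring)
  · rw [norm_mul, norm_ex, mul_one]
  · exact (hasSum_ser hc 0).summable

theorem contDiff_ser (k : ℕ) : ∀ {c : ℤ → ℂ},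
    (Summable fun n : ℤ => (1 + |(n : ℝ)|) ^ k * ‖c n‖) → ContDiff ℝ k (ser c) := by
  induction k with
  | zero =>
    intro c hc
    simp only [pow_zero, one_mul] at hc
    exact contDiff_zero.2 (continuous_ser hc)
  | succ k ih =>
    intro c hc
    have hpos : ∀ n : ℤ, 1 ≤ 1 + |(n : ℝ)| := fun n => by linarith [abs_nonneg (n : ℝ)]
    have h1 : Summable fun n => ‖c n‖ := Summable.of_nonneg_of_le (fun n => norm_nonneg _)
      (fun n => le_mul_of_one_le_left (norm_nonneg _) (one_le_pow₀ (hpos n))) hc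
    have h3 : Summable fun n : ℤ => (1 + |(n : ℝ)|) ^ k * ‖Complex.I * n * c n‖ :=
      Summable.of_nonneg_of_le (fun n => by positivity) (fun n => by
        rw [norm_mul, norm_mul, Complex.norm_I, one_mul, Complex.norm_intCast, pow_succ, mul_assoc]
        gcongr
        linarith) hc
    have h2 : Summable fun n => ‖Complex.I * n * c n‖ :=
      Summable.of_nonneg_of_le (fun n => norm_nonneg _)
        (fun n => le_mul_of_one_le_left (norm_nonneg _) (one_le_pow₀ (hpos n))) h3
    rw [show ((k + 1 : ℕ) : WithTop ℕ∞) = (k : WithTop ℕ∞) + 1 by push_cast; rfl,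
      contDiff_succ_iff_deriv]
    refine ⟨fun x => (hasDerivAt_ser h1 h2 x).differentiableAt, by simp, ?_⟩
    rw [show deriv (ser c) = ser (fun n => Complex.I * n * c n) from
      funext fun x => (hasDerivAt_ser h1 h2 x).deriv]
    exact ih h3

/-! ### The top of the spectrum of a form with compact resolvent -/

section Spectral

variable {H : Type*} [NormedAddCommGroup H] [InnerProductSpace ℂ H]

/-- Positivity of the form is tested at `x - t S x` with `t = 1/(‖S‖ + 1)`, the usual substitute for
Cauchy–Schwarz in the semidefinite form of `S`. A vector on which the form is nearly zero is
therefore nearly in the kernel. -/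
theorem norm_sq_le_of_nonneg {S : H →L[ℂ] H}
    (hs : ∀ x y, inner ℂ (S x) y = inner ℂ x (S y)) (hp : ∀ x, 0 ≤ (inner ℂ (S x) x).re) (x : H) :
    ‖S x‖ ^ 2 ≤ (‖S‖ + 1) * (inner ℂ (S x) x).re := by
  set t : ℝ := 1 / (‖S‖ + 1) with ht
  have hS : 0 < ‖S‖ + 1 := by positivity
  have h := hp (x - (t : ℂ) • S x)
  have e : (inner ℂ (S (x - (t : ℂ) • S x)) (x - (t : ℂ) • S x)).re =
      (inner ℂ (S x) x).re - 2 * t * ‖S x‖ ^ 2 + t ^ 2 * (inner ℂ (S (S x)) (S x)).re := by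
    rw [map_sub, map_smul, inner_sub_left, inner_sub_right, inner_sub_right, inner_smul_left,
      inner_smul_left, inner_smul_right, inner_smul_right, hs (S x) x,
      inner_self_eq_norm_sq_to_K]
    simp only [Complex.conj_ofReal, Complex.coe_algebraMap, Complex.sub_re, Complex.re_ofReal_mul,
      ← Complex.ofReal_pow, Complex.ofReal_re]
    ring
  have h1 : (inner ℂ (S (S x)) (S x)).re ≤ ‖S‖ * ‖S x‖ ^ 2 := by
    refine (Complex.re_le_norm _).trans ((norm_inner_le_norm _ _).trans ?_)
    rw [pow_two, ← mul_assoc]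
    exact mul_le_mul_of_nonneg_right (S.le_opNorm _) (norm_nonneg _)
  rw [e] at h
  have ht0 : 0 < t := by positivity
  have ht1 : t * (‖S‖ + 1) = 1 := by rw [ht]; field_simp
  have h2 : t ^ 2 * (inner ℂ (S (S x)) (S x)).re ≤ t * ‖S x‖ ^ 2 := by
    calc _ ≤ t ^ 2 * (‖S‖ * ‖S x‖ ^ 2) := by gcongr
      _ = t * ‖S x‖ ^ 2 * (t * ‖S‖) := by ring
      _ ≤ t * ‖S x‖ ^ 2 * 1 := by gcongr; linarith
      _ = _ := mul_one _
  have h3 : t * ‖S x‖ ^ 2 ≤ (inner ℂ (S x) x).re := by linarith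
  calc ‖S x‖ ^ 2 = (‖S‖ + 1) * (t * ‖S x‖ ^ 2) := by rw [← mul_assoc, mul_comm _ t, ht1, one_mul]
    _ ≤ _ := by gcongr

/-- If the form `⟨PGd, Gd⟩ - ‖d‖² + ‖Gd‖²` with `G` compact exceeds `μ‖Gd‖²` somewhere, then the
formal operator `P + 1 - G⁻²` has an eigenvalue above `μ`. -/
theorem exists_eigenvector_of_form_gt [CompleteSpace H] {G P : H →L[ℂ] H} (hG : IsCompactOperator G)
    (hGs : ∀ x y, inner ℂ (G x) y = inner ℂ x (G y)) (hGi : Function.Injective G)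
    (hPs : ∀ x y, inner ℂ (P x) y = inner ℂ x (P y)) {μ : ℝ} {d₀ : H}
    (h : μ * ‖G d₀‖ ^ 2 < (inner ℂ (P (G d₀)) (G d₀)).re - ‖d₀‖ ^ 2 + ‖G d₀‖ ^ 2) :
    ∃ μ' : ℝ, μ < μ' ∧ ∃ d : H, d ≠ 0 ∧ G (P (G d) + ((1 - μ' : ℝ) : ℂ) • G d) = d := by
  set Φ : H → ℝ := fun d => (inner ℂ (P (G d)) (G d)).re - ‖d‖ ^ 2 + ‖G d‖ ^ 2 with hΦ
  have hpos : ∀ d : H, d ≠ 0 → 0 < ‖G d‖ ^ 2 := fun d hd => by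
    have : G d ≠ 0 := fun h0 => hd (hGi (by rw [h0, map_zero]))
    positivity
  have hd₀ : d₀ ≠ 0 := by
    rintro rfl
    simp at h
  -- The Rayleigh quotients of the form relative to `‖Gd‖²`. Their supremum is the candidate
  -- eigenvalue.
  set A : Set ℝ := (fun d => Φ d / ‖G d‖ ^ 2) '' {d | d ≠ 0} with hA
  have hAne : A.Nonempty := ⟨_, d₀, hd₀, rfl⟩
  have hAbdd : BddAbove A := by
    refine ⟨‖P‖ + 1, ?_⟩
    rintro _ ⟨d, hd, rfl⟩
    simp only
    rw [div_le_iff₀ (hpos d hd)]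
    have h1 : (inner ℂ (P (G d)) (G d)).re ≤ ‖P‖ * ‖G d‖ ^ 2 := by
      refine (Complex.re_le_norm _).trans ((norm_inner_le_norm _ _).trans ?_)
      rw [pow_two, ← mul_assoc]
      exact mul_le_mul_of_nonneg_right (P.le_opNorm _) (norm_nonneg _)
    have := sq_nonneg ‖d‖
    simp only [hΦ]
    linarith
  set μ' := sSup A with hμ'
  have hμμ' : μ < μ' := by
    refine lt_of_lt_of_le ?_ (le_csSup hAbdd ⟨d₀, hd₀, rfl⟩)
    simp only
    rw [lt_div_iff₀ (hpos d₀ hd₀)]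
    exact h
  refine ⟨μ', hμμ', ?_⟩
  -- Formally, with `w = Gd`, the equation `T d = d` reads `(P + 1 - G⁻²)w = μ'w`. As `T` is
  -- compact, the absence of a nonzero fixed vector makes `1 - T` bounded below.
  set T : H →L[ℂ] H := G ∘L (P ∘L G + ((1 - μ' : ℝ) : ℂ) • G) with hT
  have hTc : IsCompactOperator T := hG.comp_clm (P ∘L G + ((1 - μ' : ℝ) : ℂ) • G)
  have hTa : ∀ d, T d = G (P (G d) + ((1 - μ' : ℝ) : ℂ) • G d) := fun d => rfl
  by_contra! hno
  have hne : ¬ Module.End.HasEigenvalue (T : Module.End ℂ H) 1 := by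
    intro he
    obtain ⟨d, hd⟩ := he.exists_hasEigenvector
    refine hno d hd.2 ?_
    have := hd.apply_eq_smul
    rw [one_smul] at this
    rw [← hTa]
    exact this
  obtain ⟨K, hK⟩ := hTc.antilipschitz_of_not_hasEigenvalue one_ne_zero hne
  set S : H →L[ℂ] H := ContinuousLinearMap.id ℂ H - T with hS
  have hSa : ∀ d, S d = d - T d := fun d => rfl
  have hTs : ∀ x y, inner ℂ (T x) y = inner ℂ x (T y) := fun x y => by
    rw [hTa, hTa, hGs, ← hGs x, inner_add_left, inner_add_right, hPs, inner_smul_left,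
      inner_smul_right, Complex.conj_ofReal]
  have hSs : ∀ x y, inner ℂ (S x) y = inner ℂ x (S y) := fun x y => by
    rw [hSa, hSa, inner_sub_left, inner_sub_right, hTs]
  -- The form of `S = 1 - T` is the deficit of the Rayleigh quotient below `μ'`, hence nonnegative.
  have hSq : ∀ d, (inner ℂ (S d) d).re = μ' * ‖G d‖ ^ 2 - Φ d := fun d => by
    rw [hSa, inner_sub_left, hTa, hGs, inner_add_left, inner_smul_left, Complex.conj_ofReal,
      inner_self_eq_norm_sq_to_K, inner_self_eq_norm_sq_to_K]
    simp only [Complex.coe_algebraMap, Complex.sub_re, Complex.add_re, Complex.re_ofReal_mul,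
      ← Complex.ofReal_pow, Complex.ofReal_re, hΦ]
    ring
  have hSp : ∀ d, 0 ≤ (inner ℂ (S d) d).re := fun d => by
    by_cases hd : d = 0
    · simp [hd]
    · rw [hSq, sub_nonneg, ← div_le_iff₀ (hpos d hd)]
      exact le_csSup hAbdd ⟨d, hd, rfl⟩
  have hlow : ∀ d, ‖d‖ ≤ K * ‖S d‖ := fun d => by
    have := hK.le_mul_dist d 0
    simp only [map_zero, dist_zero_right] at this
    have e : (T - (1 : ℂ) • (1 : H →L[ℂ] H)) d = -(S d) := by
      simp [hSa]
    rwa [e, norm_neg] at this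
  -- The constant is chosen so that a vector with quotient within `1/C` of the supremum contradicts
  -- the lower bound: chaining the estimates gives `‖d‖² ≤ ((C - 1)/C)‖d‖²`.
  set C : ℝ := (K : ℝ) ^ 2 * (‖S‖ + 1) * ‖G‖ ^ 2 + 1 with hC
  have hCpos : 0 < C := by positivity
  obtain ⟨_, ⟨d, hd, rfl⟩, hdμ⟩ := exists_lt_of_lt_csSup hAne
    (show μ' - 1 / C < sSup A by rw [← hμ']; linarith [show 0 < 1 / C by positivity])
  simp only at hdμ
  rw [lt_div_iff₀ (hpos d hd)] at hdμ
  have h1 : (inner ℂ (S d) d).re ≤ 1 / C * ‖G d‖ ^ 2 := by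
    rw [hSq]; linarith
  have h2 : ‖G d‖ ^ 2 ≤ ‖G‖ ^ 2 * ‖d‖ ^ 2 := by
    rw [← mul_pow]; exact pow_le_pow_left₀ (norm_nonneg _) (G.le_opNorm d) 2
  have h3 : ‖d‖ ^ 2 ≤ (K : ℝ) ^ 2 * ‖S d‖ ^ 2 := by
    rw [← mul_pow]; exact pow_le_pow_left₀ (norm_nonneg _) (hlow d) 2
  have h4 := norm_sq_le_of_nonneg hSs hSp d
  have hdpos : 0 < ‖d‖ ^ 2 := by
    have : d ≠ 0 := hd
    positivity
  have h5 : ‖d‖ ^ 2 ≤ (C - 1) * (1 / C) * ‖d‖ ^ 2 := by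
    calc ‖d‖ ^ 2 ≤ (K : ℝ) ^ 2 * ((‖S‖ + 1) * (1 / C * (‖G‖ ^ 2 * ‖d‖ ^ 2))) := by
          refine h3.trans ?_
          gcongr
          refine h4.trans ?_
          gcongr
          exact h1.trans (by gcongr)
      _ = _ := by rw [hC]; ring
  have h6 : (C - 1) * (1 / C) < 1 := by
    rw [mul_one_div, div_lt_one hCpos]; linarith
  nlinarith

end Spectral

/-! ### Diagonal and convolution operators on `ℓ²(ℤ)` -/

/-- The space `ℓ²(ℤ)`. -/
abbrev Seq : Type := lp (fun _ : ℤ => ℂ) 2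

theorem hasSum_norm_sq (d : Seq) : HasSum (fun n => ‖d n‖ ^ 2) (‖d‖ ^ 2) := by
  have h := lp.hasSum_norm (p := 2) (by norm_num) d
  simpa using h

theorem memlp_of_summable {c : ℤ → ℂ} (h : Summable fun n => ‖c n‖ ^ 2) :
    Memℓp c 2 := memℓp_gen (by simpa using h)

/-- The diagonal operator with bounded entries `g` on `ℓ²(ℤ)`. -/
def diagL (g : ℤ → ℝ) (C : ℝ) (hg : ∀ n, |g n| ≤ C) : Seq →L[ℂ] Seq :=
  LinearMap.mkContinuous
    { toFun := fun d => ⟨fun n => (g n : ℂ) * d n, memlp_of_summable (by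
        refine Summable.of_nonneg_of_le (fun n => by positivity) (fun n => ?_)
          ((hasSum_norm_sq d).summable.mul_left (C ^ 2))
        rw [← mul_pow, norm_mul, Complex.norm_real]
        exact pow_le_pow_left₀ (by positivity)
          (mul_le_mul_of_nonneg_right (hg n) (norm_nonneg _)) 2)⟩
      map_add' := fun d e => by
        ext n
        exact mul_add _ _ _
      map_smul' := fun c d => by
        ext n
        exact mul_left_comm _ _ _ }
    C (fun d => by
      have hC : 0 ≤ C := (abs_nonneg _).trans (hg 0)
      refine le_of_sq_le_sq ?_ (by positivity)
      rw [mul_pow]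
      refine hasSum_le (fun n => ?_) (hasSum_norm_sq _) ((hasSum_norm_sq d).mul_left (C ^ 2))
      change ‖(g n : ℂ) * d n‖ ^ 2 ≤ _
      rw [← mul_pow, norm_mul, Complex.norm_real]
      exact pow_le_pow_left₀ (by positivity)
        (mul_le_mul_of_nonneg_right (hg n) (norm_nonneg _)) 2)

theorem diagL_apply (g : ℤ → ℝ) (C : ℝ) (hg : ∀ n, |g n| ≤ C) (d : Seq) (n : ℤ) :
    diagL g C hg d n = (g n : ℂ) * d n := rfl

theorem inner_seq (d e : Seq) : inner ℂ d e = ∑' n, (starRingEnd ℂ) (d n) * e n := by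
  rw [lp.inner_eq_tsum]
  simp only [RCLike.inner_apply, mul_comm]

theorem diagL_symm (g : ℤ → ℝ) (C : ℝ) (hg : ∀ n, |g n| ≤ C) (d e : Seq) :
    inner ℂ (diagL g C hg d) e = inner ℂ d (diagL g C hg e) := by
  rw [inner_seq, inner_seq]
  refine tsum_congr fun n => ?_
  rw [diagL_apply, diagL_apply, map_mul, Complex.conj_ofReal]
  ring

/-- The `n`-th coordinate functional. -/
def evalL (n : ℤ) : Seq →L[ℂ] ℂ := innerSL ℂ (lp.single 2 n (1 : ℂ))

theorem evalL_apply (n : ℤ) (d : Seq) : evalL n d = d n := by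
  rw [evalL, innerSL_apply_apply, lp.inner_single_left]
  simp

theorem norm_diagL_le (g : ℤ → ℝ) (C : ℝ) (hg : ∀ n, |g n| ≤ C) : ‖diagL g C hg‖ ≤ C :=
  LinearMap.mkContinuous_norm_le _ ((abs_nonneg _).trans (hg 0)) _

theorem isCompactOperator_diagL_finite (g : ℤ → ℝ) (C : ℝ) (hg : ∀ n, |g n| ≤ C) (s : Finset ℤ)
    (hs : ∀ n, n ∉ s → g n = 0) : IsCompactOperator (diagL g C hg) := by
  have e : diagL g C hg = ∑ n ∈ s, (evalL n).smulRight (lp.single 2 n (g n : ℂ) : Seq) := by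
    ext d m
    rw [← evalL_apply m (diagL g C hg d), ← evalL_apply m ((∑ n ∈ s, _ : Seq →L[ℂ] Seq) d),
      sum_apply, map_sum, evalL_apply, diagL_apply]
    simp only [ContinuousLinearMap.smulRight_apply, map_smul, evalL_apply, lp.coeFn_single, 
      Pi.single_apply, smul_eq_mul, mul_ite, mul_zero]
    rw [Finset.sum_ite_eq]
    split_ifs with h
    · exact mul_comm _ _
    · simp [hs m h]
  rw [e]
  have : (∑ n ∈ s, (evalL n).smulRight (lp.single 2 n (g n : ℂ) : Seq)) ∈
      compactOperator (RingHom.id ℂ) Seq Seq := by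
    refine Submodule.sum_mem _ fun n _ => ?_
    have h1 : IsCompactOperator (evalL n) := isCompactOperator_of_locallyCompactSpace_dom (evalL n)
    exact h1.clm_comp ((ContinuousLinearMap.id ℂ ℂ).smulRight (lp.single 2 n (g n : ℂ) : Seq))
  exact this

/-- A norm limit of finite-rank truncations: outside a finite set the entries are at most `δ/2`. -/
theorem isCompactOperator_diagL (g : ℤ → ℝ) (C : ℝ) (hg : ∀ n, |g n| ≤ C)
    (h0 : Tendsto g cofinite (𝓝 0)) : IsCompactOperator (diagL g C hg) := by
  classical
  have hC : 0 ≤ C := (abs_nonneg _).trans (hg 0)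
  have hgs : ∀ (s : Finset ℤ) (n : ℤ), |if n ∈ s then g n else 0| ≤ C := fun s n => by
    split_ifs
    · exact hg n
    · simpa using hC
  refine isCompactOperator_of_tendsto (l := atTop) (F := fun s : Finset ℤ =>
    diagL (fun n => if n ∈ s then g n else 0) C (hgs s)) ?_ (Eventually.of_forall fun s =>
      isCompactOperator_diagL_finite _ _ _ s fun n hn => by simp [hn])
  rw [Metric.tendsto_atTop]
  intro δ hδ
  have hfin : {n | ¬ |g n| < δ / 2}.Finite := by
    have := (tendsto_order.1 h0.abs).2 (δ / 2) (by rw [abs_zero]; positivity)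
    exact this
  refine ⟨hfin.toFinset, fun s hs => ?_⟩
  have hle : ∀ n, |(if n ∈ s then g n else 0) - g n| ≤ δ / 2 := fun n => by
    split_ifs with h
    · simp; positivity
    · rw [zero_sub, abs_neg]
      by_contra hn
      exact h (hs (by simp only [Finite.mem_toFinset, mem_ofPred_eq]; exact fun h' => hn h'.le))
  have e : diagL (fun n => if n ∈ s then g n else 0) C (hgs s) - diagL g C hg =
      diagL (fun n => (if n ∈ s then g n else 0) - g n) (δ / 2) hle := by
    ext d n
    change ((if n ∈ s then g n else 0 : ℝ) : ℂ) * d n - (g n : ℂ) * d n = _ * d n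
    push_cast
    ring
  rw [dist_eq_norm, e]
  exact (norm_diagL_le _ _ hle).trans_lt (by linarith)

theorem hasSum_norm_sq_sub (m : ℤ) (d : Seq) :
    HasSum (fun n : ℤ => ‖d (n - m)‖ ^ 2) (‖d‖ ^ 2) :=
  (Equiv.hasSum_iff (f := fun n : ℤ => ‖d n‖ ^ 2) (Equiv.subRight m)).2 (hasSum_norm_sq d)

/-- The shifted sequence `(d (n - m))`. -/
def shiftFun (m : ℤ) (d : Seq) : Seq :=
  ⟨fun n => d (n - m), memlp_of_summable (hasSum_norm_sq_sub m d).summable⟩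

theorem norm_shiftFun (m : ℤ) (d : Seq) : ‖shiftFun m d‖ = ‖d‖ := by
  have h := (hasSum_norm_sq (shiftFun m d)).unique (hasSum_norm_sq_sub m d)
  exact (sq_eq_sq₀ (norm_nonneg _) (norm_nonneg _)).1 h

/-- The shift operator `(d n) ↦ (d (n - m))` on `ℓ²(ℤ)`. -/
def shiftL (m : ℤ) : Seq →L[ℂ] Seq :=
  LinearMap.mkContinuous
    { toFun := shiftFun m
      map_add' := fun d e => rfl
      map_smul' := fun c d => rfl }
    1 (fun d => by
      rw [one_mul]
      exact (norm_shiftFun m d).le)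

theorem shiftL_apply (m : ℤ) (d : Seq) (n : ℤ) : shiftL m d n = d (n - m) := rfl

theorem norm_shiftL_le (m : ℤ) : ‖shiftL m‖ ≤ 1 :=
  LinearMap.mkContinuous_norm_le _ zero_le_one _

theorem shiftL_adj (m : ℤ) (d e : Seq) :
    inner ℂ (shiftL m d) e = inner ℂ d (shiftL (-m) e) := by
  rw [inner_seq, inner_seq, ← (Equiv.addRight m).tsum_eq]
  refine tsum_congr fun n => ?_
  simp [shiftL_apply]

/-- Convolution with the sequence `p`, on `ℓ²(ℤ)`. -/
def convL (p : ℤ → ℂ) : Seq →L[ℂ] Seq := ∑' m, p m • shiftL m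

theorem hasSum_convL {p : ℤ → ℂ} (hp : Summable fun n => ‖p n‖) :
    HasSum (fun m => p m • shiftL m) (convL p) := by
  refine (Summable.of_norm ?_).hasSum
  refine Summable.of_nonneg_of_le (fun _ => norm_nonneg _) (fun m => ?_) hp
  rw [norm_smul]
  exact mul_le_of_le_one_right (norm_nonneg _) (norm_shiftL_le m)

theorem hasSum_convL_apply {p : ℤ → ℂ} (hp : Summable fun n => ‖p n‖) (d : Seq) (n : ℤ) :
    HasSum (fun m => p m * d (n - m)) (convL p d n) := by
  have h := (hasSum_convL hp).mapL ((evalL n).comp ((ContinuousLinearMap.apply ℂ Seq) d))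
  simpa [evalL_apply, shiftL_apply] using h

/-- The adjoint of the shift by `m` is the shift by `-m`, so the Hermitian symmetry of the
coefficients, valid for a real potential, makes the convolution symmetric. -/
theorem convL_symm {p : ℤ → ℂ} (hp : Summable fun n => ‖p n‖)
    (hconj : ∀ n, (starRingEnd ℂ) (p n) = p (-n)) (d e : Seq) :
    inner ℂ (convL p d) e = inner ℂ d (convL p e) := by
  have h1 : HasSum (fun m => inner ℂ e ((p m • shiftL m) d)) (inner ℂ e (convL p d)) :=
    (hasSum_convL hp).mapL ((innerSL ℂ e).comp ((ContinuousLinearMap.apply ℂ Seq) d))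
  have h2 : HasSum (fun m => inner ℂ d ((p m • shiftL m) e)) (inner ℂ d (convL p e)) :=
    (hasSum_convL hp).mapL ((innerSL ℂ d).comp ((ContinuousLinearMap.apply ℂ Seq) e))
  have h3 := h1.map (starRingEnd ℂ) Complex.continuous_conj
  rw [inner_conj_symm] at h3
  refine h3.unique ?_
  rw [← (Equiv.neg ℤ).hasSum_iff] at h2
  refine h2.congr_fun fun m => ?_
  simp only [Function.comp_apply, Equiv.neg_apply, smul_apply, inner_smul_right]
  rw [map_mul, hconj, inner_conj_symm, shiftL_adj]

/-- The vector `(n / 2π, 0)` of the dual lattice. -/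
def kap (n : ℤ) : Plane := EuclideanSpace.single 0 ((n : ℝ) / (2 * Real.pi))

theorem kap_zero_coord (n : ℤ) : kap n 0 = n / (2 * Real.pi) := by simp [kap]

theorem kap_one_coord (n : ℤ) : kap n 1 = 0 := by simp [kap]

theorem kap_add (m n : ℤ) : kap (m + n) = kap m + kap n := by
  ext i
  fin_cases i
  · simp [kap_zero_coord]; ring
  · simp [kap_one_coord]

theorem kap_zero : kap 0 = 0 := by
  ext i
  fin_cases i
  · simp [kap_zero_coord]
  · simp [kap_one_coord]

theorem kap_neg (n : ℤ) : kap (-n) = -kap n := by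
  rw [eq_neg_iff_add_eq_zero, ← kap_add, neg_add_cancel, kap_zero]

theorem conj_ex (n : ℤ) (x : ℝ) : (starRingEnd ℂ) (ex n x) = ex (-n) x := by
  rw [ex, ex, ← Complex.exp_conj]
  simp

theorem conj_coef {f : ℝ → ℂ} (hf : ContDiff ℝ 4 f) (hp : Function.Periodic f (2 * Real.pi))
    (hreal : ∀ x, (starRingEnd ℂ) (f x) = f x) (n : ℤ) :
    (starRingEnd ℂ) (coef f n) = coef f (-n) := by
  have hs := summable_norm_coef hf hp
  have key := coef_of_hasSum (f := f) (a := fun m => (starRingEnd ℂ) (coef f (-m))) ?_ ?_ (-n)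
  · rw [key, neg_neg]
  · simp only [RCLike.norm_conj]
    exact (Equiv.neg ℤ).summable_iff.2 hs
  · intro x
    have h := (hasSum_coef hf.continuous hp hs x).map (starRingEnd ℂ) Complex.continuous_conj
    rw [hreal, ← (Equiv.neg ℤ).hasSum_iff] at h
    refine h.congr_fun fun m => ?_
    simp [conj_ex]

/-! ### Bloch operators on Fourier coefficients and the bound of their forms -/

namespace Params

variable (P : Params)

/-- The potential of the linearization about the roll, as a function of `x`. -/
def pot (u : ℝ → ℝ) (x : ℝ) : ℂ := (P.potential (u x) : ℂ)

variable {P} {u : ℝ → ℝ}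

theorem contDiff_pot (hu : P.IsRoll u) : ContDiff ℝ 4 (P.pot u) := by
  have := hu.contDiff
  unfold pot potential
  refine Complex.ofRealCLM.contDiff.comp ?_
  exact ((contDiff_const.add (contDiff_const.mul this)).sub (contDiff_const.mul (this.pow 2)))

theorem periodic_pot (hu : P.IsRoll u) : Function.Periodic (P.pot u) (2 * Real.pi) := fun x => by
  simp only [pot, hu.periodic x]

theorem conj_pot (x : ℝ) : (starRingEnd ℂ) (P.pot u x) = P.pot u x := Complex.conj_ofReal _

theorem summable_norm_pot (hu : P.IsRoll u) : Summable fun n => ‖coef (P.pot u) n‖ :=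
  summable_norm_coef (contDiff_pot hu) (periodic_pot hu)

/-- At fixed `ξ` the symbol is of order four in `n`. The constant depends on `ξ`, which is harmless
because it only serves the regularity of an eigenfunction on a single fibre. -/
theorem weight_le (hk : 0 < P.kSq) (ξ : Plane) : ∃ C : ℝ, 0 < C ∧ ∀ n : ℤ,
    (1 + |(n : ℝ)|) ^ 4 ≤ C * (1 + P.msym (ξ + kap n) ^ 2) := by
  have hκ : 0 < min 1 P.kSq := lt_min one_pos hk
  set a : ℝ := 1 + |2 * Real.pi * ξ 0| with ha
  have ha1 : 1 ≤ a := by rw [ha]; linarith [abs_nonneg (2 * Real.pi * ξ 0)]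
  refine ⟨(2 * a ^ 2) ^ 2 * (8 / (min 1 P.kSq) ^ 2), by positivity, fun n => ?_⟩
  have h1 : (1 + |(n : ℝ)|) ^ 2 ≤ 2 * a ^ 2 * jap (ξ + kap n) := by
    have e0 : 2 * Real.pi * (ξ + kap n) 0 = 2 * Real.pi * ξ 0 + n := by
      rw [PiLp.add_apply, kap_zero_coord]
      field_simp
    have hj := jap_eq (ξ + kap n)
    rw [e0] at hj
    set b := 2 * Real.pi * ξ 0 + n with hb
    have h2 : |(n : ℝ)| ≤ |b| + |2 * Real.pi * ξ 0| := by
      rw [show (n : ℝ) = b - 2 * Real.pi * ξ 0 by rw [hb]; ring]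
      exact abs_sub _ _
    have h3 : (1 + |(n : ℝ)|) ^ 2 ≤ (a + |b|) ^ 2 :=
      pow_le_pow_left₀ (by positivity) (by linarith) 2
    have h4 : (a + |b|) ^ 2 ≤ 2 * a ^ 2 * (1 + b ^ 2) := by
      have : |b| ^ 2 = b ^ 2 := sq_abs b
      nlinarith [sq_nonneg (a - |b|), mul_nonneg (sub_nonneg.2 (one_le_pow₀ ha1 (n := 2))) (sq_nonneg b)]
    refine h3.trans (h4.trans ?_)
    rw [hj]
    exact mul_le_mul_of_nonneg_left (le_add_of_nonneg_right (sq_nonneg _)) (by positivity)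
  calc (1 + |(n : ℝ)|) ^ 4 = ((1 + |(n : ℝ)|) ^ 2) ^ 2 := by ring
    _ ≤ (2 * a ^ 2 * jap (ξ + kap n)) ^ 2 := by gcongr
    _ = (2 * a ^ 2) ^ 2 * jap (ξ + kap n) ^ 2 := by ring
    _ ≤ _ := by
      rw [mul_assoc]
      gcongr
      exact P.jap_sq_le hk _

/-- The Bloch wave vector belonging to the frequency `ξ`. -/
def blochVec (ξ : Plane) : ℝ × ℝ := (2 * Real.pi * ξ 0, 2 * Real.pi * ξ 1)

theorem msym_add_kap (ξ : Plane) (n : ℤ) :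
    P.msym (ξ + kap n) = 1 - P.kSq * ((blochVec ξ).1 + n) ^ 2 - (blochVec ξ).2 ^ 2 := by
  have e0 : 2 * Real.pi * (ξ + kap n) 0 = 2 * Real.pi * ξ 0 + n := by
    rw [PiLp.add_apply, kap_zero_coord]
    field_simp
  rw [msym, e0, PiLp.add_apply, kap_one_coord, add_zero]
  rfl

theorem blochDeriv_ser (τ : ℝ) {c : ℤ → ℂ} (hc : Summable fun n => ‖c n‖)
    (hc' : Summable fun n => ‖Complex.I * n * c n‖) (x : ℝ) :
    blochDeriv τ (ser c) x = ser (fun n => Complex.I * (τ + n) * c n) x := by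
  rw [blochDeriv, (hasDerivAt_ser hc hc' x).deriv]
  refine (((hasSum_ser hc' x).add ((hasSum_ser hc x).mul_left (Complex.I * τ))).congr_fun
    fun n => ?_).tsum_eq.symm
  ring

theorem summable_of_weight {c : ℤ → ℂ} {k j : ℕ} (hjk : j ≤ k)
    (hc : Summable fun n : ℤ => (1 + |(n : ℝ)|) ^ k * ‖c n‖) :
    Summable fun n : ℤ => (1 + |(n : ℝ)|) ^ j * ‖c n‖ :=
  Summable.of_nonneg_of_le (fun n => by positivity) (fun n =>
    mul_le_mul_of_nonneg_right (pow_le_pow_right₀ (by linarith [abs_nonneg (n : ℝ)]) hjk)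
      (norm_nonneg _)) hc

theorem summable_weight_mul {c : ℤ → ℂ} {b : ℤ → ℂ} {j : ℕ} {C : ℝ}
    (hb : ∀ n, ‖b n‖ ≤ C * (1 + |(n : ℝ)|))
    (hc : Summable fun n : ℤ => (1 + |(n : ℝ)|) ^ (j + 1) * ‖c n‖) :
    Summable fun n : ℤ => (1 + |(n : ℝ)|) ^ j * ‖b n * c n‖ := by
  refine Summable.of_nonneg_of_le (fun n => by positivity) (fun n => ?_) (hc.mul_left C)
  rw [norm_mul]
  calc _ ≤ (1 + |(n : ℝ)|) ^ j * (C * (1 + |(n : ℝ)|) * ‖c n‖) := by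
        gcongr; exact hb n
    _ = _ := by ring

theorem norm_bloch_factor_le (τ : ℝ) (n : ℤ) :
    ‖Complex.I * ((τ : ℂ) + n)‖ ≤ (1 + |τ|) * (1 + |(n : ℝ)|) := by
  rw [norm_mul, Complex.norm_I, one_mul]
  have : ‖(τ : ℂ) + n‖ ≤ |τ| + |(n : ℝ)| := by
    refine (norm_add_le _ _).trans ?_
    rw [Complex.norm_real, Complex.norm_intCast, Real.norm_eq_abs]
  nlinarith [abs_nonneg τ, abs_nonneg (n : ℝ), mul_nonneg (abs_nonneg τ) (abs_nonneg (n : ℝ))]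

theorem blochDeriv_ser' (τ : ℝ) {c : ℤ → ℂ} {j : ℕ}
    (hc : Summable fun n : ℤ => (1 + |(n : ℝ)|) ^ (j + 1) * ‖c n‖) :
    blochDeriv τ (ser c) = ser (fun n => Complex.I * (τ + n) * c n) ∧
      Summable fun n : ℤ => (1 + |(n : ℝ)|) ^ j * ‖Complex.I * (τ + n) * c n‖ := by
  refine ⟨funext fun x => blochDeriv_ser τ ?_ ?_ x, summable_weight_mul (norm_bloch_factor_le τ) hc⟩
  · simpa using summable_of_weight (Nat.zero_le _) hc
  · have := summable_weight_mul (j := 0) (C := 1) (b := fun n : ℤ => Complex.I * n) (fun n => by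
      rw [norm_mul, Complex.norm_I, Complex.norm_intCast]
      linarith) (summable_of_weight (by omega : 0 + 1 ≤ j + 1) hc)
    simpa using this

theorem blochA_ser (ξ : Plane) {c : ℤ → ℂ} {j : ℕ}
    (hc : Summable fun n : ℤ => (1 + |(n : ℝ)|) ^ (j + 2) * ‖c n‖) :
    P.blochA (blochVec ξ) (ser c) = ser (fun n => (P.msym (ξ + kap n) : ℂ) * c n) ∧
      Summable fun n : ℤ => (1 + |(n : ℝ)|) ^ j * ‖(P.msym (ξ + kap n) : ℂ) * c n‖ := by
  obtain ⟨h1, h2⟩ := blochDeriv_ser' (blochVec ξ).1 (j := j + 1) hc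
  obtain ⟨h3, h4⟩ := blochDeriv_ser' (blochVec ξ).1 h2
  have hc0 := summable_of_weight (by omega : j ≤ j + 2) hc
  have key : ∀ n : ℤ, (P.msym (ξ + kap n) : ℂ) * c n = (1 - ((blochVec ξ).2 : ℂ) ^ 2) * c n +
      P.kSq * (Complex.I * ((blochVec ξ).1 + n) * (Complex.I * ((blochVec ξ).1 + n) * c n)) := by
    intro n
    rw [msym_add_kap]
    push_cast
    linear_combination (-(P.kSq : ℂ) * ((blochVec ξ).1 + n) ^ 2 * c n) * Complex.I_sq
  constructor
  · ext x
    rw [blochA, h1, h3]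
    refine (((hasSum_ser ?_ x).mul_left _).add ((hasSum_ser ?_ x).mul_left _)).tsum_eq.symm.trans ?_
    · simpa using summable_of_weight (Nat.zero_le _) hc0
    · simpa using summable_of_weight (Nat.zero_le _) h4
    · refine tsum_congr fun n => ?_
      simp only [key]
      ring
  · refine Summable.of_nonneg_of_le (fun n => by positivity) (fun n => ?_)
      ((hc0.mul_left ‖1 - ((blochVec ξ).2 : ℂ) ^ 2‖).add (h4.mul_left ‖(P.kSq : ℂ)‖))
    rw [key]
    calc _ ≤ (1 + |(n : ℝ)|) ^ j * (‖1 - ((blochVec ξ).2 : ℂ) ^ 2‖ * ‖c n‖ + ‖(P.kSq : ℂ)‖ *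
          ‖Complex.I * ((blochVec ξ).1 + n) * (Complex.I * ((blochVec ξ).1 + n) * c n)‖) := by
          gcongr
          refine (norm_add_le _ _).trans ?_
          rw [norm_mul, norm_mul (P.kSq : ℂ)]
      _ = _ := by ring

/-- An eigenvector in coefficients yields a classical eigenfunction: summability with a weight of
order four makes the trigonometric series `C⁴`, and the differential equation is then checked
termwise. -/
theorem isBlochEigenvalue_of_seq (hu : P.IsRoll u) (ξ : Plane) {c : ℤ → ℂ} {μ : ℝ}
    (hc : Summable fun n : ℤ => (1 + |(n : ℝ)|) ^ 4 * ‖c n‖) (hne : ∃ n, c n ≠ 0)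
    (heig : ∀ n, HasSum (fun m => coef (P.pot u) m * c (n - m))
      (((P.msym (ξ + kap n) ^ 2 + μ : ℝ) : ℂ) * c n)) :
    P.IsBlochEigenvalue u (blochVec ξ) μ := by
  have hc1 : Summable fun n => ‖c n‖ := by simpa using summable_of_weight (Nat.zero_le 4) hc
  have hcd : ContDiff ℝ 4 (ser c) := contDiff_ser 4 hc
  obtain ⟨h1, h2⟩ := blochA_ser (P := P) ξ (j := 2) hc
  obtain ⟨h3, h4⟩ := blochA_ser (P := P) ξ (j := 0) h2
  simp only [pow_zero, one_mul] at h4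
  refine ⟨ser c, hcd, periodic_ser c, ?_, fun x => ?_⟩
  · rintro h0
    obtain ⟨n, hn⟩ := hne
    refine hn ?_
    rw [← coef_of_hasSum hc1 (hasSum_ser hc1) n, h0]
    simp [coef_eq_integral]
  · rw [bloch, h1, h3]
    have hpc : ∀ n, coef (fun x => P.pot u x * ser c x) n =
        ((P.msym (ξ + kap n) ^ 2 + μ : ℝ) : ℂ) * c n := fun n => by
      refine (hasSum_coef_mul (summable_norm_pot hu)
        (hasSum_coef (contDiff_pot hu).continuous (periodic_pot hu) (summable_norm_pot hu))
        hcd.continuous (periodic_ser c) n).unique ?_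
      simp only [coef_of_hasSum hc1 (hasSum_ser hc1)]
      exact heig n
    have hsum : Summable fun n => ‖coef (fun x => P.pot u x * ser c x) n‖ := by
      refine Summable.of_nonneg_of_le (fun _ => norm_nonneg _) (fun n => ?_)
        (h4.add (hc1.mul_left |μ|))
      rw [hpc]
      push_cast
      rw [add_mul, pow_two, mul_assoc]
      refine (norm_add_le _ _).trans ?_
      rw [norm_mul (μ : ℂ), Complex.norm_real, Real.norm_eq_abs]
    have h5 := hasSum_coef ((contDiff_pot hu).continuous.mul hcd.continuous)
      ((periodic_pot hu).mul (periodic_ser c)) hsum x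
    have h6 := (hasSum_ser h4 x).neg.add h5
    refine h6.unique ?_
    refine ((hasSum_ser hc1 x).mul_left (μ : ℂ)).congr_fun fun n => ?_
    change _ + coef (fun x => P.pot u x * ser c x) n * _ = _
    rw [hpc]
    push_cast
    ring

/-- The form of the Bloch operator is bounded by the largest Bloch eigenvalue. -/
theorem bloch_form_le (hk : 0 < P.kSq) (hu : P.IsRoll u) {lamM : ℝ}
    (hmax : ∀ σ μ, P.IsBlochEigenvalue u σ μ → μ ≤ lamM) (ξ : Plane) {c : ℤ → ℂ}
    (hc : Summable fun n => ‖c n‖ ^ 2)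
    (hmc : Summable fun n => P.msym (ξ + kap n) ^ 2 * ‖c n‖ ^ 2) :
    (∑' n, (starRingEnd ℂ) (c n) * ∑' m, coef (P.pot u) m * c (n - m)).re ≤
      ∑' n, (P.msym (ξ + kap n) ^ 2 + lamM) * ‖c n‖ ^ 2 := by
  set m : ℤ → ℝ := fun n => P.msym (ξ + kap n) with hm
  have hw : ∀ n, 0 < 1 + m n ^ 2 := fun n => by positivity
  -- `G` is the inverse square root of `1 + m²`. Through `c = G d₀` the unbounded form at `c`
  -- becomes a form defined on all of `ℓ²`; `g` tends to zero, which makes `G` compact.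
  set g : ℤ → ℝ := fun n => 1 / Real.sqrt (1 + m n ^ 2) with hgdef
  have hsq : ∀ n, 1 ≤ Real.sqrt (1 + m n ^ 2) := fun n => by
    rw [Real.one_le_sqrt]; nlinarith [sq_nonneg (m n)]
  have hgpos : ∀ n, 0 < g n := fun n => by
    have := hsq n
    simp only [hgdef]
    positivity
  have hg1 : ∀ n, |g n| ≤ 1 := fun n => by
    rw [abs_of_pos (hgpos n)]
    simp only [hgdef]
    rw [div_le_one (by linarith [hsq n])]
    exact hsq n
  have hgsq : ∀ n, g n ^ 2 * (1 + m n ^ 2) = 1 := fun n => by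
    simp only [hgdef]
    rw [div_pow, Real.sq_sqrt (hw n).le]
    have := (hw n).ne'
    field_simp
  obtain ⟨C, hC0, hC⟩ := P.weight_le hk ξ
  have hgle : ∀ n, g n ≤ Real.sqrt C / (1 + |(n : ℝ)|) ^ 2 := fun n => by
    simp only [hgdef]
    rw [div_le_div_iff₀ (by linarith [hsq n]) (by positivity), one_mul,
      ← Real.sqrt_mul hC0.le]
    refine Real.le_sqrt_of_sq_le ?_
    rw [← pow_mul]
    exact hC n
  have hgle' : ∀ n, g n ≤ Real.sqrt C * (1 / (1 + (n : ℝ) ^ 2)) := fun n => by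
    refine (hgle n).trans ?_
    rw [mul_one_div]
    gcongr
    nlinarith [abs_nonneg (n : ℝ), sq_abs (n : ℝ)]
  have hg0 : Tendsto g cofinite (𝓝 0) := by
    have h1 := (summable_one_div_one_add_sq.mul_left (Real.sqrt C)).tendsto_cofinite_zero
    exact squeeze_zero (fun n => (hgpos n).le) hgle' h1
  set G : Seq →L[ℂ] Seq := diagL g 1 hg1
  set Pc : Seq →L[ℂ] Seq := convL (coef (P.pot u))
  have hp := summable_norm_pot hu
  by_contra! hlt
  have hd0mem : Summable fun n => ‖((Real.sqrt (1 + m n ^ 2) : ℝ) : ℂ) * c n‖ ^ 2 := by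
    refine (hc.add hmc).congr fun n => ?_
    rw [norm_mul, mul_pow, Complex.norm_real, Real.norm_eq_abs, sq_abs, Real.sq_sqrt (hw n).le]
    ring
  set d₀ : Seq := ⟨_, memlp_of_summable hd0mem⟩ with hd₀
  set c' : Seq := ⟨c, memlp_of_summable hc⟩
  have hGd₀ : G d₀ = c' := by
    ext n
    change (g n : ℂ) * (((Real.sqrt (1 + m n ^ 2) : ℝ) : ℂ) * c n) = c n
    have h1 : g n * Real.sqrt (1 + m n ^ 2) = 1 := by
      simp only [hgdef]
      rw [one_div_mul_cancel (by linarith [hsq n])]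
    rw [← mul_assoc, ← Complex.ofReal_mul, h1, Complex.ofReal_one, one_mul]
  have hkey : lamM * ‖G d₀‖ ^ 2 <
      (inner ℂ (Pc (G d₀)) (G d₀)).re - ‖d₀‖ ^ 2 + ‖G d₀‖ ^ 2 := by
    rw [hGd₀]
    have e1 : (inner ℂ (Pc c') c').re =
        (∑' n, (starRingEnd ℂ) (c n) * ∑' m, coef (P.pot u) m * c (n - m)).re := by
      rw [← inner_conj_symm, Complex.conj_re, inner_seq]
      congr 1
      refine tsum_congr fun n => ?_
      congr 1
      exact (hasSum_convL_apply hp c' n).tsum_eq.symm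
    have e2 : ∑' n, (m n ^ 2 + lamM) * ‖c n‖ ^ 2 = ‖d₀‖ ^ 2 - ‖c'‖ ^ 2 + lamM * ‖c'‖ ^ 2 := by
      have h1 := hasSum_norm_sq c'
      have h2 := hasSum_norm_sq d₀
      refine (((h2.sub h1).add (h1.mul_left lamM)).congr_fun fun n => ?_).tsum_eq
      change _ = ‖((Real.sqrt (1 + m n ^ 2) : ℝ) : ℂ) * c n‖ ^ 2 - ‖c n‖ ^ 2 + lamM * ‖c n‖ ^ 2
      rw [norm_mul, mul_pow, Complex.norm_real, Real.norm_eq_abs, sq_abs, Real.sq_sqrt (hw n).le]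
      ring
    rw [e1]
    rw [e2] at hlt
    linarith
  obtain ⟨μ, hμ, d, hd, hGd⟩ := exists_eigenvector_of_form_gt (G := G) (P := Pc)
    (isCompactOperator_diagL g 1 hg1 hg0) (diagL_symm g 1 hg1)
    (fun x y hxy => by
      ext n
      have := congrArg (fun z : Seq => z n) hxy
      simp only [G, diagL_apply] at this
      exact mul_left_cancel₀ (by exact_mod_cast (hgpos n).ne') this)
    (convL_symm hp (conj_coef (contDiff_pot hu) (periodic_pot hu) conj_pot)) hkey
  refine absurd (hmax (blochVec ξ) μ ?_) (not_le.2 hμ)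
  set e : Seq := G d with he
  have hen : ∀ n, e n = (g n : ℂ) * d n := fun n => rfl
  -- The eigenvalue equation, with `G⁻²` written out as multiplication by `1 + m²`.
  have heq : ∀ n, ((1 + m n ^ 2 : ℝ) : ℂ) * e n = Pc e n + ((1 - μ : ℝ) : ℂ) * e n := fun n => by
    have h1 : d n = (g n : ℂ) * (Pc e n + ((1 - μ : ℝ) : ℂ) * e n) := by
      conv_lhs => rw [← hGd]
      rfl
    have h2 : (g n : ℂ) ^ 2 * ((1 + m n ^ 2 : ℝ) : ℂ) = 1 := by exact_mod_cast hgsq n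
    linear_combination ((1 + m n ^ 2 : ℝ) : ℂ) * hen n + ((1 + m n ^ 2 : ℝ) : ℂ) * (g n : ℂ) * h1 +
      (Pc e n + ((1 - μ : ℝ) : ℂ) * e n) * h2
  -- Regularity of the eigenvector: `e = Gd` is a product of two `ℓ²` sequences, hence in `ℓ¹`.
  -- Convolution with the summable coefficients of the potential preserves `ℓ¹`, and `heq` then
  -- gains the weight of order four.
  have he1 : Summable fun n => ‖e n‖ := by
    have h1 := (hasSum_norm_sq d).summable
    have h2 : Summable fun n : ℤ => g n ^ 2 := by
      refine Summable.of_nonneg_of_le (fun n => sq_nonneg _) (fun n => ?_)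
        (summable_one_div_one_add_sq.mul_left (Real.sqrt C))
      have := hgle' n
      have h3 := abs_le.1 (hg1 n)
      nlinarith [hgpos n]
    refine Summable.of_nonneg_of_le (fun _ => norm_nonneg _) (fun n => ?_) (h1.add h2)
    rw [hen, norm_mul, Complex.norm_real, Real.norm_of_nonneg (hgpos n).le]
    nlinarith [sq_nonneg (g n - ‖d n‖), sq_nonneg (g n + ‖d n‖)]
  have hPe : Summable fun n => ‖Pc e n‖ := by
    have h1 : Summable fun q : ℤ × ℤ => ‖coef (P.pot u) q.1‖ * ‖e q.2‖ :=
      hp.mul_of_nonneg he1 (fun _ => norm_nonneg _) (fun _ => norm_nonneg _)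
    let φ : ℤ × ℤ ≃ ℤ × ℤ :=
      { toFun := fun q => (q.2, q.1 - q.2)
        invFun := fun q => (q.2 + q.1, q.1)
        left_inv := fun q => by simp
        right_inv := fun q => by simp }
    have h2 := φ.summable_iff.2 h1
    refine Summable.of_nonneg_of_le (fun _ => norm_nonneg _) (fun n => ?_) h2.prod
    have h3 := (hasSum_convL_apply hp e n)
    rw [← h3.tsum_eq]
    refine (norm_tsum_le_tsum_norm ?_).trans_eq ?_
    · have := h2.prod_factor n
      simpa [φ] using this
    · refine tsum_congr fun k => ?_
      simp [φ]
  refine isBlochEigenvalue_of_seq hu ξ (c := fun n => e n) ?_ ?_ ?_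
  · refine Summable.of_nonneg_of_le (fun _ => by positivity) (fun n => ?_)
      ((hPe.add (he1.mul_left |1 - μ|)).mul_left C)
    have h1 : (1 + m n ^ 2) * ‖e n‖ ≤ ‖Pc e n‖ + |1 - μ| * ‖e n‖ := by
      have := congrArg norm (heq n)
      rw [norm_mul, Complex.norm_real, Real.norm_of_nonneg (hw n).le] at this
      rw [this]
      refine (norm_add_le _ _).trans ?_
      rw [norm_mul, Complex.norm_real, Real.norm_eq_abs]
    calc _ ≤ C * (1 + m n ^ 2) * ‖e n‖ := by
          gcongr
          exact hC n
      _ = C * ((1 + m n ^ 2) * ‖e n‖) := by ring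
      _ ≤ _ := by gcongr
  · by_contra! h0
    refine hd ?_
    ext n
    have := h0 n
    rw [hen] at this
    rcases mul_eq_zero.1 this with h | h
    · exact absurd h (by exact_mod_cast (hgpos n).ne')
    · exact h
  · intro n
    have h1 := hasSum_convL_apply hp e n
    have h2 := heq n
    convert h1 using 1
    push_cast at h2 ⊢
    linear_combination h2

end Params

/-! ### Sums in `L²` -/

theorem coeFn_finsetSum {ι : Type*} (s : Finset ι) (v : ι → L2) :
    ((∑ i ∈ s, v i : L2) : Plane → ℂ) =ᵐ[volume] fun z => ∑ i ∈ s, v i z := by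
  classical
  induction s using Finset.induction_on with
  | empty =>
    simp only [Finset.sum_empty]
    exact Lp.coeFn_zero ℂ 2 volume
  | insert i s hi ih =>
    simp only [Finset.sum_insert hi]
    filter_upwards [ih, Lp.coeFn_add (v i) (∑ i ∈ s, v i)] with z h1 h2
    rw [h2, Pi.add_apply, h1]

/-- A series that converges in `L²` and pointwise has the same sum in both senses. -/
theorem ae_eq_of_hasSum {v : ℤ → L2} {V : L2} (hV : HasSum v V) {f : Plane → ℂ}
    (hf : ∀ᵐ z, HasSum (fun n => v n z) (f z)) : (V : Plane → ℂ) =ᵐ[volume] f := by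
  have h1 : TendstoInMeasure volume (fun s : Finset ℤ => ((∑ n ∈ s, v n : L2) : Plane → ℂ)) atTop V :=
    tendstoInMeasure_of_tendsto_Lp hV
  obtain ⟨ns, hns, h2⟩ := h1.exists_seq_tendsto_ae'
  have h3 : ∀ᵐ z : Plane, ∀ s : Finset ℤ, ((∑ n ∈ s, v n : L2) : Plane → ℂ) z = ∑ n ∈ s, v n z :=
    ae_all_iff.2 fun s => coeFn_finsetSum s v
  filter_upwards [hf, h2, h3] with z h4 h5 h6
  refine tendsto_nhds_unique h5 ?_
  simp only [h6]
  have h7 : Tendsto (fun s : Finset ℤ => ∑ n ∈ s, v n z) atTop (𝓝 (f z)) := by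
    simpa [HasSum] using h4
  exact h7.comp hns

/-! ### Periodic multipliers as sums of modulations -/

theorem fourierChar_kap (n : ℤ) (z : Plane) :
    (Real.fourierChar (inner ℝ (kap n) z) : ℂ) = ex n (z 0) := by
  rw [Real.fourierChar_apply, ex, kap, EuclideanSpace.inner_single_left]
  congr 1
  have : (Real.pi : ℂ) ≠ 0 := by exact_mod_cast Real.pi_ne_zero
  simp only [conj_trivial]
  push_cast
  field_simp

/-- Functions of `x` alone as multipliers. -/
theorem bddMeas_fst {f : ℝ → ℂ} (hf : Continuous f) {C : ℝ} (hC : ∀ x, ‖f x‖ ≤ C) :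
    BddMeas fun z : Plane => f (z 0) :=
  ⟨(hf.comp (by fun_prop)).measurable, C, fun z => hC _⟩

/-- Modulations have norm at most one, so the series converges in operator norm; the limit is
identified by pointwise convergence of the Fourier series. -/
theorem hasSum_charL {a : ℤ → ℂ} (ha : Summable fun n => ‖a n‖) {f : ℝ → ℂ}
    (hb : BddMeas fun z : Plane => f (z 0)) (hf : ∀ x, HasSum (fun n => a n * ex n x) (f x)) :
    HasSum (fun n => a n • charL (kap n)) (mulCLM hb) := by
  have hs : Summable fun n => a n • charL (kap n) := by
    refine Summable.of_norm (Summable.of_nonneg_of_le (fun _ => norm_nonneg _) (fun n => ?_) ha)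
    rw [norm_smul]
    exact mul_le_of_le_one_right (norm_nonneg _) (norm_charL_le _)
  convert hs.hasSum using 1
  ext1 v
  have h1 := hs.hasSum.mapL ((ContinuousLinearMap.apply ℂ L2) v)
  apply Lp.ext
  refine (mulCLM_ae hb v).trans (ae_eq_of_hasSum h1 ?_).symm
  have h2 : ∀ᵐ z : Plane, ∀ n, (charL (kap n) v : Plane → ℂ) z = ex n (z 0) * v z := by
    refine ae_all_iff.2 fun n => ?_
    filter_upwards [charL_ae (kap n) v] with z h
    rw [h, fourierChar_kap]
  have h3 : ∀ᵐ z : Plane, ∀ n, ((a n • charL (kap n) v : L2) : Plane → ℂ) z =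
      a n * (charL (kap n) v : Plane → ℂ) z := by
    refine ae_all_iff.2 fun n => ?_
    filter_upwards [Lp.coeFn_smul (a n) (charL (kap n) v)] with z h
    rw [h, Pi.smul_apply, smul_eq_mul]
  filter_upwards [h2, h3] with z h4 h5
  refine ((hf (z 0)).mul_right (v z)).congr_fun fun n => ?_
  change ((a n • charL (kap n) v : L2) : Plane → ℂ) z = _
  rw [h5, h4, mul_assoc]

/-! ### Decomposition of the plane into strips -/

/-- The strip of frequencies belonging to one period of Bloch wave vectors. -/
def strip : Set Plane := {ξ | ξ 0 ∈ Ico (0 : ℝ) (1 / (2 * Real.pi))}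

/-- The translates of the strip. -/
def stripT (l : ℤ) : Set Plane := (fun ξ => ξ - kap l) ⁻¹' strip

theorem measurableSet_strip : MeasurableSet strip :=
  (by fun_prop : Measurable fun ξ : Plane => ξ 0) measurableSet_Ico

theorem measurableSet_stripT (l : ℤ) : MeasurableSet (stripT l) :=
  (measurable_id.sub_const _) measurableSet_strip

theorem mem_stripT {l : ℤ} {ξ : Plane} : ξ ∈ stripT l ↔ ⌊2 * Real.pi * ξ 0⌋ = l := by
  have : ξ ∈ stripT l ↔ (ξ - kap l) 0 ∈ Ico (0 : ℝ) (1 / (2 * Real.pi)) := Iff.rfl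
  rw [this, PiLp.sub_apply, kap_zero_coord, mem_Ico, Int.floor_eq_iff, sub_nonneg,
    sub_lt_iff_lt_add, ← add_div, div_le_iff₀ Real.two_pi_pos, lt_div_iff₀ Real.two_pi_pos]
  constructor <;> rintro ⟨h1, h2⟩ <;> constructor <;> linarith

theorem iUnion_stripT : ⋃ l, stripT l = univ := by
  ext ξ
  simp only [mem_iUnion, mem_stripT, mem_univ, iff_true]
  exact ⟨_, rfl⟩

theorem pairwise_disjoint_stripT : Pairwise (Function.onFun Disjoint stripT) := by
  intro l l' hl
  refine Set.disjoint_left.2 fun ξ h1 h2 => hl ?_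
  rw [← mem_stripT.1 h1, mem_stripT.1 h2]

theorem preimage_stripT (l : ℤ) : (fun ξ => ξ + kap l) ⁻¹' stripT l = strip := by
  ext ξ
  simp [stripT]

theorem lintegral_eq_tsum_strip (f : Plane → ℝ≥0∞) :
    ∫⁻ ξ, f ξ = ∑' l : ℤ, ∫⁻ ξ in strip, f (ξ + kap l) := by
  rw [← setLIntegral_univ, ← iUnion_stripT, lintegral_iUnion measurableSet_stripT
    pairwise_disjoint_stripT]
  refine tsum_congr fun l => ?_
  rw [← (measurePreserving_add_const (kap l)).setLIntegral_comp_preimage_emb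
    (measurableEmbedding_addRight (kap l)), preimage_stripT]

theorem ae_strip_summable {E : Type*} [NormedAddCommGroup E] {f : Plane → E} (hf : Integrable f) :
    ∀ᵐ ξ ∂(volume.restrict strip), Summable fun l => ‖f (ξ + kap l)‖ := by
  have h1 := lintegral_eq_tsum_strip fun ξ => ‖f ξ‖ₑ
  have hm : ∀ l : ℤ, AEMeasurable (fun ξ => ‖f (ξ + kap l)‖ₑ) (volume.restrict strip) := fun l =>
    ((hf.1.enorm).comp_quasiMeasurePreserving
      (measurePreserving_add_const (kap l)).quasiMeasurePreserving).restrict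
  rw [← lintegral_tsum hm] at h1
  have h2 : ∫⁻ ξ in strip, ∑' l, ‖f (ξ + kap l)‖ₑ ≠ ∞ := by
    rw [← h1]
    exact hf.2.ne
  filter_upwards [ae_lt_top' (AEMeasurable.tsum hm) h2] with ξ h3
  have := ENNReal.summable_toReal h3.ne
  simpa using this

/-- The translates of the strip tile the plane. For fixed `ξ` in the strip, the points `ξ + kap l`
are exactly the frequencies coupled to `ξ` by functions that are `2π`-periodic in `x`. -/
theorem integral_eq_integral_strip {E : Type*} [NormedAddCommGroup E] [NormedSpace ℝ E]
    {f : Plane → E} (hf : Integrable f) :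
    ∫ ξ, f ξ = ∫ ξ in strip, ∑' l : ℤ, f (ξ + kap l) := by
  have hm : ∀ l : ℤ, AEStronglyMeasurable (fun ξ => f (ξ + kap l)) (volume.restrict strip) :=
    fun l => (hf.1.comp_quasiMeasurePreserving
      (measurePreserving_add_const (kap l)).quasiMeasurePreserving).restrict
  rw [integral_tsum hm]
  · rw [← setIntegral_univ, ← iUnion_stripT, integral_iUnion measurableSet_stripT
      pairwise_disjoint_stripT hf.integrableOn]
    refine tsum_congr fun l => ?_
    rw [← (measurePreserving_add_const (kap l)).setIntegral_preimage_emb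
      (measurableEmbedding_addRight (kap l)), preimage_stripT]
  · rw [← lintegral_eq_tsum_strip fun ξ => ‖f ξ‖ₑ]
    exact hf.2.ne

namespace Params

variable (P : Params)

/-! ### The linearization through the Fourier transform -/

theorem hasTemperateGrowth_msym : (fun ξ => (P.msym ξ : ℂ)).HasTemperateGrowth := by
  have h0 : (fun ξ : Plane => ξ 0).HasTemperateGrowth :=
    (EuclideanSpace.proj (𝕜 := ℝ) (0 : Fin 2)).hasTemperateGrowth
  have h1 : (fun ξ : Plane => ξ 1).HasTemperateGrowth :=
    (EuclideanSpace.proj (𝕜 := ℝ) (1 : Fin 2)).hasTemperateGrowth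
  unfold msym
  fun_prop

theorem fourier_planeA (T : 𝓢'(Plane, ℂ)) :
    𝓕 (P.planeA T) =
      TemperedDistribution.smulLeftCLM ℂ (fun ξ => (P.msym ξ : ℂ)) (𝓕 T) := by
  have hi : ∀ m : Plane, (fun ξ : Plane => ((inner ℝ ξ m : ℝ) : ℂ)).HasTemperateGrowth := by
    intro m; fun_prop
  ext g
  rw [planeA, FourierTransform.fourier_add, FourierTransform.fourier_add,
    FourierTransform.fourier_smul]
  simp only [TemperedDistribution.fourier_lineDerivOp_eq]
  have key : SchwartzMap.smulLeftCLM ℂ (fun ξ => (P.msym ξ : ℂ)) g =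
      g + (P.kSq : ℂ) • (2 * Real.pi * Complex.I) • (2 * Real.pi * Complex.I) •
        SchwartzMap.smulLeftCLM ℂ
          (fun ξ : Plane => ((inner ℝ ξ (EuclideanSpace.single (0 : Fin 2) (1 : ℝ)) : ℝ) : ℂ))
          (SchwartzMap.smulLeftCLM ℂ
          (fun ξ : Plane => ((inner ℝ ξ (EuclideanSpace.single (0 : Fin 2) (1 : ℝ)) : ℝ) : ℂ)) g)
      + (2 * Real.pi * Complex.I) • (2 * Real.pi * Complex.I) •
        SchwartzMap.smulLeftCLM ℂ
          (fun ξ : Plane => ((inner ℝ ξ (EuclideanSpace.single (1 : Fin 2) (1 : ℝ)) : ℝ) : ℂ))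
          (SchwartzMap.smulLeftCLM ℂ
          (fun ξ : Plane => ((inner ℝ ξ (EuclideanSpace.single (1 : Fin 2) (1 : ℝ)) : ℝ) : ℂ)) g) := by
    ext ξ
    simp only [add_apply, smul_apply,
      SchwartzMap.smulLeftCLM_apply_apply P.hasTemperateGrowth_msym,
      SchwartzMap.smulLeftCLM_apply_apply (hi _), smul_eq_mul]
    simp only [EuclideanSpace.inner_single_right, msym, conj_trivial, one_mul]
    push_cast
    linear_combination (-(P.kSq * (2 * Real.pi * ξ 0) ^ 2 * g ξ : ℂ) -
      ((2 * Real.pi * ξ 1) ^ 2 * g ξ : ℂ)) * Complex.I_sq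
  rw [TemperedDistribution.smulLeftCLM_apply_apply, key]
  generalize (P.kSq : ℂ) = κ
  simp [map_add, map_smul]

variable {P} {u : ℝ → ℝ}

theorem bddMeas_pot (hu : P.IsRoll u) : BddMeas fun z : Plane => P.pot u (z 0) := by
  obtain ⟨C, hC⟩ := exists_bound_of_periodic (contDiff_pot hu).continuous (periodic_pot hu)
  exact bddMeas_fst (contDiff_pot hu).continuous hC

/-- The elements of the domain of the linearization are in the range of the resolvent. -/
theorem IsLinearization.exists_res (hu : P.IsRoll u) {v w : L2} (h : P.IsLinearization u v w) :
    ∃ h : L2, v = P.res h ∧ w = -(h - v) + mulCLM (bddMeas_pot hu) v := by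
  obtain ⟨-, a, ha, hw⟩ := h
  have hmc : Continuous fun ξ => (P.msym ξ : ℂ) := Complex.continuous_ofReal.comp P.continuous_msym
  have h1 : (𝓕 a : L2) =ᵐ[volume] fun ξ => (P.msym ξ : ℂ) ^ 2 * (𝓕 v : L2) ξ := by
    refine ae_eq_of_schwartz_test ((Lp.memLp _).locallyIntegrable (by norm_num)) ?_ fun g => ?_
    · exact (((Lp.memLp (𝓕 v : L2)).locallyIntegrable (by norm_num)).smul_continuous
        (g := fun ξ => (P.msym ξ : ℂ) ^ 2) (by fun_prop)).congr
        (by filter_upwards with ξ; simp [mul_comm])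
    · have h2 : (𝓕 (a : 𝓢'(Plane, ℂ))) g = (𝓕 (P.planeA (P.planeA (v : 𝓢'(Plane, ℂ))))) g := by
        rw [ha]
      rw [fourier_planeA, fourier_planeA, Lp.fourier_toTemperedDistribution_eq,
        Lp.fourier_toTemperedDistribution_eq, TemperedDistribution.smulLeftCLM_apply_apply,
        TemperedDistribution.smulLeftCLM_apply_apply, Lp.toTemperedDistribution_apply,
        Lp.toTemperedDistribution_apply] at h2
      simp only [SchwartzMap.smulLeftCLM_apply_apply P.hasTemperateGrowth_msym, smul_eq_mul] at h2
      rw [h2]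
      congr 1
      ext ξ
      ring
  -- Since `a` is the squared operator applied to `v`, the preimage of `v` under the resolvent is `a
  -- + v`.
  refine ⟨a + v, fourier_injective (Lp.ext ?_), Lp.ext ?_⟩
  · have h3 := Lp.coeFn_add (𝓕 a : L2) (𝓕 v)
    rw [← FourierTransform.fourier_add] at h3
    filter_upwards [h1, P.fourier_res_ae (a + v), h3] with ξ h1 h2 h3
    rw [h2, h3, Pi.add_apply, h1]
    have : (1 + (P.msym ξ : ℂ) ^ 2) ≠ 0 := by exact_mod_cast (P.one_add_msym_sq_pos ξ).ne'
    push_cast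
    field_simp
    ring
  · rw [add_sub_cancel_right]
    filter_upwards [hw, Lp.coeFn_add (-a) (mulCLM (bddMeas_pot hu) v), Lp.coeFn_neg a,
      mulCLM_ae (bddMeas_pot hu) v] with z h1 h2 h3 h4
    rw [h1, h2, Pi.add_apply, h3, h4]
    rfl

/-! ### Dissipativity -/

-- By Plancherel the inequality is an integral over frequencies. Cut into strips, its integrand at
-- `ξ` is a sum over `l` that involves only the sequence `F (ξ + kap l)`: the potential acts by
-- convolution and the differential part by `P.msym (ξ + kap l) ^ 2`. For almost every `ξ` this is
-- the form of the Bloch operator at `blochVec ξ`, and `bloch_form_le` applies.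
set_option maxHeartbeats 1000000 in
theorem res_form_le (hk : 0 < P.kSq) (hu : P.IsRoll u) {lamM : ℝ}
    (hmax : ∀ σ μ, P.IsBlochEigenvalue u σ μ → μ ≤ lamM) (h : L2) :
    (inner ℂ (P.res h) (-(h - P.res h) + mulCLM (bddMeas_pot hu) (P.res h))).re ≤
      lamM * ‖P.res h‖ ^ 2 := by
  set v := P.res h
  set F : L2 := 𝓕 v
  set K : L2 := 𝓕 h
  set G : L2 := 𝓕 (mulCLM (bddMeas_pot hu) v)
  have hp := summable_norm_pot hu
  have hG : HasSum (fun n => coef (P.pot u) n • transL (-kap n) F) G := by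
    have h1 := (hasSum_charL hp (bddMeas_pot hu) (hasSum_coef (contDiff_pot hu).continuous
      (periodic_pot hu) hp)).mapL (ContinuousLinearMap.apply ℂ L2 v)
    have h2 := h1.mapL (FourierTransform.fourierCLM ℂ L2 : L2 →L[ℂ] L2)
    refine h2.congr_fun fun n => ?_
    change _ = 𝓕 (coef (P.pot u) n • charL (kap n) v : L2)
    rw [FourierTransform.fourier_smul, fourier_charL]
  -- The norms in `L²` are summable, so the series also converges pointwise almost everywhere; the
  -- fibrewise argument needs this.
  have hGae : ∀ᵐ ξ, HasSum (fun n => coef (P.pot u) n * F (ξ - kap n)) (G ξ) := by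
    have hsum : ∑' n, ‖coef (P.pot u) n • transL (-kap n) F‖ₑ ≠ ∞ := by
      rw [tsum_enorm_ne_top_iff_summable_norm]
      refine (hp.mul_right ‖F‖).congr fun n => ?_
      rw [norm_smul, LinearIsometry.norm_map]
    have h1 := Lp.hasSum_coeFn_tsum hsum
    rw [hG.tsum_eq] at h1
    have h2 : ∀ᵐ ξ : Plane, ∀ n, ((coef (P.pot u) n • transL (-kap n) F : L2) : Plane → ℂ) ξ =
        coef (P.pot u) n * F (ξ - kap n) := by
      refine ae_all_iff.2 fun n => ?_
      filter_upwards [Lp.coeFn_smul (coef (P.pot u) n) (transL (-kap n) F),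
        transL_ae (-kap n) F] with z h h'
      rw [h, Pi.smul_apply, smul_eq_mul, h', sub_eq_add_neg]
    filter_upwards [h1, h2] with ξ h1 h2
    exact h1.congr_fun fun n => (h2 n).symm
  have hF : ∀ᵐ ξ, K ξ = (1 + (P.msym ξ : ℂ) ^ 2) * F ξ := by
    filter_upwards [P.fourier_res_ae h] with ξ h1
    have h2 : F ξ = ((1 / (1 + P.msym ξ ^ 2) : ℝ) : ℂ) * K ξ := h1
    have : (1 + (P.msym ξ : ℂ) ^ 2) ≠ 0 := by exact_mod_cast (P.one_add_msym_sq_pos ξ).ne'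
    rw [h2]
    push_cast
    field_simp
  have hKF : ∀ᵐ ξ, (K - F : L2) ξ = (P.msym ξ : ℂ) ^ 2 * F ξ := by
    filter_upwards [hF, Lp.coeFn_sub K F] with ξ h1 h2
    rw [h2, Pi.sub_apply, h1]
    ring
  have i1 := (L2.integrable_inner (𝕜 := ℂ) F G)
  have i2 := (L2.integrable_inner (𝕜 := ℂ) F (K - F))
  have i3 := (L2.integrable_inner (𝕜 := ℂ) F F)
  set H : Plane → ℝ := fun ξ => (inner ℂ (F ξ) (G ξ)).re - (inner ℂ (F ξ) ((K - F : L2) ξ)).re -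
    lamM * (inner ℂ (F ξ) (F ξ)).re with hH
  have iH : Integrable H := (i1.re.sub i2.re).sub (i3.re.const_mul lamM)
  have hint : ∫ ξ, H ξ ≤ 0 := by
    rw [integral_eq_integral_strip iH]
    refine integral_nonpos_of_ae ?_
    have shift : ∀ {p : Plane → Prop}, (∀ᵐ ξ, p ξ) →
        ∀ᵐ ξ ∂(volume.restrict strip), ∀ l, p (ξ + kap l) := by
      intro p hp
      refine ae_restrict_of_ae (ae_all_iff.2 fun l => ?_)
      exact (measurePreserving_add_const (kap l)).quasiMeasurePreserving.ae hp
    filter_upwards [shift hGae, shift hKF, ae_strip_summable i1, ae_strip_summable i2,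
      ae_strip_summable i3] with ξ hG hKF s1 s2 s3
    set c : ℤ → ℂ := fun l => F (ξ + kap l) with hc
    have e3 : ∀ l, inner ℂ (c l) (c l) = ((‖c l‖ ^ 2 : ℝ) : ℂ) := fun l => by
      rw [inner_self_eq_norm_sq_to_K]; push_cast; rfl
    have e2 : ∀ l, inner ℂ (c l) ((K - F : L2) (ξ + kap l)) =
        ((P.msym (ξ + kap l) ^ 2 * ‖c l‖ ^ 2 : ℝ) : ℂ) := fun l => by
      rw [hKF l, ← smul_eq_mul, inner_smul_right, e3]
      push_cast
      rfl
    have e1 : ∀ l, inner ℂ (c l) (G (ξ + kap l)) =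
        (starRingEnd ℂ) (c l) * ∑' m, coef (P.pot u) m * c (l - m) := fun l => by
      have : G (ξ + kap l) = ∑' m, coef (P.pot u) m * c (l - m) := by
        rw [← (hG l).tsum_eq]
        refine tsum_congr fun m => ?_
        have : ξ + kap l - kap m = ξ + kap (l - m) := by
          rw [sub_eq_add_neg l m, kap_add, kap_neg]
          abel
        rw [this]
      rw [← this, RCLike.inner_apply, mul_comm]
    have s3' : Summable fun l => ‖c l‖ ^ 2 := by
      refine s3.congr fun l => ?_
      rw [e3, Complex.norm_real]
      simp
    have s2' : Summable fun l => P.msym (ξ + kap l) ^ 2 * ‖c l‖ ^ 2 := by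
      refine s2.congr fun l => ?_
      rw [e2, Complex.norm_real, Real.norm_of_nonneg (by positivity)]
    have s1' := s1.of_norm
    have key := bloch_form_le hk hu hmax ξ s3' s2'
    have s1'' : HasSum (fun l => (inner ℂ (c l) (G (ξ + kap l))).re)
        (∑' l, (starRingEnd ℂ) (c l) * ∑' m, coef (P.pot u) m * c (l - m)).re := by
      have := Complex.hasSum_re s1'.hasSum
      rw [tsum_congr e1] at this
      exact this
    have s4 : HasSum (fun l => (P.msym (ξ + kap l) ^ 2 + lamM) * ‖c l‖ ^ 2)
        (∑' l, (P.msym (ξ + kap l) ^ 2 + lamM) * ‖c l‖ ^ 2) := by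
      refine Summable.hasSum ((s2'.add (s3'.mul_left lamM)).congr fun l => ?_)
      ring
    have s5 : HasSum (fun l => H (ξ + kap l))
        ((∑' l, (starRingEnd ℂ) (c l) * ∑' m, coef (P.pot u) m * c (l - m)).re -
          ∑' l, (P.msym (ξ + kap l) ^ 2 + lamM) * ‖c l‖ ^ 2) := by
      refine (s1''.sub s4).congr_fun fun l => ?_
      change (inner ℂ (c l) (G (ξ + kap l))).re - (inner ℂ (c l) ((K - F : L2) (ξ + kap l))).re -
        lamM * (inner ℂ (c l) (c l)).re = _
      rw [e2, e3, Complex.ofReal_re, Complex.ofReal_re]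
      ring
    change ∑' l, H (ξ + kap l) ≤ 0
    rw [s5.tsum_eq]
    linarith
  have e : ∫ ξ, H ξ = (inner ℂ v (-(h - v) + mulCLM (bddMeas_pot hu) v)).re - lamM * ‖v‖ ^ 2 := by
    have i12 : Integrable fun ξ => (inner ℂ (F ξ) (G ξ)).re -
      (inner ℂ (F ξ) ((K - F : L2) ξ)).re := i1.re.sub i2.re
    have i3' : Integrable fun ξ => lamM * (inner ℂ (F ξ) (F ξ)).re := i3.re.const_mul lamM
    have i1' : Integrable fun ξ => (inner ℂ (F ξ) (G ξ)).re := i1.re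
    have i2' : Integrable fun ξ => (inner ℂ (F ξ) ((K - F : L2) ξ)).re := i2.re
    rw [hH, integral_sub i12 i3', integral_sub i1' i2', integral_const_mul]
    have r : ∀ A B : L2, ∫ ξ, (inner ℂ (A ξ) (B ξ)).re = (inner ℂ A B).re := fun A B => by
      rw [L2.inner_def]
      exact integral_re (L2.integrable_inner (𝕜 := ℂ) A B)
    rw [r, r, r]
    have : K - F = 𝓕 (h - v) := 
      (map_sub (FourierTransform.fourierCLM ℂ L2 : L2 →L[ℂ] L2) h v).symm
    rw [this, Lp.inner_fourier_eq, Lp.inner_fourier_eq, Lp.inner_fourier_eq, inner_add_right,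
      inner_neg_right, Complex.add_re, Complex.neg_re]
    have : (inner ℂ v v).re = ‖v‖ ^ 2 := by
      rw [← inner_self_eq_norm_sq (𝕜 := ℂ)]; rfl
    rw [this]
    ring
  linarith

end Params

/-! ### Abstract dissipative evolutions -/

section Evolution

variable {E : Type*} [NormedAddCommGroup E] [InnerProductSpace ℂ E]

theorem re_inner_comm (v w : E) : (inner ℂ v w).re = (inner ℂ w v).re :=
  inner_re_symm (𝕜 := ℂ) v w

theorem re_inner_self (v : E) : (inner ℂ v v).re = ‖v‖ ^ 2 :=
  inner_self_eq_norm_sq (𝕜 := ℂ) v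

theorem re_inner_le (v w : E) : (inner ℂ v w).re ≤ ‖v‖ * ‖w‖ :=
  re_inner_le_norm (𝕜 := ℂ) v w

variable [NormedSpace ℝ E]

theorem hasDerivAt_re_inner {f g : ℝ → E} {f' g' : E} {t : ℝ} (hf : HasDerivAt f f' t)
    (hg : HasDerivAt g g' t) : HasDerivAt (fun s => (inner ℂ (f s) (g s)).re)
      ((inner ℂ (f t) g').re + (inner ℂ f' (g t)).re) t := by
  have := Complex.reCLM.hasFDerivAt.comp_hasDerivAt t (hf.inner ℂ hg)
  rw [map_add] at this
  exact this

theorem hasDerivAt_normSq {f : ℝ → E} {f' : E} {t : ℝ} (hf : HasDerivAt f f' t) :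
    HasDerivAt (fun s => ‖f s‖ ^ 2) (2 * (inner ℂ (f t) f').re) t := by
  have := hasDerivAt_re_inner hf hf
  rw [re_inner_comm f' (f t), ← two_mul] at this
  simpa only [re_inner_self] using this

/-- The derivative of a symmetric form along a differentiable curve, when only continuity is known
of the images under the unbounded operator that defines the form. -/
theorem hasDerivAt_symm_form [IsScalarTower ℝ ℂ E] {N v : ℝ → E} {v' : E} {t : ℝ} (hN : ContinuousAt N t)
    (hv : HasDerivAt v v' t)
    (hs : ∀ᶠ s in 𝓝 t, (inner ℂ (N s) (v t)).re = (inner ℂ (N t) (v s)).re) :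
    HasDerivAt (fun s => (inner ℂ (N s) (v s)).re) (2 * (inner ℂ (N t) v').re) t := by
  have h1 : HasDerivAt (fun s => (inner ℂ (N s + N t) (v s - v t)).re)
      (2 * (inner ℂ (N t) v').re) t := by
    rw [hasDerivAt_iff_tendsto_slope] at hv ⊢
    have h2 : Tendsto (fun s => (inner ℂ (N s + N t) (slope v t s)).re) (𝓝[≠] t)
        (𝓝 (inner ℂ (N t + N t) v').re) :=
      (Complex.continuous_re.tendsto _).comp
        (((hN.tendsto.mono_left nhdsWithin_le_nhds).add_const (N t)).inner hv)
    have h3 : (inner ℂ (N t + N t) v').re = 2 * (inner ℂ (N t) v').re := by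
      rw [inner_add_left, Complex.add_re]; ring
    rw [h3] at h2
    refine h2.congr fun s => ?_
    rw [slope_def_module, slope_def_field, sub_self, inner_zero_right, Complex.zero_re, sub_zero]
    have : (s - t)⁻¹ • (v s - v t) = (((s - t)⁻¹ : ℝ) : ℂ) • (v s - v t) :=
      RCLike.real_smul_eq_coe_smul (K := ℂ) _ _
    rw [this, inner_smul_right, Complex.re_ofReal_mul]
    ring
  refine (h1.add_const (inner ℂ (N t) (v t)).re).congr_of_eventuallyEq ?_
  filter_upwards [hs] with s hs
  rw [inner_sub_right, inner_add_left, inner_add_left, Complex.sub_re, Complex.add_re,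
    Complex.add_re, hs]
  ring

/-- Formally `(√q)' ≤ lam √q + cκe^{-μ(T-t)}`, and integration gives `cκ ∫ e^{-(μ-lam)(T-t)} dt ≤
cκ/(μ-lam)`. A positive `η` under the root avoids the zeros of `q`. The hypothesis `h0` replaces an
initial value, because `q` need not extend continuously to `0`. -/
theorem sqrt_le_of_deriv_le {q q' : ℝ → ℝ} {lam μ c κ T : ℝ} (hlam : 0 ≤ lam) (hμ : lam < μ)
    (hc : 0 ≤ c) (hκ : 0 ≤ κ) (hT : 0 < T) (hq : ∀ t ∈ Ioc 0 T, 0 ≤ q t)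
    (hd : ∀ t ∈ Ioc 0 T, HasDerivAt q (q' t) t)
    (hle : ∀ t ∈ Ioc 0 T, q' t ≤
      2 * lam * q t + 2 * c * Real.sqrt (q t) * (κ * Real.exp (-μ * (T - t))))
    (h0 : ∀ η > 0, ∃ δ ∈ Ioo 0 T, q δ < η) :
    Real.sqrt (q T) ≤ c * κ / (μ - lam) := by
  have hμl : 0 < μ - lam := sub_pos.2 hμ
  suffices h : Real.sqrt (q T) * Real.exp (-lam * T) ≤ c * κ / (μ - lam) * Real.exp (-lam * T) from
    le_of_mul_le_mul_right h (Real.exp_pos _)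
  refine le_of_forall_pos_le_add fun ε hε => ?_
  obtain ⟨δ, ⟨hδ0, hδT⟩, hδ⟩ := h0 (ε ^ 2 / 2) (by positivity)
  set η := ε ^ 2 / 2 with hη
  have hηpos : 0 < η := by positivity
  set A := c * κ / (μ - lam) with hA
  -- The regularized root, freed of the factor `e^{lam t}`, minus the explicit integral of its
  -- forcing; the differential inequality makes it nonincreasing. With `η = ε²/2` and `q δ < η`, its
  -- value at `δ` is at most `ε`.
  set z : ℝ → ℝ := fun t => Real.sqrt (q t * Real.exp (-(2 * lam) * t) + η) -
    A * Real.exp (-μ * T) * Real.exp ((μ - lam) * t) with hz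
  have hpos : ∀ t ∈ Ioc 0 T, 0 < q t * Real.exp (-(2 * lam) * t) + η := fun t ht =>
    add_pos_of_nonneg_of_pos (mul_nonneg (hq t ht) (Real.exp_pos _).le) hηpos
  have hexp : ∀ a t : ℝ, HasDerivAt (fun t => Real.exp (a * t)) (Real.exp (a * t) * a) t := by
    intro a t
    simpa using (((hasDerivAt_id t).const_mul a).exp)
  have hder : ∀ t ∈ Ioc 0 T, HasDerivAt z ((q' t * Real.exp (-(2 * lam) * t) +
      q t * (Real.exp (-(2 * lam) * t) * (-(2 * lam)))) /
        (2 * Real.sqrt (q t * Real.exp (-(2 * lam) * t) + η)) -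
      A * Real.exp (-μ * T) * (Real.exp ((μ - lam) * t) * (μ - lam))) t := fun t ht =>
    ((((hd t ht).mul (hexp _ t)).add_const η).sqrt (hpos t ht).ne').sub
      ((hexp (μ - lam) t).const_mul _)
  have hsub : Icc δ T ⊆ Ioc 0 T := fun t ht => ⟨hδ0.trans_le ht.1, ht.2⟩
  have hanti : AntitoneOn z (Icc δ T) := by
    refine antitoneOn_of_hasDerivWithinAt_nonpos (convex_Icc _ _)
      (fun t ht => (hder t (hsub ht)).continuousAt.continuousWithinAt)
      (fun t ht => (hder t (hsub (interior_subset ht))).hasDerivWithinAt) fun t ht => ?_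
    replace ht := hsub (interior_subset ht)
    rw [sub_nonpos, div_le_iff₀ (by have := Real.sqrt_pos.2 (hpos t ht); positivity)]
    have e1 : A * Real.exp (-μ * T) * (Real.exp ((μ - lam) * t) * (μ - lam)) =
        c * κ * Real.exp (-μ * (T - t)) * Real.exp (-lam * t) := by
      rw [hA]
      have : Real.exp (-μ * T) * Real.exp ((μ - lam) * t) =
        Real.exp (-μ * (T - t)) * Real.exp (-lam * t) := by
        rw [← Real.exp_add, ← Real.exp_add]; ring_nf
      calc _ = c * κ / (μ - lam) * (μ - lam) *
            (Real.exp (-μ * T) * Real.exp ((μ - lam) * t)) := by ring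
        _ = _ := by rw [this, div_mul_cancel₀ _ hμl.ne']; ring
    rw [e1]
    have e2 : Real.exp (-(2 * lam) * t) = Real.exp (-lam * t) * Real.exp (-lam * t) := by
      rw [← Real.exp_add]; ring_nf
    have e3 : Real.sqrt (q t) * Real.exp (-lam * t) ≤
        Real.sqrt (q t * Real.exp (-(2 * lam) * t) + η) := by
      refine Real.le_sqrt_of_sq_le ?_
      rw [mul_pow, Real.sq_sqrt (hq t ht), e2, ← sq]
      linarith
    have e4 := hle t ht
    have e5 : 0 ≤ c * κ * Real.exp (-μ * (T - t)) * Real.exp (-lam * t) := by positivity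
    have e6 := mul_le_mul_of_nonneg_left e3 (mul_nonneg zero_le_two e5)
    have e7 := mul_le_mul_of_nonneg_right e4 (Real.exp_pos (-(2 * lam) * t)).le
    calc _ = q' t * Real.exp (-(2 * lam) * t) - 2 * lam * q t * Real.exp (-(2 * lam) * t) := by ring
      _ ≤ 2 * c * Real.sqrt (q t) * (κ * Real.exp (-μ * (T - t))) * Real.exp (-(2 * lam) * t) := by
        linarith
      _ = 2 * (c * κ * Real.exp (-μ * (T - t)) * Real.exp (-lam * t)) *
          (Real.sqrt (q t) * Real.exp (-lam * t)) := by rw [e2]; ring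
      _ ≤ _ := by linarith
  have h1 := hanti (left_mem_Icc.2 hδT.le) (right_mem_Icc.2 hδT.le) hδT.le
  have hTm : T ∈ Ioc 0 T := ⟨hT, le_rfl⟩
  have e2 : Real.exp (-(2 * lam) * T) = Real.exp (-lam * T) ^ 2 := by
    rw [← Real.exp_nat_mul]; ring_nf
  have h2 : Real.sqrt (q T) * Real.exp (-lam * T) ≤
      Real.sqrt (q T * Real.exp (-(2 * lam) * T) + η) := by
    refine Real.le_sqrt_of_sq_le ?_
    rw [mul_pow, Real.sq_sqrt (hq T hTm), e2]
    linarith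
  have h3 : Real.sqrt (q δ * Real.exp (-(2 * lam) * δ) + η) ≤ ε := by
    refine Real.sqrt_le_iff.2 ⟨hε.le, ?_⟩
    have : Real.exp (-(2 * lam) * δ) ≤ 1 := Real.exp_le_one_iff.2 (by nlinarith)
    have := mul_le_of_le_one_right (hq δ ⟨hδ0, hδT.le⟩) this
    linarith
  have h4 : A * Real.exp (-μ * T) * Real.exp ((μ - lam) * T) = A * Real.exp (-lam * T) := by
    rw [mul_assoc, ← Real.exp_add]; ring_nf
  have h5 : 0 ≤ A * Real.exp (-μ * T) * Real.exp ((μ - lam) * δ) := by positivity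
  simp only [hz, h4] at h1
  linarith

/-- The operators that describe a dissipative evolution equation `v' = L v + ι k`, where
`L (R h) = -(h - R h) + M (R h)`, in terms of the resolvent `R = ι S`. -/
structure IsDissipative (R M ι S D : E →L[ℂ] E) (C lam : ℝ) : Prop where
  res_symm : ∀ v w, inner ℂ (R v) w = inner ℂ v (R w)
  mul_symm : ∀ v w, inner ℂ (M v) w = inner ℂ v (M w)
  emb_symm : ∀ v w, inner ℂ (ι v) w = inner ℂ v (ι w)
  emb_apply : ∀ h, ι (S h) = R h
  dual_apply : ∀ h, D (S h) = ι h
  elliptic : ∀ h, ‖S h‖ ^ 2 ≤ C * (inner ℂ h (R h)).re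
  dissip : ∀ h, (inner ℂ (R h) (-(h - R h) + M (R h))).re ≤ lam * ‖R h‖ ^ 2

variable {R M ι S D : E →L[ℂ] E} {C lam : ℝ}

/-- Uniqueness: dissipativity makes `‖v‖² e^{-2 lam t}` nonincreasing, and it starts at zero. -/
theorem IsDissipative.eq_zero (H : IsDissipative R M ι S D C lam) {v h : ℝ → E}
    (hv : ContinuousOn v (Ici 0)) (hv0 : v 0 = 0) (hR : ∀ t, 0 < t → v t = R (h t))
    (hd : ∀ t, 0 < t → HasDerivAt v (-(h t - v t) + M (v t)) t) {t : ℝ} (ht : 0 ≤ t) : v t = 0 := by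
  have hder : ∀ t, 0 < t → HasDerivAt (fun t => ‖v t‖ ^ 2 * Real.exp (-(2 * lam) * t))
      (2 * (inner ℂ (v t) (-(h t - v t) + M (v t))).re * Real.exp (-(2 * lam) * t) +
        ‖v t‖ ^ 2 * (Real.exp (-(2 * lam) * t) * (-(2 * lam)))) t := fun t ht =>
    (hasDerivAt_normSq (hd t ht)).mul (by
      simpa using ((hasDerivAt_id t).const_mul (-(2 * lam))).exp)
  have hanti : AntitoneOn (fun t => ‖v t‖ ^ 2 * Real.exp (-(2 * lam) * t)) (Ici 0) := by
    refine antitoneOn_of_hasDerivWithinAt_nonpos (convex_Ici 0)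
      ((hv.norm.pow 2).mul (by fun_prop))
      (fun t ht => (hder t (by simpa using ht)).hasDerivWithinAt) fun t ht => ?_
    have ht : 0 < t := by simpa using ht
    have h1 := H.dissip (h t)
    rw [← hR t ht] at h1
    nlinarith [Real.exp_pos (-(2 * lam) * t)]
  have h1 := hanti (mem_Ici.2 le_rfl) ht ht
  simp only [hv0, norm_zero, ne_eq, OfNat.ofNat_ne_zero, not_false_eq_true, zero_pow, zero_mul] at h1
  have h2 : ‖v t‖ ^ 2 ≤ 0 := nonpos_of_mul_nonpos_left h1 (Real.exp_pos _)
  simpa using h2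

/-- An energy estimate for `q = Re⟨N, v⟩ + Λ‖v‖²` with `N = -L v`. It controls `‖S h‖²`, the squared
`H²` norm, and grows at the sharp rate `2 lam`. The forcing costs only `‖k‖`, since `⟨h, ιk⟩ = ⟨ιh,
k⟩ = ⟨D(S h), k⟩` removes the excess derivatives from `h`. -/
theorem IsDissipative.exists_bound [IsScalarTower ℝ ℂ E] (H : IsDissipative R M ι S D C lam) (hC : 0 ≤ C)
    (hlam : 0 ≤ lam) :
    ∃ B : ℝ, 0 ≤ B ∧ ∀ {v h k : ℝ → E} {κ μ T : ℝ}, 0 < T → lam < μ → 0 ≤ κ →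
      ContinuousOn v (Ici 0) → v 0 = 0 → (∀ t, 0 < t → v t = R (h t)) →
      (∀ t, 0 < t → HasDerivAt v (-(h t - v t) + M (v t) + ι (k t)) t) →
      ContinuousOn h (Ioi 0) →
      (∀ t ∈ Ioc 0 T, ‖k t‖ ≤ κ * Real.exp (-μ * (T - t))) → ‖S (h T)‖ ≤ B * κ / (μ - lam) := by
  -- The summand `1 + ‖M‖` gives `q ≥ Re⟨h, R h⟩`; the summand `lam` compensates `Re⟨N, v⟩ ≥
  -- -lam‖v‖²`.
  set Λ : ℝ := 1 + ‖M‖ + lam with hΛ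
  set c₁ : ℝ := ‖D‖ + (Λ + 1 + ‖M‖) * ‖ι‖ * ‖ι‖ with hc₁
  have hc₁0 : 0 ≤ c₁ := by positivity
  refine ⟨C * c₁, by positivity, fun {v h k κ μ T} hT hμ hκ hv hv0 hR hd hh hk => ?_⟩
  set N : ℝ → E := fun t => h t - v t - M (v t) with hN
  set q : ℝ → ℝ := fun t => (inner ℂ (N t) (v t)).re + Λ * ‖v t‖ ^ 2 with hq
  have hMle : ∀ w, (inner ℂ (M w) w).re ≤ ‖M‖ * ‖w‖ ^ 2 := fun w => by
    refine (re_inner_le _ _).trans ?_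
    rw [sq, ← mul_assoc]
    exact mul_le_mul_of_nonneg_right (M.le_opNorm w) (norm_nonneg _)
  have hqh : ∀ t, 0 < t → (inner ℂ (h t) (R (h t))).re ≤ q t := fun t ht => by
    have h1 := hMle (v t)
    have h2 := re_inner_self (v t)
    simp only [hq, hN, inner_sub_left, Complex.sub_re, ← hR t ht, h2]
    nlinarith [sq_nonneg ‖v t‖, norm_nonneg M]
  have hS : ∀ t, 0 < t → ‖S (h t)‖ ^ 2 ≤ C * q t := fun t ht =>
    (H.elliptic _).trans (mul_le_mul_of_nonneg_left (hqh t ht) hC)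
  have hdis : ∀ t, 0 < t → -(lam * ‖v t‖ ^ 2) ≤ (inner ℂ (v t) (N t)).re := fun t ht => by
    have h1 := H.dissip (h t)
    rw [← hR t ht] at h1
    have : N t = -(-(h t - v t) + M (v t)) := by simp only [hN]; abel
    rw [this, inner_neg_right, Complex.neg_re]
    linarith
  have hq0 : ∀ t, 0 < t → 0 ≤ q t := fun t ht => by
    have h1 := hdis t ht
    rw [re_inner_comm] at h1
    have : 0 ≤ ‖M‖ := norm_nonneg _
    simp only [hq]
    nlinarith [sq_nonneg ‖v t‖]
  have hd' : ∀ t, 0 < t → HasDerivAt v (-N t + ι (k t)) t := fun t ht => by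
    convert hd t ht using 2
    simp only [hN]; abel
  have hNc : ∀ t, 0 < t → ContinuousAt N t := fun t ht => by
    have h1 := hh.continuousAt (Ioi_mem_nhds ht)
    have h2 := (hd t ht).continuousAt
    exact (h1.sub h2).sub (M.continuous.continuousAt.comp h2)
  -- Symmetry of the operator between two times. It lets `q` be differentiated although `N` is only
  -- continuous.
  have hsymm : ∀ s t, 0 < s → 0 < t → (inner ℂ (N s) (v t)).re = (inner ℂ (N t) (v s)).re := by
    intro s t hs ht
    rw [re_inner_comm (N t)]
    simp only [hN, inner_sub_left, inner_sub_right, H.mul_symm]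
    rw [hR t ht, hR s hs, ← H.res_symm (h s) (h t)]
  have hqd : ∀ t, 0 < t → HasDerivAt q (2 * (inner ℂ (N t) (-N t + ι (k t))).re +
      Λ * (2 * (inner ℂ (v t) (-N t + ι (k t))).re)) t := fun t ht =>
    (hasDerivAt_symm_form (hNc t ht) (hd' t ht)
      (by filter_upwards [Ioi_mem_nhds ht] with s hs using hsymm s t hs ht)).add
      ((hasDerivAt_normSq (hd' t ht)).const_mul Λ)
  have hvS : ∀ t, 0 < t → ‖v t‖ ≤ ‖ι‖ * ‖S (h t)‖ := fun t ht => by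
    rw [hR t ht, ← H.emb_apply]
    exact ι.le_opNorm _
  have hforce : ∀ t, 0 < t → (inner ℂ (N t) (ι (k t))).re + Λ * (inner ℂ (v t) (ι (k t))).re ≤
      c₁ * ‖S (h t)‖ * ‖k t‖ := fun t ht => by
    have e1 : (inner ℂ (h t) (ι (k t))).re ≤ ‖D‖ * ‖S (h t)‖ * ‖k t‖ := by
      rw [← H.emb_symm, ← H.dual_apply]
      exact (re_inner_le _ _).trans (mul_le_mul_of_nonneg_right (D.le_opNorm _) (norm_nonneg _))
    have e2 : |(inner ℂ (v t) (ι (k t))).re| ≤ ‖v t‖ * (‖ι‖ * ‖k t‖) :=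
      (Complex.abs_re_le_norm _).trans ((norm_inner_le_norm _ _).trans
        (mul_le_mul_of_nonneg_left (ι.le_opNorm _) (norm_nonneg _)))
    have e3 : |(inner ℂ (M (v t)) (ι (k t))).re| ≤ ‖M‖ * ‖v t‖ * (‖ι‖ * ‖k t‖) :=
      (Complex.abs_re_le_norm _).trans ((norm_inner_le_norm _ _).trans
        (mul_le_mul (M.le_opNorm _) (ι.le_opNorm _) (norm_nonneg _) (by positivity)))
    have e4 : ‖v t‖ * (‖ι‖ * ‖k t‖) ≤ ‖ι‖ * ‖S (h t)‖ * (‖ι‖ * ‖k t‖) :=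
      mul_le_mul_of_nonneg_right (hvS t ht) (by positivity)
    have hM0 : 0 ≤ ‖M‖ := norm_nonneg _
    have hΛ0 : 0 ≤ Λ := by positivity
    simp only [hN, inner_sub_left, Complex.sub_re]
    have e5 := abs_le.1 e2
    have e6 := abs_le.1 e3
    have e7 := mul_le_mul_of_nonneg_left (e5.2.trans e4) hΛ0
    have e8 := mul_le_mul_of_nonneg_left e4 hM0
    rw [hc₁]
    nlinarith
  have hle : ∀ t ∈ Ioc 0 T, 2 * (inner ℂ (N t) (-N t + ι (k t))).re +
      Λ * (2 * (inner ℂ (v t) (-N t + ι (k t))).re) ≤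
      2 * lam * q t + 2 * (c₁ * Real.sqrt C) * Real.sqrt (q t) *
        (κ * Real.exp (-μ * (T - t))) := fun t ht => by
    have e1 := hforce t ht.1
    have e2 : ‖S (h t)‖ ≤ Real.sqrt C * Real.sqrt (q t) := by
      rw [← Real.sqrt_mul hC]
      exact Real.le_sqrt_of_sq_le (hS t ht.1)
    have e3 : c₁ * ‖S (h t)‖ * ‖k t‖ ≤ c₁ * (Real.sqrt C * Real.sqrt (q t)) *
        (κ * Real.exp (-μ * (T - t))) :=
      mul_le_mul (mul_le_mul_of_nonneg_left e2 hc₁0) (hk t ht) (norm_nonneg _) (by positivity)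
    -- Without forcing, with `X = Re⟨v, N⟩`, one has `2 lam q - q' = 2(‖N‖² + 2 lam X + lam²‖v‖²) +
    -- 2(Λ - lam)(X + lam‖v‖²)`. The first bracket is nonnegative by Cauchy–Schwarz, the second by
    -- dissipativity.
    have e4 : 0 ≤ ‖N t‖ ^ 2 + 2 * lam * (inner ℂ (v t) (N t)).re + lam ^ 2 * ‖v t‖ ^ 2 := by
      have h1 : -(‖v t‖ * ‖N t‖) ≤ (inner ℂ (v t) (N t)).re :=
        (abs_le.1 ((Complex.abs_re_le_norm _).trans (norm_inner_le_norm _ _))).1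
      nlinarith [sq_nonneg (‖N t‖ - lam * ‖v t‖)]
    have e5 := hdis t ht.1
    have e6 : (inner ℂ (N t) (v t)).re = (inner ℂ (v t) (N t)).re := re_inner_comm _ _
    simp only [hq, inner_add_right, inner_neg_right, Complex.add_re, Complex.neg_re,
      re_inner_self, e6]
    have e7 : 0 ≤ Λ - lam := by
      have : 0 ≤ ‖M‖ := norm_nonneg _
      linarith
    have e8 := mul_nonneg e7 (by linarith : 0 ≤ (inner ℂ (v t) (N t)).re + lam * ‖v t‖ ^ 2)
    simp only [hq, e6] at e3
    nlinarith
  -- Only `v` is continuous at `0`. If `q ≥ η` on all of `(0, T)`, then `Re⟨N, v⟩` is bounded below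
  -- near `0` by nearly `η`, so `‖v‖²` decreases from its initial value `0`. Thus `v` vanishes at a
  -- positive time, where `q = 0`, a contradiction.
  have hsmall : ∀ η > 0, ∃ δ ∈ Ioo 0 T, q δ < η := by
    intro η hη
    by_contra! hge
    have hΛ0 : 0 ≤ Λ := by positivity
    have hlim : Tendsto (fun t => 2 * Λ * ‖v t‖ ^ 2 + 2 * (‖v t‖ * (‖ι‖ * κ))) (𝓝[≥] 0) (𝓝 0) := by
      have h1 : Tendsto (fun t => ‖v t‖) (𝓝[≥] 0) (𝓝 0) := by
        simpa [hv0] using (hv 0 (mem_Ici.2 le_rfl)).norm.tendsto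
      have := ((h1.pow 2).const_mul (2 * Λ)).add ((h1.mul_const (‖ι‖ * κ)).const_mul 2)
      simpa using this
    have hev := hlim.eventually (gt_mem_nhds hη)
    obtain ⟨τ, hτ0, hτ⟩ := (mem_nhdsGE_iff_exists_Icc_subset).1 hev
    set τ' := min τ (T / 2) with hτ'
    have hτ'0 : 0 < τ' := lt_min hτ0 (by linarith)
    have hτ'T : τ' < T := (min_le_right _ _).trans_lt (by linarith)
    have hanti : AntitoneOn (fun t => ‖v t‖ ^ 2) (Icc 0 τ') := by
      refine antitoneOn_of_hasDerivWithinAt_nonpos (convex_Icc _ _)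
        ((hv.mono fun t ht => ht.1).norm.pow 2)
        (f' := fun t => 2 * (inner ℂ (v t) (-N t + ι (k t))).re)
        (fun t ht => (hasDerivAt_normSq (hd' t (by simp at ht; exact ht.1))).hasDerivWithinAt)
        fun t ht => ?_
      rw [interior_Icc] at ht
      have ht0 : 0 < t := ht.1
      have htT : t < T := ht.2.trans hτ'T
      have e1 := hge t ⟨ht0, htT⟩
      have e2 : 2 * Λ * ‖v t‖ ^ 2 + 2 * (‖v t‖ * (‖ι‖ * κ)) < η :=
        hτ ⟨ht0.le, ht.2.le.trans (min_le_left _ _)⟩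
      have e3 : ‖k t‖ ≤ κ := (hk t ⟨ht0, htT.le⟩).trans
        (mul_le_of_le_one_right hκ (Real.exp_le_one_iff.2 (by nlinarith)))
      have e4 : (inner ℂ (v t) (ι (k t))).re ≤ ‖v t‖ * (‖ι‖ * κ) :=
        (re_inner_le _ _).trans (mul_le_mul_of_nonneg_left ((ι.le_opNorm _).trans
          (mul_le_mul_of_nonneg_left e3 (norm_nonneg _))) (norm_nonneg _))
      have e6 : (inner ℂ (N t) (v t)).re = (inner ℂ (v t) (N t)).re := re_inner_comm _ _
      simp only [hq, e6] at e1
      rw [inner_add_right, inner_neg_right, Complex.add_re, Complex.neg_re]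
      linarith
    have h1 := hanti (left_mem_Icc.2 hτ'0.le) (right_mem_Icc.2 hτ'0.le) hτ'0.le
    simp only [hv0, norm_zero] at h1
    have h2 : v τ' = 0 := by simpa using h1
    have h3 := hge τ' ⟨hτ'0, hτ'T⟩
    simp only [hq, h2, inner_zero_right, norm_zero] at h3
    simp at h3
    linarith
  have := sqrt_le_of_deriv_le hlam hμ (by positivity) hκ hT (fun t ht => hq0 t ht.1)
    (fun t ht => hqd t ht.1) hle hsmall
  have h1 : ‖S (h T)‖ ≤ Real.sqrt C * Real.sqrt (q T) := by
    rw [← Real.sqrt_mul hC]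
    exact Real.le_sqrt_of_sq_le (hS T hT)
  refine h1.trans ((mul_le_mul_of_nonneg_left this (Real.sqrt_nonneg _)).trans_eq ?_)
  have : Real.sqrt C * Real.sqrt C = C := Real.mul_self_sqrt hC
  calc _ = (Real.sqrt C * Real.sqrt C) * c₁ * κ / (μ - lam) := by ring
    _ = _ := by rw [this]

end Evolution

/-! ### Modulations and Fourier multipliers -/

theorem BddMeas.comp_add {a : Plane → ℂ} (h : BddMeas a) (c : Plane) :
    BddMeas fun ξ => a (ξ + c) := by
  obtain ⟨C, hC⟩ := h.bdd
  exact ⟨h.meas.comp (measurable_id.add_const c), C, fun ξ => hC _⟩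

theorem fmul_charL {a : Plane → ℂ} (ha : BddMeas a) (c : Plane) (v : L2) :
    fmul ha (charL c v) = charL c (fmul (ha.comp_add c) v) := by
  apply fourier_injective
  rw [fourier_fmul, fourier_charL, fourier_charL, fourier_fmul]
  have hq := (measurePreserving_add_const (-c)).quasiMeasurePreserving
  apply Lp.ext
  filter_upwards [mulCLM_ae ha (transL (-c) (𝓕 v)), transL_ae (-c) (𝓕 v),
    transL_ae (-c) (mulCLM (ha.comp_add c) (𝓕 v)),
    hq.ae (mulCLM_ae (ha.comp_add c) (𝓕 v))] with ξ h1 h2 h3 h4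
  rw [h1, h2, h3, h4, neg_add_cancel_right]

theorem charL_charL (c d : Plane) (v : L2) : charL c (charL d v) = charL (c + d) v := by
  refine mulCLM_mulCLM _ _ _ (fun z => ?_) v
  rw [inner_add_left, AddChar.map_add_eq_mul, Circle.coe_mul]

/-- Multiplication by a smooth periodic function of `x`, as an operator on `H²`. -/
theorem exists_iota_mul_fst {f : ℝ → ℂ} (hf : ContDiff ℝ 4 f)
    (hp : Function.Periodic f (2 * Real.pi)) :
    ∃ M : L2 →L[ℂ] L2, ∀ h, (iota (M h) : Plane → ℂ) =ᵐ[volume] fun z => f (z 0) * iota h z := by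
  have hle : ∀ c ξ : Plane, |jap (ξ + c) / jap ξ| ≤ 2 * (1 + jap c) := fun c ξ => by
    have h1 := jap_add_le ξ c
    have h2 := one_le_jap ξ
    have h3 := one_le_jap c
    have h4 := jap_pos (ξ + c)
    rw [abs_of_nonneg (by positivity), div_le_iff₀ (by positivity)]
    nlinarith
  have hb : ∀ c : Plane, BddMeas fun ξ => ((jap (ξ + c) / jap ξ : ℝ) : ℂ) := fun c =>
    bddMeas_ofReal (by
      have := continuous_jap
      exact (this.comp (by fun_prop)).div this fun ξ => (jap_pos ξ).ne') (hle c)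
  -- This is `(1 - Δ)e^{inx}(1 - Δ)⁻¹`. Its norm is of order `1 + n²`, which the coefficients of a
  -- `C⁴` function can absorb.
  set B : ℤ → L2 →L[ℂ] L2 := fun n => charL (kap n) ∘L fmul (hb (kap n)) with hB
  have hBι : ∀ n h, iota (B n h) = charL (kap n) (iota h) := fun n h => by
    simp only [hB, ContinuousLinearMap.comp_apply]
    rw [iota, fmul_charL, fmul_fmul _ _ bddMeas_invJap]
    intro ξ
    have h1 := (jap_pos ξ).ne'
    have h2 := (jap_pos (ξ + kap n)).ne'
    rw [← Complex.ofReal_mul]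
    congr 1
    field_simp
  have hjk : ∀ n : ℤ, jap (kap n) = 1 + (n : ℝ) ^ 2 := fun n => by
    rw [Params.jap_eq, kap_zero_coord, kap_one_coord]
    field_simp
    simp
  have hBn : ∀ n, ‖B n‖ ≤ 4 * (1 + (n : ℝ) ^ 2) := fun n => by
    refine (ContinuousLinearMap.opNorm_comp_le _ _).trans ?_
    refine (mul_le_of_le_one_left (norm_nonneg _) (norm_charL_le _)).trans ?_
    refine ContinuousLinearMap.opNorm_le_bound _ (by positivity) fun v => ?_
    refine norm_fmul_apply_le _ (fun ξ => ?_) v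
    rw [Complex.norm_real]
    refine (hle _ _).trans ?_
    rw [hjk]
    nlinarith [sq_nonneg (n : ℝ)]
  have hs : Summable fun n => coef f n • B n := by
    refine Summable.of_norm_bounded ((summable_coef hf hp).mul_left 4) fun n => ?_
    rw [norm_smul]
    nlinarith [mul_le_mul_of_nonneg_left (hBn n) (norm_nonneg (coef f n))]
  obtain ⟨C, hC⟩ := exists_bound_of_periodic hf.continuous hp
  refine ⟨∑' n, coef f n • B n, fun h => ?_⟩
  have h1 : HasSum (fun n => coef f n • charL (kap n) (iota h))
      (iota ((∑' n, coef f n • B n) h)) := by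
    have h2 := (hs.hasSum.mapL (ContinuousLinearMap.apply ℂ L2 h)).mapL iota
    refine h2.congr_fun fun n => ?_
    change _ = iota (coef f n • B n h)
    rw [map_smul, hBι]
  have h3 := (hasSum_charL (summable_norm_coef hf hp) (bddMeas_fst hf.continuous hC)
    (hasSum_coef hf.continuous hp (summable_norm_coef hf hp))).mapL
      (ContinuousLinearMap.apply ℂ L2 (iota h))
  rw [h1.unique h3]
  exact mulCLM_ae (bddMeas_fst hf.continuous hC) (iota h)

/-! ### Wave packets -/

/-- The inverse Fourier transform as an operator on `L²`. -/
def fourierInvL : L2 →L[ℂ] L2 :=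
  ((Lp.fourierTransformₗᵢ Plane ℂ).symm.toContinuousLinearEquiv : L2 →L[ℂ] L2)

theorem fourierInvL_apply (v : L2) : fourierInvL v = (𝓕⁻ v : L2) := rfl

theorem norm_fourierInvL (v : L2) : ‖fourierInvL v‖ = ‖v‖ :=
  (Lp.fourierTransformₗᵢ Plane ℂ).symm.norm_map v

theorem fmul_fourierInvL {a : Plane → ℂ} (ha : BddMeas a) (v : L2) :
    fmul ha (fourierInvL v) = fourierInvL (mulCLM ha v) := by
  rw [fmul_apply, fourierInvL_apply, fourierInvL_apply, FourierTransform.fourier_fourierInv_eq]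

/-- One Fourier mode of a wave packet. -/
def packetTerm {γ : ℤ → Plane → ℂ} (hγ : ∀ n, BddMeas (γ n)) (n : ℤ) : L2 →L[ℂ] L2 :=
  charL (kap n) ∘L fourierInvL ∘L mulCLM (hγ n)

/-- The operator that maps an amplitude `A` to `∑ₙ e^{inx} 𝓕⁻¹(γₙ A)`. -/
def packet {γ : ℤ → Plane → ℂ} (hγ : ∀ n, BddMeas (γ n)) : L2 →L[ℂ] L2 :=
  ∑' n, packetTerm hγ n

section Packet

variable {γ : ℤ → Plane → ℂ} (hγ : ∀ n, BddMeas (γ n)) {K : ℤ → ℝ}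

theorem norm_packetTerm_le (hle : ∀ n η, ‖γ n η‖ ≤ K n) (n : ℤ) : ‖packetTerm hγ n‖ ≤ K n := by
  refine ContinuousLinearMap.opNorm_le_bound _ ((norm_nonneg _).trans (hle n 0)) fun v => ?_
  refine ((charL (kap n)).le_opNorm _).trans ?_
  refine (mul_le_of_le_one_left (norm_nonneg _) (norm_charL_le _)).trans ?_
  change ‖fourierInvL (mulCLM (hγ n) v)‖ ≤ _
  rw [norm_fourierInvL]
  exact norm_mulCLM_apply_le _ (hle n) v

theorem hasSum_packet (hK : Summable K) (hle : ∀ n η, ‖γ n η‖ ≤ K n) :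
    HasSum (packetTerm hγ) (packet hγ) :=
  (Summable.of_norm_bounded hK (norm_packetTerm_le hγ hle)).hasSum

theorem hasSum_packet_apply (hK : Summable K) (hle : ∀ n η, ‖γ n η‖ ≤ K n) (A : L2) :
    HasSum (fun n => packetTerm hγ n A) (packet hγ A) :=
  (hasSum_packet hγ hK hle).mapL (ContinuousLinearMap.apply ℂ L2 A)

end Packet

namespace Params

variable {P : Params} {u : ℝ → ℝ}

/-- A wave packet of eigenfunctions lies in the domain of the linearization, which acts on it
through its amplitude. -/
theorem res_packet (hu : P.IsRoll u) {γ : ℤ → Plane → ℂ} (hγ : ∀ n, BddMeas (γ n))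
    {K : ℤ → ℝ} (hK : Summable K) (hle : ∀ n η, ‖γ n η‖ ≤ K n) {Λ : Plane → ℂ} (hΛ : BddMeas Λ)
    (heig : ∀ η n, HasSum (fun m => coef (P.pot u) m * γ (n - m) η)
      (((P.msym (η + kap n) : ℂ) ^ 2 + Λ η) * γ n η)) (A : L2) :
    P.res (mulCLM (bddMeas_pot hu) (packet hγ A) - packet hγ (mulCLM hΛ A) + packet hγ A) =
      packet hγ A := by
  have hp := summable_norm_pot hu
  set p : ℤ → ℂ := coef (P.pot u) with hpdef
  have hK0 : ∀ n, 0 ≤ K n := fun n => (norm_nonneg _).trans (hle n 0)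
  have hTA := hasSum_packet_apply hγ hK hle A
  have hterm : ∀ n, ‖packetTerm hγ n A‖ ≤ K n * ‖A‖ := fun n =>
    (ContinuousLinearMap.le_opNorm _ _).trans
      (mul_le_mul_of_nonneg_right (norm_packetTerm_le hγ hle n) (norm_nonneg _))
  -- The product of the Fourier series of the potential and of the packet. It is summed once over
  -- the potential, then regrouped by total mode so that the eigenvalue equation applies to each
  -- mode.
  set g : ℤ × ℤ → L2 := fun x => p x.1 • charL (kap x.1) (packetTerm hγ x.2 A) with hg
  have hgs : Summable g := by
    refine Summable.of_norm_bounded (hp.mul_of_nonneg (hK.mul_right ‖A‖)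
      (fun _ => norm_nonneg _) fun n => mul_nonneg (hK0 n) (norm_nonneg _)) fun x => ?_
    rw [norm_smul]
    refine mul_le_mul_of_nonneg_left ?_ (norm_nonneg _)
    exact ((charL _).le_opNorm _).trans ((mul_le_of_le_one_left (norm_nonneg _)
      (norm_charL_le _)).trans (hterm _))
  have hM : HasSum g (mulCLM (bddMeas_pot hu) (packet hγ A)) := by
    have h1 : HasSum (fun m => p m • charL (kap m) (packet hγ A)) (∑' x, g x) :=
      hgs.hasSum.prod_fiberwise fun m => (hTA.mapL (charL (kap m))).const_smul (p m)
    have h2 := (hasSum_charL hp (bddMeas_pot hu) (hasSum_coef (contDiff_pot hu).continuous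
      (periodic_pot hu) hp)).mapL (ContinuousLinearMap.apply ℂ L2 (packet hγ A))
    have h3 : mulCLM (bddMeas_pot hu) (packet hγ A) = ∑' x, g x := h2.unique h1
    rw [h3]
    exact hgs.hasSum
  -- The factor `P.msym` is unbounded, but the eigenvalue equation equates the product with a
  -- convolution of bounded symbols.
  have hδ : ∀ n, BddMeas fun η => ((P.msym (η + kap n) : ℂ) ^ 2 + Λ η) * γ n η := fun n => by
    have hs : Summable fun m => ‖p m‖ * K (n - m) := by
      refine Summable.of_norm_bounded (hp.mul_right (∑' n, K n)) fun m => ?_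
      rw [Real.norm_of_nonneg (mul_nonneg (norm_nonneg _) (hK0 _))]
      exact mul_le_mul_of_nonneg_left (hK.le_tsum _ fun _ _ => hK0 _) (norm_nonneg _)
    refine ⟨?_, ∑' m, ‖p m‖ * K (n - m), fun η => ?_⟩
    · have h1 := P.continuous_msym
      have h2 : Measurable fun η => (P.msym (η + kap n) : ℂ) :=
        (Complex.continuous_ofReal.comp (h1.comp (by fun_prop))).measurable
      exact ((h2.pow_const 2).add hΛ.meas).mul (hγ n).meas
    · rw [← (heig η n).tsum_eq]
      refine tsum_of_norm_bounded hs.hasSum fun m => ?_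
      rw [norm_mul]
      exact mul_le_mul_of_nonneg_left (hle _ _) (norm_nonneg _)
  have hfib : ∀ n, HasSum (fun m => g (m, n - m))
      (charL (kap n) (fourierInvL (mulCLM (hδ n) A))) := fun n => by
    have hs : Summable fun m => p m • mulCLM (hγ (n - m)) A := by
      refine Summable.of_norm_bounded (hp.mul_right ((∑' n, K n) * ‖A‖)) fun m => ?_
      rw [norm_smul]
      refine mul_le_mul_of_nonneg_left ?_ (norm_nonneg _)
      refine (norm_mulCLM_apply_le _ (hle _) A).trans ?_
      exact mul_le_mul_of_nonneg_right (hK.le_tsum _ fun _ _ => hK0 _) (norm_nonneg _)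
    have h1 : (∑' m, p m • mulCLM (hγ (n - m)) A) = mulCLM (hδ n) A := by
      apply Lp.ext
      refine (ae_eq_of_hasSum hs.hasSum ?_).trans (mulCLM_ae (hδ n) A).symm
      have h2 : ∀ᵐ η : Plane, ∀ m, ((p m • mulCLM (hγ (n - m)) A : L2) : Plane → ℂ) η =
          p m * γ (n - m) η * A η := by
        refine ae_all_iff.2 fun m => ?_
        filter_upwards [Lp.coeFn_smul (p m) (mulCLM (hγ (n - m)) A),
          mulCLM_ae (hγ (n - m)) A] with η h h'
        rw [h, Pi.smul_apply, smul_eq_mul, h', mul_assoc]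
      filter_upwards [h2] with η h2
      simp only [h2]
      exact (heig η n).mul_right (A η)
    have h3 := (hs.hasSum.mapL fourierInvL).mapL (charL (kap n))
    rw [h1] at h3
    refine h3.congr_fun fun m => ?_
    rw [map_smul, map_smul]
    simp only [hg, packetTerm, ContinuousLinearMap.comp_apply]
    rw [charL_charL, ← kap_add, add_sub_cancel]
  let e : ℤ × ℤ ≃ ℤ × ℤ :=
    ⟨fun x => (x.2, x.1 - x.2), fun x => (x.1 + x.2, x.1), fun x => by simp, fun x => by simp⟩
  have hY : HasSum (fun n => charL (kap n) (fourierInvL (mulCLM (hδ n) A)))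
      (mulCLM (bddMeas_pot hu) (packet hγ A)) :=
    ((e.hasSum_iff).2 hM).prod_fiberwise hfib
  have hall := ((hY.sub (hasSum_packet_apply hγ hK hle (mulCLM hΛ A))).add hTA).mapL P.res
  refine hall.unique (hTA.congr_fun fun n => ?_)
  -- In each mode the claim is `((m² + Λ)γ - Λγ + γ)/(1 + m²) = γ`, with `m` the symbol shifted by
  -- `kap n`.
  simp only [packetTerm, ContinuousLinearMap.comp_apply]
  rw [← map_sub, ← map_add, ← map_sub, ← map_add, res, fmul_charL, fmul_fourierInvL]
  congr 2
  apply Lp.ext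
  filter_upwards [mulCLM_ae (P.bddMeas_res.comp_add (kap n))
      (mulCLM (hδ n) A - mulCLM (hγ n) (mulCLM hΛ A) + mulCLM (hγ n) A),
    Lp.coeFn_add (mulCLM (hδ n) A - mulCLM (hγ n) (mulCLM hΛ A)) (mulCLM (hγ n) A),
    Lp.coeFn_sub (mulCLM (hδ n) A) (mulCLM (hγ n) (mulCLM hΛ A)),
    mulCLM_ae (hδ n) A, mulCLM_ae (hγ n) (mulCLM hΛ A), mulCLM_ae (hγ n) A, mulCLM_ae hΛ A]
    with η h1 h2 h3 h4 h5 h6 h7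
  rw [h1, h2, Pi.add_apply, h3, Pi.sub_apply, h4, h5, h6, h7]
  have : (1 + (P.msym (η + kap n) : ℂ) ^ 2) ≠ 0 := by
    exact_mod_cast (P.one_add_msym_sq_pos (η + kap n)).ne'
  push_cast
  field_simp
  ring

end Params

namespace Params

variable {P : Params} {u : ℝ → ℝ}

/-! ### Fourier coefficients of Bloch eigenfunctions -/

variable (P) in
/-- The symbol of `1 + k² (∂ₓ + iσ₁)² - σ₂²`. -/
def blochSym (σ : ℝ × ℝ) (n : ℤ) : ℝ := 1 - P.kSq * (σ.1 + n) ^ 2 - σ.2 ^ 2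

theorem contDiff_blochDeriv {k : ℕ} (τ : ℝ) {w : ℝ → ℂ} (hw : ContDiff ℝ (k + 1 : ℕ) w) :
    ContDiff ℝ k (blochDeriv τ w) := by
  have h1 : ContDiff ℝ k (deriv w) := by
    have : ContDiff ℝ (k + 1) w := by exact_mod_cast hw
    exact (contDiff_succ_iff_deriv.1 this).2.2
  have h2 : ContDiff ℝ k w := hw.of_le (by exact_mod_cast Nat.le_succ k)
  exact h1.add (contDiff_const.mul h2)

theorem periodic_blochDeriv (τ : ℝ) {w : ℝ → ℂ} {T : ℝ} (hp : Function.Periodic w T) :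
    Function.Periodic (blochDeriv τ w) T := fun x => by
  rw [blochDeriv, blochDeriv, hp x, periodic_deriv hp x]

theorem coef_add_const_mul {f g : ℝ → ℂ} (hf : Continuous f) (hg : Continuous g) (c : ℂ) (n : ℤ) :
    coef (fun x => f x + c * g x) n = coef f n + c * coef g n := by
  have h : Continuous fun x => c * g x := by fun_prop
  rw [coef_add hf h, coef_const_mul]

theorem coef_blochDeriv (τ : ℝ) {w : ℝ → ℂ} (hw : ContDiff ℝ 1 w)
    (hp : Function.Periodic w (2 * Real.pi)) (n : ℤ) :
    coef (blochDeriv τ w) n = Complex.I * (τ + n) * coef w n := by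
  have h1 : Continuous (deriv w) := hw.continuous_deriv le_rfl
  have h2 := coef_deriv (fun x => (hw.differentiable one_ne_zero x).hasDerivAt) h1 hp n
  have h3 := coef_add_const_mul h1 hw.continuous (Complex.I * τ) n
  rw [h2] at h3
  refine Eq.trans h3 ?_
  ring

theorem contDiff_blochA {k : ℕ} (σ : ℝ × ℝ) {w : ℝ → ℂ} (hw : ContDiff ℝ (k + 2 : ℕ) w) :
    ContDiff ℝ k (P.blochA σ w) := by
  have h1 := contDiff_blochDeriv σ.1 (contDiff_blochDeriv (k := k + 1) σ.1 hw)
  have h2 : ContDiff ℝ k w := hw.of_le (by exact_mod_cast Nat.le_add_right k 2)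
  exact (contDiff_const.mul h2).add (contDiff_const.mul h1)

theorem periodic_blochA (σ : ℝ × ℝ) {w : ℝ → ℂ} {T : ℝ} (hp : Function.Periodic w T) :
    Function.Periodic (P.blochA σ w) T := fun x => by
  rw [blochA, blochA, hp x, periodic_blochDeriv _ (periodic_blochDeriv _ hp) x]

theorem coef_blochA (σ : ℝ × ℝ) {w : ℝ → ℂ} (hw : ContDiff ℝ 2 w)
    (hp : Function.Periodic w (2 * Real.pi)) (n : ℤ) :
    coef (P.blochA σ w) n = P.blochSym σ n * coef w n := by
  have h1 := contDiff_blochDeriv (k := 1) σ.1 (by exact_mod_cast hw)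
  have h2 := contDiff_blochDeriv (k := 0) σ.1 (by exact_mod_cast h1)
  have h3 := coef_blochDeriv σ.1 (by exact_mod_cast h1) (periodic_blochDeriv σ.1 hp) n
  rw [coef_blochDeriv σ.1 (hw.of_le (by norm_num)) hp] at h3
  have h4 := coef_add_const_mul (f := fun x => (1 - (σ.2 : ℂ) ^ 2) * w x)
    (by have := hw.continuous; fun_prop) h2.continuous (P.kSq : ℂ) n
  rw [coef_const_mul, h3] at h4
  refine Eq.trans h4 ?_
  rw [blochSym]
  push_cast
  linear_combination ((P.kSq : ℂ) * (σ.1 + n) ^ 2 * coef w n) * Complex.I_sq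

theorem IsBlochEigenfunction.hasSum_coef (hu : P.IsRoll u) {σ : ℝ × ℝ} {μ : ℝ} {w : ℝ → ℂ}
    (h : P.IsBlochEigenfunction u σ μ w) (n : ℤ) :
    HasSum (fun m => coef (P.pot u) m * coef w (n - m))
      (((P.blochSym σ n : ℂ) ^ 2 + μ) * coef w n) := by
  have hp := summable_norm_pot hu
  have h1 := hasSum_coef_mul hp (GSHE.hasSum_coef (contDiff_pot hu).continuous (periodic_pot hu) hp)
    h.contDiff.continuous h.periodic n
  convert h1 using 1
  have hA : ContDiff ℝ 2 (P.blochA σ w) := by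
    exact_mod_cast contDiff_blochA (k := 2) σ (by exact_mod_cast h.contDiff)
  have hAA : ContDiff ℝ 0 (P.blochA σ (P.blochA σ w)) := by
    exact_mod_cast contDiff_blochA (k := 0) σ (by exact_mod_cast hA)
  have hAp := periodic_blochA (P := P) σ h.periodic
  have e : (fun x => P.pot u x * w x) =
      fun x => P.blochA σ (P.blochA σ w) x + (μ : ℂ) * w x := by
    ext x
    have := h.eigen x
    rw [bloch] at this
    rw [← this, pot]
    ring
  rw [e, coef_add_const_mul hAA.continuous h.contDiff.continuous,
    coef_blochA σ hA hAp, coef_blochA σ (h.contDiff.of_le (by norm_num)) h.periodic]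
  ring

theorem norm_coef_sub_sq_le {f g : ℝ → ℂ} (hf : Continuous f) (hg : Continuous g) (n : ℤ) :
    ENNReal.ofReal (((1 + (n : ℝ) ^ 2) * ‖coef f n - coef g n‖) ^ 2) ≤
      torusSobolevNormSq 2 fun x => f x - g x := by
  have h1 : coef (fun x => f x - g x) n = coef f n - coef g n := by
    have := coef_add_const_mul hf hg (-1) n
    simpa only [neg_one_mul, ← sub_eq_add_neg] using this
  rw [mul_pow, ← h1]
  exact ENNReal.le_tsum (f := fun j : ℤ => ENNReal.ofReal
    ((1 + (j : ℝ) ^ 2) ^ 2 * ‖coef (fun x => f x - g x) j‖ ^ 2)) n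

variable {lam : ℝ × ℝ → ℝ} {Q : Set (ℝ × ℝ)} {W : ℝ × ℝ → ℝ → ℂ}

/-- Each weighted squared coefficient is one term of the squared `H²` norm on the torus, so the
continuity is uniform in `n`. -/
theorem IsEigenfamily.tendsto_coef (h : P.IsEigenfamily u lam Q W) {σ₀ : ℝ × ℝ} (hσ₀ : σ₀ ∈ Q)
    {η : ℝ} (hη : 0 < η) :
    ∀ᶠ σ in 𝓝[Q] σ₀, ∀ n : ℤ, (1 + (n : ℝ) ^ 2) * ‖coef (W σ) n - coef (W σ₀) n‖ ≤ η := by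
  have h1 := (h.continuous σ₀ hσ₀).eventually
    (gt_mem_nhds (show (0 : ℝ≥0∞) < ENNReal.ofReal (η ^ 2) by simpa using sq_pos_of_pos hη))
  filter_upwards [h1, self_mem_nhdsWithin] with σ h2 hσ n
  have h3 := (norm_coef_sub_sq_le (h.eigenfunction σ hσ).contDiff.continuous
    (h.eigenfunction σ₀ hσ₀).contDiff.continuous n).trans h2.le
  rw [ENNReal.ofReal_le_ofReal_iff (by positivity)] at h3
  exact (sq_le_sq₀ (by positivity) hη.le).1 h3

theorem IsEigenfamily.continuousOn_coef (h : P.IsEigenfamily u lam Q W) (n : ℤ) :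
    ContinuousOn (fun σ => coef (W σ) n) Q := by
  intro σ₀ hσ₀
  refine Metric.tendsto_nhds.2 fun η hη => ?_
  filter_upwards [h.tendsto_coef hσ₀ (half_pos hη)] with σ hσ
  rw [dist_eq_norm]
  have := hσ n
  nlinarith [norm_nonneg (coef (W σ) n - coef (W σ₀) n), sq_nonneg (n : ℝ),
    mul_nonneg (sq_nonneg (n : ℝ)) (norm_nonneg (coef (W σ) n - coef (W σ₀) n))]

/-- Near each `σ₀` the weighted coefficients stay within `1` of a summable sequence; compactness of
`Q` then gives one summable majorant for all modes of the packet. -/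
theorem IsEigenfamily.exists_bound (h : P.IsEigenfamily u lam Q W) (hQ : IsCompact Q) :
    ∃ K : ℝ, 0 ≤ K ∧ ∀ σ ∈ Q, ∀ n : ℤ, ‖coef (W σ) n‖ ≤ K * (1 / (1 + (n : ℝ) ^ 2)) := by
  suffices h : ∃ K : ℝ, 0 ≤ K ∧ ∀ σ ∈ Q, ∀ n : ℤ, (1 + (n : ℝ) ^ 2) * ‖coef (W σ) n‖ ≤ K by
    obtain ⟨K, hK, h⟩ := h
    refine ⟨K, hK, fun σ hσ n => ?_⟩
    rw [mul_one_div, le_div_iff₀ (by positivity), mul_comm]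
    exact h σ hσ n
  refine hQ.induction_on (p := fun s => ∃ K : ℝ, 0 ≤ K ∧ ∀ σ ∈ s, ∀ n : ℤ,
    (1 + (n : ℝ) ^ 2) * ‖coef (W σ) n‖ ≤ K) ⟨0, le_rfl, by simp⟩ ?_ ?_ ?_
  · rintro s t hst ⟨K, hK, h⟩
    exact ⟨K, hK, fun σ hσ => h σ (hst hσ)⟩
  · rintro s t ⟨K, hK, h⟩ ⟨K', hK', h'⟩
    refine ⟨max K K', le_max_of_le_left hK, fun σ hσ n => ?_⟩
    rcases hσ with hσ | hσ
    · exact (h σ hσ n).trans (le_max_left _ _)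
    · exact (h' σ hσ n).trans (le_max_right _ _)
  · intro σ₀ hσ₀
    have hw := h.eigenfunction σ₀ hσ₀
    have hs := summable_coef hw.contDiff hw.periodic
    refine ⟨_, h.tendsto_coef hσ₀ one_pos, 1 + ∑' n : ℤ, (1 + (n : ℝ) ^ 2) * ‖coef (W σ₀) n‖,
      by positivity, fun σ hσ n => ?_⟩
    have h1 := hσ n
    have h2 : (1 + (n : ℝ) ^ 2) * ‖coef (W σ₀) n‖ ≤ _ := hs.le_tsum n fun _ _ => by positivity
    have h3 : ‖coef (W σ) n‖ ≤ ‖coef (W σ) n - coef (W σ₀) n‖ + ‖coef (W σ₀) n‖ := by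
      simpa using norm_add_le (coef (W σ) n - coef (W σ₀) n) (coef (W σ₀) n)
    nlinarith [mul_le_mul_of_nonneg_left h3 (by positivity : 0 ≤ 1 + (n : ℝ) ^ 2)]

/-! ### Amplitudes -/

theorem continuous_blochVec : Continuous blochVec := by unfold blochVec; fun_prop

theorem measurePreserving_coord :
    MeasurePreserving (fun η : Plane => (η 0, η 1)) volume (volume : Measure (ℝ × ℝ)) :=
  (volume_preserving_finTwoArrow ℝ).comp
    (EuclideanSpace.volume_preserving_symm_measurableEquiv_toLp (Fin 2))

theorem measurableEmbedding_coord : MeasurableEmbedding fun η : Plane => (η 0, η 1) :=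
  (MeasurableEquiv.finTwoArrow.measurableEmbedding).comp
    (MeasurableEquiv.toLp 2 (Fin 2 → ℝ)).symm.measurableEmbedding

theorem integral_comp_blochVec {E : Type*} [NormedAddCommGroup E] [NormedSpace ℝ E]
    (f : ℝ × ℝ → E) :
    ∫ η, f (blochVec η) = ((2 * Real.pi) ^ 2)⁻¹ • ∫ σ, f σ := by
  rw [← measurePreserving_coord.integral_comp measurableEmbedding_coord]
  have := Measure.integral_comp_smul_of_nonneg (volume : Measure Plane)
    (fun η : Plane => f (η 0, η 1)) (2 * Real.pi) (hR := Real.two_pi_pos.le)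
  rw [finrank_euclideanSpace_fin] at this
  exact this

theorem integrable_comp_blochVec {E : Type*} [NormedAddCommGroup E]
    {f : ℝ × ℝ → E} (hf : Integrable f) : Integrable fun η => f (blochVec η) := by
  have h1 := (measurePreserving_coord.integrable_comp_emb measurableEmbedding_coord).2 hf
  exact (integrable_comp_smul_iff volume (fun η : Plane => f (η 0, η 1))
    Real.two_pi_pos.ne').2 h1

/-- The function on the frequency plane that corresponds to a function of Bloch wave vectors on
the set `Q`. -/
def ampl (Q : Set (ℝ × ℝ)) (g : ℝ × ℝ → ℂ) (η : Plane) : ℂ := Q.indicator g (blochVec η)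

theorem ampl_of_mem {g : ℝ × ℝ → ℂ} {η : Plane} (h : blochVec η ∈ Q) :
    ampl Q g η = g (blochVec η) := indicator_of_mem h g

theorem ampl_of_notMem {g : ℝ × ℝ → ℂ} {η : Plane} (h : blochVec η ∉ Q) : ampl Q g η = 0 :=
  indicator_of_notMem h g

theorem norm_ampl_le {g : ℝ × ℝ → ℂ} {C : ℝ} (hC : 0 ≤ C) (h : ∀ σ ∈ Q, ‖g σ‖ ≤ C) (η : Plane) :
    ‖ampl Q g η‖ ≤ C := by
  by_cases hη : blochVec η ∈ Q
  · rw [ampl_of_mem hη]; exact h _ hη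
  · rw [ampl_of_notMem hη, norm_zero]; exact hC

theorem ampl_mul (g g' : ℝ × ℝ → ℂ) (η : Plane) :
    ampl Q g η * ampl Q g' η = ampl Q (fun σ => g σ * g' σ) η := by
  by_cases hη : blochVec η ∈ Q
  · rw [ampl_of_mem hη, ampl_of_mem hη, ampl_of_mem hη]
  · rw [ampl_of_notMem hη, ampl_of_notMem hη, ampl_of_notMem hη, zero_mul]

theorem measurable_ampl (hQ : IsCompact Q) {g : ℝ × ℝ → ℂ} (hg : ContinuousOn g Q) :
    Measurable (ampl Q g) := by
  classical
  have h1 : Measurable (Q.indicator g) := by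
    rw [← piecewise_eq_indicator]
    exact hg.measurable_piecewise continuousOn_const hQ.measurableSet
  exact h1.comp continuous_blochVec.measurable

theorem bddMeas_ampl (hQ : IsCompact Q) {g : ℝ × ℝ → ℂ} (hg : ContinuousOn g Q) :
    BddMeas (ampl Q g) := by
  obtain ⟨C, hC⟩ := hQ.exists_bound_of_continuousOn hg
  exact ⟨measurable_ampl hQ hg, max C 0, norm_ampl_le (le_max_right _ _)
    fun σ hσ => (hC σ hσ).trans (le_max_left _ _)⟩

theorem integrable_ampl (hQ : IsCompact Q) {g : ℝ × ℝ → ℂ} (hg : ContinuousOn g Q) :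
    Integrable (ampl Q g) :=
  integrable_comp_blochVec ((integrable_indicator_iff hQ.measurableSet).2
    (hg.integrableOn_compact hQ))

theorem normSq_ampl (g : ℝ × ℝ → ℂ) (η : Plane) :
    ‖ampl Q g η‖ ^ 2 = Q.indicator (fun σ => ‖g σ‖ ^ 2) (blochVec η) := by
  by_cases hη : blochVec η ∈ Q
  · rw [ampl_of_mem hη, indicator_of_mem hη]
  · rw [ampl_of_notMem hη, indicator_of_notMem hη]; simp

theorem memLp_ampl (hQ : IsCompact Q) {g : ℝ × ℝ → ℂ} (hg : ContinuousOn g Q) :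
    MemLp (ampl Q g) 2 := by
  rw [memLp_two_iff_integrable_sq_norm (measurable_ampl hQ hg).aestronglyMeasurable]
  simp only [normSq_ampl]
  exact integrable_comp_blochVec ((integrable_indicator_iff hQ.measurableSet).2
    ((hg.norm.pow 2).integrableOn_compact hQ))

theorem norm_toLp_ampl (hQ : IsCompact Q) {g : ℝ × ℝ → ℂ} (hg : ContinuousOn g Q) :
    ‖(memLp_ampl hQ hg).toLp‖ = (2 * Real.pi)⁻¹ * Real.sqrt (∫ σ in Q, ‖g σ‖ ^ 2) := by
  have h1 : ‖(memLp_ampl hQ hg).toLp‖ ^ 2 = ∫ η, ‖ampl Q g η‖ ^ 2 := by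
    rw [← re_inner_self, L2.inner_def]
    have h2 := integral_re (L2.integrable_inner (𝕜 := ℂ) (memLp_ampl hQ hg).toLp
      (memLp_ampl hQ hg).toLp)
    refine h2.symm.trans (integral_congr_ae ?_)
    filter_upwards [(memLp_ampl hQ hg).coeFn_toLp] with η h
    rw [h]
    exact re_inner_self _
  simp only [normSq_ampl] at h1
  rw [integral_comp_blochVec, integral_indicator hQ.measurableSet, smul_eq_mul] at h1
  have h3 : 0 ≤ ∫ σ in Q, ‖g σ‖ ^ 2 := integral_nonneg fun _ => by positivity
  rw [← sq_eq_sq₀ (norm_nonneg _) (by positivity), h1, mul_pow (2 * Real.pi)⁻¹, Real.sq_sqrt h3,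
    inv_pow]

end Params

namespace Params

variable {P : Params} {u : ℝ → ℝ} {lam : ℝ × ℝ → ℝ} {Q : Set (ℝ × ℝ)} {W : ℝ × ℝ → ℝ → ℂ}

/-! ### Evolution of the amplitude -/

theorem continuousOn_growth (hl : ContinuousOn lam Q) (t : ℝ) :
    ContinuousOn (fun σ => (Real.exp (lam σ * t) : ℂ)) Q :=
  Complex.continuous_ofReal.comp_continuousOn
    (Real.continuous_exp.comp_continuousOn (hl.mul continuousOn_const))

theorem continuousOn_ofReal (hl : ContinuousOn lam Q) : ContinuousOn (fun σ => (lam σ : ℂ)) Q :=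
  Complex.continuous_ofReal.comp_continuousOn hl

/-- The amplitude `e^{λ(σ)t}`, `σ ∈ Q`, as an element of `L²` of the frequency plane. -/
def amp (hQ : IsCompact Q) (hl : ContinuousOn lam Q) (t : ℝ) : L2 :=
  (memLp_ampl hQ (continuousOn_growth hl t)).toLp

variable (hQ : IsCompact Q) (hl : ContinuousOn lam Q)

theorem amp_ae (t : ℝ) :
    (amp hQ hl t : Plane → ℂ) =ᵐ[volume] ampl Q fun σ => (Real.exp (lam σ * t) : ℂ) :=
  MemLp.coeFn_toLp _

theorem norm_amp (t : ℝ) : ‖amp hQ hl t‖ =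
    (2 * Real.pi)⁻¹ * Real.sqrt (∫ σ in Q, Real.exp (2 * lam σ * t)) := by
  rw [amp, norm_toLp_ampl hQ (continuousOn_growth hl t)]
  congr 3
  ext σ
  rw [Complex.norm_real, Real.norm_eq_abs, sq_abs, ← Real.exp_nat_mul]
  congr 1
  push_cast
  ring

theorem hasDerivAt_amp (t : ℝ) : HasDerivAt (amp hQ hl)
    (mulCLM (bddMeas_ampl hQ (continuousOn_ofReal hl)) (amp hQ hl t)) t := by
  obtain ⟨C, hC⟩ := hQ.exists_bound_of_continuousOn hl
  set L := max C 0 + 1 with hL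
  have hL1 : 1 ≤ L := by rw [hL]; linarith [le_max_right C 0]
  have hLb : ∀ σ ∈ Q, |lam σ| ≤ L := fun σ hσ =>
    (hC σ hσ).trans (by rw [hL]; linarith [le_max_left C 0])
  set hΛ := bddMeas_ampl hQ (continuousOn_ofReal hl)
  rw [hasDerivAt_iff_isLittleO]
  refine Asymptotics.IsBigO.trans_isLittleO (g := fun s => (s - t) ^ 2)
    (Asymptotics.IsBigO.of_bound (L ^ 2 * ‖amp hQ hl t‖) ?_) ?_
  -- Within distance `1/L` the exponent `λ(s - t)` is at most `1` in modulus, so `|e^x - 1 - x| ≤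
  -- x²` bounds the remainder uniformly over `Q`.
  · filter_upwards [Metric.ball_mem_nhds t (show 0 < 1 / L by positivity)] with s hs
    rw [mem_ball_iff_norm, Real.norm_eq_abs, lt_div_iff₀ (by positivity)] at hs
    have key : ‖amp hQ hl s - amp hQ hl t - (s - t) • mulCLM hΛ (amp hQ hl t)‖ ≤
        (L ^ 2 * (s - t) ^ 2) * ‖amp hQ hl t‖ := by
      refine Lp.norm_le_mul_norm_of_ae_le_mul ?_
      filter_upwards [Lp.coeFn_sub (amp hQ hl s - amp hQ hl t)
          ((s - t) • mulCLM hΛ (amp hQ hl t)), Lp.coeFn_sub (amp hQ hl s) (amp hQ hl t),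
        Lp.coeFn_smul (s - t) (mulCLM hΛ (amp hQ hl t)), mulCLM_ae hΛ (amp hQ hl t),
        amp_ae hQ hl s, amp_ae hQ hl t] with η h1 h2 h3 h4 h5 h6
      rw [h1, Pi.sub_apply, h2, Pi.sub_apply, h3, Pi.smul_apply, h4, h5, h6]
      by_cases hη : blochVec η ∈ Q
      · rw [ampl_of_mem hη, ampl_of_mem hη, ampl_of_mem hη]
        set a := lam (blochVec η)
        have ha : |a| ≤ L := hLb _ hη
        have h7 : |a * (s - t)| ≤ 1 := by
          rw [abs_mul]
          nlinarith [abs_nonneg (s - t)]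
        have e1 : Real.exp (a * s) = Real.exp (a * t) * Real.exp (a * (s - t)) := by
          rw [← Real.exp_add]; ring_nf
        have e2 : (Real.exp (a * s) : ℂ) - (Real.exp (a * t) : ℂ) -
            (s - t) • ((a : ℂ) * (Real.exp (a * t) : ℂ)) =
            ((Real.exp (a * t) * (Real.exp (a * (s - t)) - 1 - a * (s - t)) : ℝ) : ℂ) := by
          rw [Complex.real_smul, e1]
          push_cast
          ring
        rw [e2, Complex.norm_real, Complex.norm_real, norm_mul, mul_comm]
        refine mul_le_mul_of_nonneg_right ?_ (norm_nonneg _)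
        refine (Real.abs_exp_sub_one_sub_id_le h7).trans ?_
        rw [mul_pow]
        refine mul_le_mul_of_nonneg_right ?_ (sq_nonneg _)
        rw [← sq_abs]
        exact pow_le_pow_left₀ (abs_nonneg _) ha 2
      · rw [ampl_of_notMem hη, ampl_of_notMem hη, ampl_of_notMem hη]
        simp
    refine key.trans_eq ?_
    rw [Real.norm_of_nonneg (sq_nonneg _)]
    ring
  · have := Asymptotics.isLittleO_pow_sub_sub t (m := 2) one_lt_two
    refine this.congr_left fun s => ?_
    rw [Real.norm_eq_abs, sq_abs]

/-! ### The packet of eigenfunctions -/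

/-- The symbols of the Fourier modes of the wave packet. -/
def modeSym (Q : Set (ℝ × ℝ)) (W : ℝ × ℝ → ℝ → ℂ) (n : ℤ) : Plane → ℂ :=
  ampl Q fun σ => ((2 * Real.pi) ^ 2 : ℝ) * coef (W σ) n

theorem IsEigenfamily.continuousOn_mode (h : P.IsEigenfamily u lam Q W) (n : ℤ) :
    ContinuousOn (fun σ => (((2 * Real.pi) ^ 2 : ℝ) : ℂ) * coef (W σ) n) Q :=
  continuousOn_const.mul (h.continuousOn_coef n)

theorem IsEigenfamily.bddMeas_modeSym (h : P.IsEigenfamily u lam Q W) (hQ : IsCompact Q) (n : ℤ) :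
    BddMeas (modeSym Q W n) :=
  bddMeas_ampl hQ (h.continuousOn_mode n)

theorem IsEigenfamily.exists_modeSym_le (h : P.IsEigenfamily u lam Q W) (hQ : IsCompact Q) :
    ∃ K : ℤ → ℝ, Summable K ∧ ∀ n η, ‖modeSym Q W n η‖ ≤ K n := by
  obtain ⟨K, hK0, hK⟩ := h.exists_bound hQ
  refine ⟨fun n => (2 * Real.pi) ^ 2 * (K * (1 / (1 + (n : ℝ) ^ 2))),
    (summable_one_div_one_add_sq.mul_left K).mul_left _, fun n => ?_⟩
  refine norm_ampl_le (by positivity) fun σ hσ => ?_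
  rw [norm_mul, Complex.norm_real, Real.norm_of_nonneg (by positivity)]
  exact mul_le_mul_of_nonneg_left (hK σ hσ n) (by positivity)

theorem IsEigenfamily.hasSum_modeSym (h : P.IsEigenfamily u lam Q W) (hu : P.IsRoll u)
    (η : Plane) (n : ℤ) :
    HasSum (fun m => coef (P.pot u) m * modeSym Q W (n - m) η)
      (((P.msym (η + kap n) : ℂ) ^ 2 + ampl Q (fun σ => (lam σ : ℂ)) η) * modeSym Q W n η) := by
  by_cases hη : blochVec η ∈ Q
  · simp only [modeSym, ampl_of_mem hη]
    have h1 := (((h.eigenfunction _ hη).hasSum_coef hu n).mul_left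
      (((2 * Real.pi) ^ 2 : ℝ) : ℂ))
    have h2 : P.msym (η + kap n) = P.blochSym (blochVec η) n := P.msym_add_kap η n
    rw [h2]
    rw [mul_left_comm]
    exact h1.congr_fun fun m => mul_left_comm _ _ _
  · simp only [modeSym, ampl_of_notMem hη, mul_zero]
    exact hasSum_zero

theorem IsEigenfamily.hasSum_wavePacket (h : P.IsEigenfamily u lam Q W) (hQ : IsCompact Q)
    (z : Plane) :
    HasSum (fun n => ex n (z 0) * ∫ σ in Q,
      Complex.exp (Complex.I * (σ.1 * z 0 + σ.2 * z 1)) * coef (W σ) n) (wavePacket Q W z) := by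
  obtain ⟨K, hK0, hK⟩ := h.exists_bound hQ
  set F : ℤ → ℝ × ℝ → ℂ := fun n σ => ex n (z 0) *
    (Complex.exp (Complex.I * (σ.1 * z 0 + σ.2 * z 1)) * coef (W σ) n) with hF
  have hchar : ∀ σ : ℝ × ℝ, ‖Complex.exp (Complex.I * (σ.1 * z 0 + σ.2 * z 1))‖ = 1 := fun σ => by
    have : Complex.I * (σ.1 * z 0 + σ.2 * z 1) = ((σ.1 * z 0 + σ.2 * z 1 : ℝ) : ℂ) * Complex.I := by
      push_cast; ring
    rw [this, Complex.norm_exp_ofReal_mul_I]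
  have hFn : ∀ n, ∀ σ ∈ Q, ‖F n σ‖ ≤ K * (1 / (1 + (n : ℝ) ^ 2)) := fun n σ hσ => by
    simp only [hF]
    rw [norm_mul, norm_mul, norm_ex, hchar, one_mul, one_mul]
    exact hK σ hσ n
  have hFi : ∀ n, Integrable (F n) (volume.restrict Q) := fun n => by
    refine ContinuousOn.integrableOn_compact (μ := volume) hQ ?_
    refine continuousOn_const.mul (ContinuousOn.mul ?_ (h.continuousOn_coef n))
    exact Continuous.continuousOn (by fun_prop)
  have hs : Summable fun n => ∫ σ in Q, ‖F n σ‖ := by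
    refine Summable.of_nonneg_of_le (fun n => integral_nonneg fun _ => norm_nonneg _) (fun n => ?_)
      ((summable_one_div_one_add_sq.mul_left K).mul_left (volume.real Q))
    have := setIntegral_mono_on (hFi n).norm (integrableOn_const hQ.measure_lt_top.ne)
      hQ.measurableSet (hFn n)
    rwa [setIntegral_const, smul_eq_mul] at this
  have h1 := hasSum_integral_of_summable_integral_norm hFi hs
  have h2 : ∫ σ in Q, ∑' n, F n σ = wavePacket Q W z := by
    refine setIntegral_congr_fun hQ.measurableSet fun σ hσ => ?_
    have hw := h.eigenfunction σ hσ
    have h3 := (hasSum_coef hw.contDiff.continuous hw.periodic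
      (summable_norm_coef hw.contDiff hw.periodic) (z 0)).mul_left
      (Complex.exp (Complex.I * (σ.1 * z 0 + σ.2 * z 1)))
    rw [← h3.tsum_eq]
    refine tsum_congr fun n => ?_
    simp only [hF]
    ring
  rw [h2] at h1
  refine h1.congr_fun fun n => ?_
  rw [← integral_const_mul]

/-- The factor `(2π)²` in the symbol cancels the Jacobian of the passage from frequencies to Bloch
wave vectors. -/
theorem fourierInv_ampl (g : ℝ × ℝ → ℂ) (hQm : MeasurableSet Q) (z : Plane) :
    𝓕⁻ (ampl Q fun σ => (((2 * Real.pi) ^ 2 : ℝ) : ℂ) * g σ) z =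
      ∫ σ in Q, Complex.exp (Complex.I * (σ.1 * z 0 + σ.2 * z 1)) * g σ := by
  rw [Real.fourierInv_eq]
  have h1 : ∀ η : Plane, Real.fourierChar (inner ℝ η z) •
      ampl Q (fun σ => (((2 * Real.pi) ^ 2 : ℝ) : ℂ) * g σ) η =
      Q.indicator (fun σ => (((2 * Real.pi) ^ 2 : ℝ) : ℂ) *
        (Complex.exp (Complex.I * (σ.1 * z 0 + σ.2 * z 1)) * g σ)) (blochVec η) := fun η => by
    by_cases hη : blochVec η ∈ Q
    · rw [ampl_of_mem hη, indicator_of_mem hη, Circle.smul_def, Real.fourierChar_apply,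
        smul_eq_mul, mul_left_comm]
      congr 3
      rw [PiLp.inner_apply, Fin.sum_univ_two, blochVec]
      simp only [RCLike.inner_apply, conj_trivial]
      push_cast
      ring
    · rw [ampl_of_notMem hη, indicator_of_notMem hη, smul_zero]
  simp only [h1]
  rw [integral_comp_blochVec, integral_indicator hQm, integral_const_mul, Complex.real_smul,
    ← mul_assoc, ← Complex.ofReal_mul, inv_mul_cancel₀ (by positivity), Complex.ofReal_one, one_mul]

/-- At time zero the amplitude is the indicator of `Q`; each mode is an explicit integral, and the
`L²` sum agrees with the pointwise one. -/
theorem IsEigenfamily.packet_ae (h : P.IsEigenfamily u lam Q W) (hQ : IsCompact Q)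
    (hl : ContinuousOn lam Q) :
    (packet (h.bddMeas_modeSym hQ) (amp hQ hl 0) : Plane → ℂ) =ᵐ[volume] wavePacket Q W := by
  obtain ⟨K, hK, hle⟩ := h.exists_modeSym_le hQ
  refine ae_eq_of_hasSum (hasSum_packet_apply (h.bddMeas_modeSym hQ) hK hle (amp hQ hl 0)) ?_
  have h1 : ∀ᵐ z : Plane, ∀ n, (packetTerm (h.bddMeas_modeSym hQ) n (amp hQ hl 0) : Plane → ℂ) z =
      ex n (z 0) * ∫ σ in Q, Complex.exp (Complex.I * (σ.1 * z 0 + σ.2 * z 1)) * coef (W σ) n := by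
    refine ae_all_iff.2 fun n => ?_
    set G : L2 := mulCLM (h.bddMeas_modeSym hQ n) (amp hQ hl 0) with hG
    have hGae : (G : Plane → ℂ) =ᵐ[volume] modeSym Q W n := by
      filter_upwards [mulCLM_ae (h.bddMeas_modeSym hQ n) (amp hQ hl 0), amp_ae hQ hl 0] with η h1 h2
      rw [h1, h2, modeSym, ampl_mul]
      simp
    have hGi : Integrable (G : Plane → ℂ) :=
      (integrable_ampl hQ (h.continuousOn_mode n)).congr hGae.symm
    filter_upwards [charL_ae (kap n) (𝓕⁻ G : L2), fourierInv_ae_eq hGi] with z h1 h2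
    change (charL (kap n) (𝓕⁻ G : L2) : Plane → ℂ) z = _
    rw [h1, h2, fourierChar_kap, Real.fourierInv_congr_ae hGae]
    congr 1
    exact fourierInv_ampl _ hQ.measurableSet z
  filter_upwards [h1] with z h1
  simp only [h1]
  exact h.hasSum_wavePacket hQ z

/-! ### The first correction -/

theorem isDissipative (hk : 0 < P.kSq) (hu : P.IsRoll u) {lamM : ℝ}
    (hmax : ∀ σ μ, P.IsBlochEigenvalue u σ μ → μ ≤ lamM) :
    IsDissipative P.res (mulCLM (bddMeas_pot hu)) iota (P.resS hk) (P.resD hk)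
      (8 / (min 1 P.kSq) ^ 2) lamM where
  res_symm := P.res_symm
  mul_symm := mulCLM_symm _ fun _ => conj_pot _
  emb_symm := Params.iota_symm
  emb_apply := P.iota_resS hk
  dual_apply := P.resD_resS hk
  elliptic := P.norm_resS_sq_le hk
  dissip := res_form_le hk hu hmax

/-- The first correction is the wave packet whose amplitude grows exponentially. -/
theorem IsEigenfamily.exists_first (h : P.IsEigenfamily u lam Q W) (hk : 0 < P.kSq)
    (hu : P.IsRoll u) {lamM : ℝ} (hmax : ∀ σ μ, P.IsBlochEigenvalue u σ μ → μ ≤ lamM)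
    (hQ : IsCompact Q) (hl : ContinuousOn lam Q) :
    ∃ Φ : L2 →L[ℂ] L2, ∀ v : ℝ → L2, P.IsSolution u (fun _ _ => 0) (wavePacket Q W) v →
      ∀ t, 0 ≤ t → v t = iota (Φ (amp hQ hl t)) := by
  obtain ⟨K, hK, hle⟩ := h.exists_modeSym_le hQ
  set hγ := h.bddMeas_modeSym hQ
  set hΛ := bddMeas_ampl hQ (continuousOn_ofReal hl)
  set M := mulCLM (bddMeas_pot hu)
  -- The preimage of the packet under the resolvent, bounded in the amplitude; hence `P.resS hk ∘L
  -- G` bounds the packet in `H²`.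
  set G : L2 →L[ℂ] L2 := M ∘L packet hγ - packet hγ ∘L mulCLM hΛ + packet hγ with hG
  have hres : ∀ A, P.res (G A) = packet hγ A := fun A =>
    res_packet hu hγ hK hle hΛ (h.hasSum_modeSym hu) A
  refine ⟨P.resS hk ∘L G, fun v hv t ht => ?_⟩
  rw [ContinuousLinearMap.comp_apply, P.iota_resS, hres]
  obtain ⟨hvc, hv0, v', -, hv'⟩ := hv
  rw [← sub_eq_zero]
  have hex : ∀ t, ∃ g : L2, 0 < t → v t = P.res g ∧ v' t = -(g - v t) + M (v t) := by
    intro t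
    by_cases ht : 0 < t
    · obtain ⟨-, w, hw, hw'⟩ := hv' t ht
      obtain ⟨g, hg, hg'⟩ := hw.exists_res hu
      refine ⟨g, fun _ => ⟨hg, ?_⟩⟩
      rw [← hg']
      apply Lp.ext
      filter_upwards [hw'] with z hz
      rw [hz, add_zero]
    · exact ⟨0, fun h => absurd h ht⟩
  choose g hg using hex
  have hpd : ∀ t, HasDerivAt (fun t => packet hγ (amp hQ hl t))
      (packet hγ (mulCLM hΛ (amp hQ hl t))) t := fun t =>
    ((packet hγ).restrictScalars ℝ).hasFDerivAt.comp_hasDerivAt t (hasDerivAt_amp hQ hl t)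
  refine (isDissipative hk hu hmax).eq_zero (v := fun t => v t - packet hγ (amp hQ hl t))
    (h := fun t => g t - G (amp hQ hl t)) ?_ ?_ (fun t ht => ?_) (fun t ht => ?_) ht
  · exact hvc.sub fun t _ => (hpd t).continuousAt.continuousWithinAt
  · rw [sub_eq_zero]
    apply Lp.ext
    filter_upwards [hv0, h.packet_ae hQ hl] with z h1 h2
    rw [h1, h2]
  · rw [map_sub, hres, ← (hg t ht).1]
  · refine ((hv' t ht).1.sub (hpd t)).congr_deriv ?_
    rw [(hg t ht).2, map_sub]
    simp only [hG, add_apply, sub_apply,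
      ContinuousLinearMap.comp_apply]
    abel

end Params

/-! ### Convolution sums of inverse squares -/

theorem sum_inv_sq_le_two (j : ℕ) : ∑ k ∈ Finset.Icc 1 j, ((k : ℝ) ^ 2)⁻¹ ≤ 2 := by
  rcases Nat.eq_zero_or_pos j with rfl | hj
  · simp
  · have h1 := sum_Ioo_inv_sq_le (α := ℝ) 0 (j + 1)
    have h2 : Finset.Ioo 0 (j + 1) = Finset.Icc 1 j := by
      ext k; simp only [Finset.mem_Ioo, Finset.mem_Icc]; omega
    rw [h2] at h1
    simpa using h1

/-- From `(a + b)² ≤ 2(a² + b²)` one gets `1/(a²b²) ≤ 2(a + b)⁻²(1/a² + 1/b²)`, and each remaining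
sum is at most `2`. The same weight thus survives the convolution. -/
theorem sum_pairs_le (j : ℕ) :
    ∑ m ∈ (Finset.Icc 1 j ×ˢ Finset.Icc 1 j).filter (fun m => m.1 + m.2 = j),
      ((m.1 : ℝ) ^ 2)⁻¹ * ((m.2 : ℝ) ^ 2)⁻¹ ≤ 8 * ((j : ℝ) ^ 2)⁻¹ := by
  set s := (Finset.Icc 1 j ×ˢ Finset.Icc 1 j).filter (fun m => m.1 + m.2 = j) with hs
  have hmem : ∀ m ∈ s, 1 ≤ m.1 ∧ m.1 ≤ j ∧ 1 ≤ m.2 ∧ m.2 ≤ j ∧ m.1 + m.2 = j := fun m hm => by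
    simp only [hs, Finset.mem_filter, Finset.mem_product, Finset.mem_Icc] at hm
    omega
  have h0 : ∀ k : ℕ, 0 ≤ ((k : ℝ) ^ 2)⁻¹ := fun k => by positivity
  have h1 : ∑ m ∈ s, ((m.1 : ℝ) ^ 2)⁻¹ ≤ 2 := by
    rw [← Finset.sum_image (f := fun k : ℕ => ((k : ℝ) ^ 2)⁻¹) (g := Prod.fst)]
    · refine (Finset.sum_le_sum_of_subset_of_nonneg ?_ fun _ _ _ => h0 _).trans
        (sum_inv_sq_le_two j)
      intro k hk
      obtain ⟨m, hm, rfl⟩ := Finset.mem_image.1 hk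
      have := hmem m hm
      exact Finset.mem_Icc.2 ⟨this.1, this.2.1⟩
    · intro m hm m' hm' h
      have := hmem m hm
      have := hmem m' hm'
      exact Prod.ext h (by omega)
  have h2 : ∑ m ∈ s, ((m.2 : ℝ) ^ 2)⁻¹ ≤ 2 := by
    rw [← Finset.sum_image (f := fun k : ℕ => ((k : ℝ) ^ 2)⁻¹) (g := Prod.snd)]
    · refine (Finset.sum_le_sum_of_subset_of_nonneg ?_ fun _ _ _ => h0 _).trans
        (sum_inv_sq_le_two j)
      intro k hk
      obtain ⟨m, hm, rfl⟩ := Finset.mem_image.1 hk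
      have := hmem m hm
      exact Finset.mem_Icc.2 ⟨this.2.2.1, this.2.2.2.1⟩
    · intro m hm m' hm' h
      have := hmem m hm
      have := hmem m' hm'
      exact Prod.ext (by omega) h
  calc _ ≤ ∑ m ∈ s, 2 * ((j : ℝ) ^ 2)⁻¹ * (((m.1 : ℝ) ^ 2)⁻¹ + ((m.2 : ℝ) ^ 2)⁻¹) := by
        refine Finset.sum_le_sum fun m hm => ?_
        obtain ⟨h3, -, h4, -, h5⟩ := hmem m hm
        have ha : (0 : ℝ) < m.1 := by exact_mod_cast h3
        have hb : (0 : ℝ) < m.2 := by exact_mod_cast h4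
        have hj : (j : ℝ) = m.1 + m.2 := by exact_mod_cast h5.symm
        rw [hj]
        set a : ℝ := ((m.1 : ℕ) : ℝ)
        set b : ℝ := ((m.2 : ℕ) : ℝ)
        have e : 2 * ((a + b) ^ 2)⁻¹ * ((a ^ 2)⁻¹ + (b ^ 2)⁻¹) =
            (2 * (a ^ 2 + b ^ 2) / (a + b) ^ 2) * ((a ^ 2)⁻¹ * (b ^ 2)⁻¹) := by
          field_simp
          ring
        rw [e]
        refine le_mul_of_one_le_left (by positivity) ?_
        rw [one_le_div (by positivity)]
        nlinarith [sq_nonneg (a - b)]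
    _ = 2 * ((j : ℝ) ^ 2)⁻¹ * (∑ m ∈ s, ((m.1 : ℝ) ^ 2)⁻¹ + ∑ m ∈ s, ((m.2 : ℝ) ^ 2)⁻¹) := by
        rw [← Finset.mul_sum, Finset.sum_add_distrib]
    _ ≤ 2 * ((j : ℝ) ^ 2)⁻¹ * (2 + 2) := by gcongr
    _ = _ := by ring

/-- The analogue with `(a + b + c)² ≤ 3(a² + b² + c²)`: three double sums remain, each at most
`2·2`. -/
theorem sum_triples_le (j : ℕ) :
    ∑ m ∈ (Finset.Icc 1 j ×ˢ Finset.Icc 1 j ×ˢ Finset.Icc 1 j).filter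
        (fun m => m.1 + m.2.1 + m.2.2 = j),
      ((m.1 : ℝ) ^ 2)⁻¹ * (((m.2.1 : ℝ) ^ 2)⁻¹ * ((m.2.2 : ℝ) ^ 2)⁻¹) ≤ 36 * ((j : ℝ) ^ 2)⁻¹ := by
  set s := (Finset.Icc 1 j ×ˢ Finset.Icc 1 j ×ˢ Finset.Icc 1 j).filter
        (fun m => m.1 + m.2.1 + m.2.2 = j) with hs
  have hmem : ∀ m ∈ s, 1 ≤ m.1 ∧ m.1 ≤ j ∧ 1 ≤ m.2.1 ∧ m.2.1 ≤ j ∧ 1 ≤ m.2.2 ∧ m.2.2 ≤ j ∧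
      m.1 + m.2.1 + m.2.2 = j := fun m hm => by
    simp only [hs, Finset.mem_filter, Finset.mem_product, Finset.mem_Icc] at hm
    omega
  have hprod : ∀ g : ℕ × ℕ × ℕ → ℕ × ℕ, Set.InjOn g s →
      (∀ m ∈ s, g m ∈ Finset.Icc 1 j ×ˢ Finset.Icc 1 j) →
      ∑ m ∈ s, (((g m).1 : ℝ) ^ 2)⁻¹ * (((g m).2 : ℝ) ^ 2)⁻¹ ≤ 4 := by
    intro g hg hgm
    rw [← Finset.sum_image (f := fun k : ℕ × ℕ => ((k.1 : ℝ) ^ 2)⁻¹ * ((k.2 : ℝ) ^ 2)⁻¹) hg]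
    refine (Finset.sum_le_sum_of_subset_of_nonneg (t := Finset.Icc 1 j ×ˢ Finset.Icc 1 j)
      (Finset.image_subset_iff.2 hgm) fun _ _ _ => by positivity).trans ?_
    rw [Finset.sum_product]
    change ∑ a ∈ Finset.Icc 1 j, ∑ b ∈ Finset.Icc 1 j, ((a : ℝ) ^ 2)⁻¹ * ((b : ℝ) ^ 2)⁻¹ ≤ 4
    rw [← Finset.sum_mul_sum]
    have h1 := sum_inv_sq_le_two j
    have h2 : 0 ≤ ∑ k ∈ Finset.Icc 1 j, ((k : ℝ) ^ 2)⁻¹ := Finset.sum_nonneg fun _ _ => by positivity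
    nlinarith
  have h1 := hprod (fun m => (m.1, m.2.1))
    (fun m hm m' hm' h => by
      have := hmem m hm
      have := hmem m' hm'
      have h3 : m.1 = m'.1 ∧ m.2.1 = m'.2.1 := Prod.ext_iff.1 h
      exact Prod.ext h3.1 (Prod.ext h3.2 (by omega)))
    (fun m hm => by
      have := hmem m hm
      simp only [Finset.mem_product, Finset.mem_Icc]; omega)
  have h2 := hprod (fun m => (m.1, m.2.2))
    (fun m hm m' hm' h => by
      have := hmem m hm
      have := hmem m' hm'
      have h3 : m.1 = m'.1 ∧ m.2.2 = m'.2.2 := Prod.ext_iff.1 h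
      exact Prod.ext h3.1 (Prod.ext (by omega) h3.2))
    (fun m hm => by
      have := hmem m hm
      simp only [Finset.mem_product, Finset.mem_Icc]; omega)
  have h3 := hprod (fun m => (m.2.1, m.2.2))
    (fun m hm m' hm' h => by
      have := hmem m hm
      have := hmem m' hm'
      have h3 : m.2.1 = m'.2.1 ∧ m.2.2 = m'.2.2 := Prod.ext_iff.1 h
      exact Prod.ext (by omega) (Prod.ext h3.1 h3.2))
    (fun m hm => by
      have := hmem m hm
      simp only [Finset.mem_product, Finset.mem_Icc]; omega)
  calc _ ≤ ∑ m ∈ s, 3 * ((j : ℝ) ^ 2)⁻¹ * (((m.1 : ℝ) ^ 2)⁻¹ * ((m.2.1 : ℝ) ^ 2)⁻¹ +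
          ((m.1 : ℝ) ^ 2)⁻¹ * ((m.2.2 : ℝ) ^ 2)⁻¹ + ((m.2.1 : ℝ) ^ 2)⁻¹ * ((m.2.2 : ℝ) ^ 2)⁻¹) := by
        refine Finset.sum_le_sum fun m hm => ?_
        obtain ⟨h3, -, h4, -, h5, -, h6⟩ := hmem m hm
        have ha : (0 : ℝ) < m.1 := by exact_mod_cast h3
        have hb : (0 : ℝ) < m.2.1 := by exact_mod_cast h4
        have hc : (0 : ℝ) < m.2.2 := by exact_mod_cast h5
        have hj : (j : ℝ) = m.1 + m.2.1 + m.2.2 := by exact_mod_cast h6.symm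
        rw [hj]
        set a : ℝ := ((m.1 : ℕ) : ℝ)
        set b : ℝ := ((m.2.1 : ℕ) : ℝ)
        set c : ℝ := ((m.2.2 : ℕ) : ℝ)
        have e : 3 * ((a + b + c) ^ 2)⁻¹ * ((a ^ 2)⁻¹ * (b ^ 2)⁻¹ + (a ^ 2)⁻¹ * (c ^ 2)⁻¹ +
            (b ^ 2)⁻¹ * (c ^ 2)⁻¹) =
            (3 * (a ^ 2 + b ^ 2 + c ^ 2) / (a + b + c) ^ 2) *
              ((a ^ 2)⁻¹ * ((b ^ 2)⁻¹ * (c ^ 2)⁻¹)) := by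
          field_simp
          ring
        rw [e]
        refine le_mul_of_one_le_left (by positivity) ?_
        rw [one_le_div (by positivity)]
        nlinarith [sq_nonneg (a - b), sq_nonneg (a - c), sq_nonneg (b - c)]
    _ = 3 * ((j : ℝ) ^ 2)⁻¹ * (∑ m ∈ s, ((m.1 : ℝ) ^ 2)⁻¹ * ((m.2.1 : ℝ) ^ 2)⁻¹ +
        ∑ m ∈ s, ((m.1 : ℝ) ^ 2)⁻¹ * ((m.2.2 : ℝ) ^ 2)⁻¹ +
        ∑ m ∈ s, ((m.2.1 : ℝ) ^ 2)⁻¹ * ((m.2.2 : ℝ) ^ 2)⁻¹) := by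
        rw [← Finset.mul_sum, Finset.sum_add_distrib, Finset.sum_add_distrib]
    _ ≤ 3 * ((j : ℝ) ^ 2)⁻¹ * (4 + 4 + 4) := by gcongr
    _ = _ := by ring

namespace Params

variable {P : Params} {u : ℝ → ℝ} {lam : ℝ × ℝ → ℝ} {Q : Set (ℝ × ℝ)}

/-! ### The growth function -/

/-- The growth function `(∫_Q e^{2λ(σ)t} dσ)^{1/2}` of the amplitude. -/
def growth (Q : Set (ℝ × ℝ)) (lam : ℝ × ℝ → ℝ) (t : ℝ) : ℝ :=
  Real.sqrt (∫ σ in Q, Real.exp (2 * lam σ * t))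

theorem growth_nonneg (t : ℝ) : 0 ≤ growth Q lam t := Real.sqrt_nonneg _

theorem growth_eq (lamM t : ℝ) :
    growth Q lam t = Real.exp (lamM * t) * prefactor Q lam lamM t := by
  have h1 : ∀ σ, Real.exp (2 * lam σ * t) =
      Real.exp (lamM * t) ^ 2 * Real.exp (2 * (lam σ - lamM) * t) := fun σ => by
    rw [← Real.exp_nat_mul, ← Real.exp_add]
    congr 1
    push_cast
    ring
  rw [growth, prefactor]
  simp only [h1]
  rw [integral_const_mul, Real.sqrt_mul (sq_nonneg _), Real.sqrt_sq (Real.exp_pos _).le]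

/-- Backwards in time every mode decays at least at the rate `ℓ`; this turns the inductive bound
into the exponential weight of the energy estimate. -/
theorem growth_le (hQ : IsCompact Q) (hl : ContinuousOn lam Q) {ℓ : ℝ} (hℓ : ∀ σ ∈ Q, ℓ ≤ lam σ)
    {τ t : ℝ} (hτ : τ ≤ t) : growth Q lam τ ≤ Real.exp (-ℓ * (t - τ)) * growth Q lam t := by
  have hc : ∀ r, IntegrableOn (fun σ => Real.exp (2 * lam σ * r)) Q := fun r =>
    (Real.continuous_exp.comp_continuousOn
      ((continuousOn_const.mul hl).mul continuousOn_const)).integrableOn_compact hQ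
  rw [growth, growth, ← Real.sqrt_sq (Real.exp_pos (-ℓ * (t - τ))).le,
    ← Real.sqrt_mul (sq_nonneg _)]
  refine Real.sqrt_le_sqrt ?_
  rw [← integral_const_mul]
  refine setIntegral_mono_on (hc τ) ((hc t).const_mul _) hQ.measurableSet fun σ hσ => ?_
  rw [← Real.exp_nat_mul, ← Real.exp_add, Real.exp_le_exp]
  have := hℓ σ hσ
  push_cast
  nlinarith

/-! ### The nonlinearity in `H²` -/

/-- The preimage under `iota` of the forcing of the `j`-th correction. -/
def forceH (s : ℝ) (F : L2 →L[ℂ] L2) (H : ℕ → L2) (j : ℕ) : L2 :=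
  -F (∑ m ∈ (Finset.Icc 1 j ×ˢ Finset.Icc 1 j).filter (fun m => m.1 + m.2 = j),
      mulH (H m.1) (H m.2))
    - (s : ℂ) • ∑ m ∈ (Finset.Icc 1 j ×ˢ Finset.Icc 1 j ×ˢ Finset.Icc 1 j).filter
          (fun m => m.1 + m.2.1 + m.2.2 = j), mulH (H m.1) (mulH (H m.2.1) (H m.2.2))

theorem norm_mulH_apply_le (h k : L2) : ‖mulH h k‖ ≤ ‖mulH‖ * ‖h‖ * ‖k‖ := mulH.le_opNorm₂ h k

theorem iota_forceH_ae {F : L2 →L[ℂ] L2}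
    (hF : ∀ h, (iota (F h) : Plane → ℂ) =ᵐ[volume]
      fun z => ((3 * P.s * u (z 0) - P.b : ℝ) : ℂ) * iota h z)
    {H : ℕ → L2} {V : ℕ → ℝ → L2} {j : ℕ} {t : ℝ}
    (hH : ∀ k, 1 ≤ k → k < j → V k t = iota (H k)) :
    (iota (forceH P.s F H j) : Plane → ℂ) =ᵐ[volume] P.forcing u V j t := by
  set s2 := (Finset.Icc 1 j ×ˢ Finset.Icc 1 j).filter (fun m => m.1 + m.2 = j) with hs2
  set s3 := (Finset.Icc 1 j ×ˢ Finset.Icc 1 j ×ˢ Finset.Icc 1 j).filter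
          (fun m => m.1 + m.2.1 + m.2.2 = j) with hs3
  have h2 : (iota (∑ m ∈ s2, mulH (H m.1) (H m.2)) : Plane → ℂ) =ᵐ[volume]
      fun z => ∑ m ∈ s2, V m.1 t z * V m.2 t z := by
    rw [map_sum]
    have h : ∀ᵐ z : Plane, ∀ m ∈ s2, iota (mulH (H m.1) (H m.2)) z = V m.1 t z * V m.2 t z := by
      rw [Filter.eventually_all_finset]
      intro m hm
      simp only [hs2, Finset.mem_filter, Finset.mem_product, Finset.mem_Icc] at hm
      rw [hH m.1 (by omega) (by omega), hH m.2 (by omega) (by omega)]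
      exact iota_mulH_ae _ _
    filter_upwards [coeFn_finsetSum s2 fun m => iota (mulH (H m.1) (H m.2)), h] with z h1 h2
    rw [h1]
    exact Finset.sum_congr rfl h2
  have h3 : (iota (∑ m ∈ s3, mulH (H m.1) (mulH (H m.2.1) (H m.2.2))) : Plane → ℂ) =ᵐ[volume]
      fun z => ∑ m ∈ s3, V m.1 t z * V m.2.1 t z * V m.2.2 t z := by
    rw [map_sum]
    have h : ∀ᵐ z : Plane, ∀ m ∈ s3, iota (mulH (H m.1) (mulH (H m.2.1) (H m.2.2))) z =
        V m.1 t z * V m.2.1 t z * V m.2.2 t z := by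
      rw [Filter.eventually_all_finset]
      intro m hm
      simp only [hs3, Finset.mem_filter, Finset.mem_product, Finset.mem_Icc] at hm
      rw [hH m.1 (by omega) (by omega), hH m.2.1 (by omega) (by omega),
        hH m.2.2 (by omega) (by omega)]
      filter_upwards [iota_mulH_ae (H m.1) (mulH (H m.2.1) (H m.2.2)),
        iota_mulH_ae (H m.2.1) (H m.2.2)] with z h1 h2
      rw [h1, h2, mul_assoc]
    filter_upwards [coeFn_finsetSum s3 fun m => iota (mulH (H m.1) (mulH (H m.2.1) (H m.2.2))), h]
      with z h1 h2
    rw [h1]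
    exact Finset.sum_congr rfl h2
  have e : iota (forceH P.s F H j) = -iota (F (∑ m ∈ s2, mulH (H m.1) (H m.2))) -
      (P.s : ℂ) • iota (∑ m ∈ s3, mulH (H m.1) (mulH (H m.2.1) (H m.2.2))) := by
    rw [forceH, map_sub, map_neg, map_smul]
  rw [e]
  set A := iota (F (∑ m ∈ s2, mulH (H m.1) (H m.2)))
  set B := iota (∑ m ∈ s3, mulH (H m.1) (mulH (H m.2.1) (H m.2.2)))
  filter_upwards [h2, h3, hF (∑ m ∈ s2, mulH (H m.1) (H m.2)), Lp.coeFn_sub (-A) ((P.s : ℂ) • B),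
    Lp.coeFn_neg A, Lp.coeFn_smul (P.s : ℂ) B] with z h2 h3 h4 h5 h6 h7
  rw [h5, Pi.sub_apply, h6, Pi.neg_apply, h7, Pi.smul_apply, h4, h2, h3, forcing, smul_eq_mul]
  push_cast
  ring

/-- The forcing is at least quadratic, so a common prefactor `θ ≤ 1` comes back as `θ²`, with a
constant independent of `j`. All indices in the sums are below `j`, because the others are at least
`1`. -/
theorem norm_forceH_le (s : ℝ) (F : L2 →L[ℂ] L2) {H : ℕ → L2} {j : ℕ} {θ r : ℝ} (hθ0 : 0 ≤ θ)
    (hθ : θ ≤ 1) (hr : 0 ≤ r)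
    (hH : ∀ k, 1 ≤ k → k < j → ‖H k‖ ≤ θ * (((k : ℝ) ^ 2)⁻¹ * r ^ k)) :
    ‖forceH s F H j‖ ≤ (8 * ‖F‖ * ‖mulH‖ + 36 * |s| * ‖mulH‖ ^ 2) * θ ^ 2 *
      (((j : ℝ) ^ 2)⁻¹ * r ^ j) := by
  set s2 := (Finset.Icc 1 j ×ˢ Finset.Icc 1 j).filter (fun m => m.1 + m.2 = j) with hs2
  set s3 := (Finset.Icc 1 j ×ˢ Finset.Icc 1 j ×ˢ Finset.Icc 1 j).filter
          (fun m => m.1 + m.2.1 + m.2.2 = j) with hs3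
  set μ := ‖mulH‖
  have hμ : 0 ≤ μ := norm_nonneg mulH
  have h2 : ‖∑ m ∈ s2, mulH (H m.1) (H m.2)‖ ≤ μ * θ ^ 2 * r ^ j * (8 * ((j : ℝ) ^ 2)⁻¹) := by
    refine (norm_sum_le _ _).trans ?_
    refine le_trans ?_ (mul_le_mul_of_nonneg_left (sum_pairs_le j) (by positivity))
    rw [Finset.mul_sum]
    refine Finset.sum_le_sum fun m hm => ?_
    simp only [hs2, Finset.mem_filter, Finset.mem_product, Finset.mem_Icc] at hm
    refine (norm_mulH_apply_le _ _).trans ?_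
    calc _ ≤ μ * (θ * (((m.1 : ℝ) ^ 2)⁻¹ * r ^ m.1)) * (θ * (((m.2 : ℝ) ^ 2)⁻¹ * r ^ m.2)) := by
          gcongr
          · exact hH _ (by omega) (by omega)
          · exact hH _ (by omega) (by omega)
      _ = _ := by
          rw [← hm.2, pow_add]
          ring
  have h3 : ‖∑ m ∈ s3, mulH (H m.1) (mulH (H m.2.1) (H m.2.2))‖ ≤
      μ ^ 2 * θ ^ 3 * r ^ j * (36 * ((j : ℝ) ^ 2)⁻¹) := by
    refine (norm_sum_le _ _).trans ?_
    refine le_trans ?_ (mul_le_mul_of_nonneg_left (sum_triples_le j) (by positivity))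
    rw [Finset.mul_sum]
    refine Finset.sum_le_sum fun m hm => ?_
    simp only [hs3, Finset.mem_filter, Finset.mem_product, Finset.mem_Icc] at hm
    refine (norm_mulH_apply_le _ _).trans ?_
    refine (mul_le_mul_of_nonneg_left (norm_mulH_apply_le _ _) (by positivity)).trans ?_
    calc _ ≤ μ * (θ * (((m.1 : ℝ) ^ 2)⁻¹ * r ^ m.1)) *
          (μ * (θ * (((m.2.1 : ℝ) ^ 2)⁻¹ * r ^ m.2.1)) *
            (θ * (((m.2.2 : ℝ) ^ 2)⁻¹ * r ^ m.2.2))) := by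
          gcongr
          · exact hH _ (by omega) (by omega)
          · exact hH _ (by omega) (by omega)
          · exact hH _ (by omega) (by omega)
      _ = _ := by
          rw [← hm.2, pow_add, pow_add]
          ring
  have hθ3 : θ ^ 3 ≤ θ ^ 2 := pow_le_pow_of_le_one hθ0 hθ (by norm_num)
  rw [forceH]
  calc _ ≤ ‖F‖ * (μ * θ ^ 2 * r ^ j * (8 * ((j : ℝ) ^ 2)⁻¹)) +
        |s| * (μ ^ 2 * θ ^ 3 * r ^ j * (36 * ((j : ℝ) ^ 2)⁻¹)) := by
        refine (norm_sub_le _ _).trans (add_le_add ?_ ?_)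
        · rw [norm_neg]
          exact (F.le_opNorm _).trans (mul_le_mul_of_nonneg_left h2 (norm_nonneg _))
        · rw [norm_smul, Complex.norm_real]
          exact mul_le_mul_of_nonneg_left h3 (norm_nonneg _)
    _ ≤ ‖F‖ * (μ * θ ^ 2 * r ^ j * (8 * ((j : ℝ) ^ 2)⁻¹)) +
        |s| * (μ ^ 2 * θ ^ 2 * r ^ j * (36 * ((j : ℝ) ^ 2)⁻¹)) := by gcongr
    _ = _ := by ring

theorem continuousOn_forceH (s : ℝ) (F : L2 →L[ℂ] L2) {H : ℕ → ℝ → L2} {j : ℕ} {I : Set ℝ}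
    (hH : ∀ k, 1 ≤ k → k < j → ContinuousOn (H k) I) :
    ContinuousOn (fun t => forceH s F (fun k => H k t) j) I := by
  have hm : ∀ {f g : ℝ → L2}, ContinuousOn f I → ContinuousOn g I →
      ContinuousOn (fun t => mulH (f t) (g t)) I := fun hf hg =>
    (mulH.continuous.comp_continuousOn hf).clm_apply hg
  have hA : ContinuousOn (fun t => ∑ m ∈ (Finset.Icc 1 j ×ˢ Finset.Icc 1 j).filter
      (fun m => m.1 + m.2 = j), mulH (H m.1 t) (H m.2 t)) I := by
    refine continuousOn_finsetSum _ fun m h => ?_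
    simp only [Finset.mem_filter, Finset.mem_product, Finset.mem_Icc] at h
    exact hm (hH _ (by omega) (by omega)) (hH _ (by omega) (by omega))
  have hB : ContinuousOn (fun t => ∑ m ∈ (Finset.Icc 1 j ×ˢ Finset.Icc 1 j ×ˢ
      Finset.Icc 1 j).filter (fun m => m.1 + m.2.1 + m.2.2 = j),
      mulH (H m.1 t) (mulH (H m.2.1 t) (H m.2.2 t))) I := by
    refine continuousOn_finsetSum _ fun m h => ?_
    simp only [Finset.mem_filter, Finset.mem_product, Finset.mem_Icc] at h
    exact hm (hH _ (by omega) (by omega))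
      (hm (hH _ (by omega) (by omega)) (hH _ (by omega) (by omega)))
  exact (F.continuous.comp_continuousOn hA).neg.sub (hB.const_smul (s : ℂ))

end Params

namespace Params

variable {P : Params} {u : ℝ → ℝ} {lam : ℝ × ℝ → ℝ}

/-! ### The higher corrections -/

/-- Solving the equation for the preimage under the resolvent gives a formula in `v`, `k` and the
derivative of `v`, so the preimage is continuous in time. -/
theorem IsSolution.exists_res (hu : P.IsRoll u) {g : ℝ → Plane → ℂ} {v k : ℝ → L2}
    (hv : P.IsSolution u g (fun _ => 0) v) (hk : ContinuousOn k (Ioi 0))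
    (hg : ∀ t, 0 < t → (iota (k t) : Plane → ℂ) =ᵐ[volume] g t) :
    ContinuousOn v (Ici 0) ∧ v 0 = 0 ∧ ∃ h : ℝ → L2, ContinuousOn h (Ioi 0) ∧
      (∀ t, 0 < t → v t = P.res (h t)) ∧
      ∀ t, 0 < t → HasDerivAt v
        (-(h t - v t) + mulCLM (bddMeas_pot hu) (v t) + iota (k t)) t := by
  obtain ⟨hvc, hv0, v', hv'c, hv'⟩ := hv
  refine ⟨hvc, ?_, ?_⟩
  · apply Lp.ext
    filter_upwards [hv0, Lp.coeFn_zero ℂ 2 (volume : Measure Plane)] with z h1 h2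
    rw [h1, h2, Pi.zero_apply]
  have hex : ∀ t, 0 < t → v t = P.res (v t + mulCLM (bddMeas_pot hu) (v t) + iota (k t) - v' t) := by
    intro t ht
    obtain ⟨-, w, hw, hw'⟩ := hv' t ht
    obtain ⟨h, hh, hh'⟩ := hw.exists_res hu
    have h1 : v' t = w + iota (k t) := by
      apply Lp.ext
      filter_upwards [hw', hg t ht, Lp.coeFn_add w (iota (k t))] with z h1 h2 h3
      rw [h1, h3, Pi.add_apply, h2]
    have h2 : v t + mulCLM (bddMeas_pot hu) (v t) + iota (k t) - v' t = h := by
      rw [h1, hh']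
      abel
    rw [h2]
    exact hh
  refine ⟨fun t => v t + mulCLM (bddMeas_pot hu) (v t) + iota (k t) - v' t, ?_, hex,
    fun t ht => ?_⟩
  · have h1 := hvc.mono Ioi_subset_Ici_self
    exact ((h1.add ((mulCLM (bddMeas_pot hu)).continuous.comp_continuousOn h1)).add
      (iota.continuous.comp_continuousOn hk)).sub hv'c
  · refine (hv' t ht).1.congr_deriv ?_
    beta_reduce
    abel

/-- The bounds for the corrections, by recursion over their order. -/
theorem AreCorrections.exists_bound (hk : 0 < P.kSq) (hu : P.IsRoll u) {lamM : ℝ} (hlamM : 0 < lamM)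
    (hmax : ∀ σ μ, P.IsBlochEigenvalue u σ μ → μ ≤ lamM) {Q : Set (ℝ × ℝ)} (hQ : IsCompact Q)
    (hl : ContinuousOn lam Q) (hlow : ∀ σ ∈ Q, 3 / 4 * lamM ≤ lam σ) {W : ℝ × ℝ → ℝ → ℂ}
    (hW : P.IsEigenfamily u lam Q W) :
    ∃ ρ : ℝ, 0 < ρ ∧ ∀ (N : ℕ) (V : ℕ → ℝ → L2), P.AreCorrections u (wavePacket Q W) N V →
      ∀ j, 1 ≤ j → j ≤ N → ∀ t, 0 ≤ t →
        ∃ h : L2, V j t = iota h ∧ ‖h‖ ≤ (ρ * growth Q lam t) ^ j := by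
  obtain ⟨Φ, hΦ⟩ := hW.exists_first hk hu hmax hQ hl
  have hD := isDissipative hk hu hmax
  obtain ⟨B, hB0, hB⟩ := hD.exists_bound (by positivity) hlamM.le
  obtain ⟨F, hF⟩ := exists_iota_mul_fst (f := fun x => ((3 * P.s * u x - P.b : ℝ) : ℂ))
    (Complex.ofRealCLM.contDiff.comp ((contDiff_const.mul hu.contDiff).sub contDiff_const))
    (fun x => by simp only [hu.periodic x])
  set G : ℝ := 8 * ‖F‖ * ‖mulH‖ + 36 * |P.s| * ‖mulH‖ ^ 2 with hG
  have hμ0 : 0 ≤ ‖mulH‖ := norm_nonneg mulH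
  have hF0 : 0 ≤ ‖F‖ := norm_nonneg F
  have hG0 : 0 ≤ G := by positivity
  -- Chosen so that `2BGθ ≤ lamM`, which absorbs the constants of the energy estimate and of the
  -- nonlinearity; the `+ 1` keeps the denominator positive.
  set θ : ℝ := min 1 (lamM / (2 * (B * G) + 1)) with hθ
  have hθ0 : 0 < θ := lt_min one_pos (by positivity)
  have hθ1 : θ ≤ 1 := min_le_left _ _
  have hθB : 2 * (B * G) * θ ≤ lamM := by
    have h1 : θ ≤ lamM / (2 * (B * G) + 1) := min_le_right _ _
    rw [le_div_iff₀ (by positivity)] at h1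
    linarith
  -- Fixed by the first term, which must satisfy the inductive bound with the small prefactor `θ`.
  set ρ : ℝ := ‖Φ‖ * (2 * Real.pi)⁻¹ / θ + 1 with hρ
  have hΦ0 : 0 ≤ ‖Φ‖ := norm_nonneg Φ
  have hρ0 : 0 < ρ := by positivity
  refine ⟨ρ, hρ0, fun N V hV => ?_⟩
  set E : ℝ → ℝ := growth Q lam with hE
  have hE0 : ∀ t, 0 ≤ E t := fun t => growth_nonneg t
  have hfirst : ∀ t, 0 ≤ t → ‖Φ (amp hQ hl t)‖ ≤ θ * (ρ * E t) := fun t ht => by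
    refine (Φ.le_opNorm _).trans ?_
    rw [norm_amp]
    change ‖Φ‖ * ((2 * Real.pi)⁻¹ * E t) ≤ _
    have h1 : ‖Φ‖ * (2 * Real.pi)⁻¹ ≤ θ * ρ := by
      rw [hρ, mul_add, mul_div_cancel₀ _ hθ0.ne']
      linarith
    calc _ = ‖Φ‖ * (2 * Real.pi)⁻¹ * E t := by ring
      _ ≤ θ * ρ * E t := mul_le_mul_of_nonneg_right h1 (hE0 t)
      _ = _ := by ring
  -- The claim is stronger than the conclusion, by the factor `θ j⁻²`, so that the recursion closes
  -- with constants independent of `j`. Continuity is carried along to make the next forcing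
  -- continuous.
  have hmain : ∀ j, 1 ≤ j → j ≤ N → ∃ H : ℝ → L2, ContinuousOn H (Ioi 0) ∧
      (∀ t, 0 < t → V j t = iota (H t)) ∧
      ∀ t, 0 < t → ‖H t‖ ≤ θ * (((j : ℝ) ^ 2)⁻¹ * (ρ * E t) ^ j) := by
    intro j
    induction j using Nat.strong_induction_on with
    | _ j ih =>
      intro hj hjN
      rcases Nat.lt_or_ge 1 j with hj2 | hj1
      · have ih' : ∀ k, k < j → 1 ≤ k → ∃ H : ℝ → L2, ContinuousOn H (Ioi 0) ∧
          (∀ t, 0 < t → V k t = iota (H t)) ∧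
          ∀ t, 0 < t → ‖H t‖ ≤ θ * (((k : ℝ) ^ 2)⁻¹ * (ρ * E t) ^ k) :=
          fun k h1 h2 => ih k h1 h2 (h1.le.trans hjN)
        choose! H hHc hHV hHb using ih'
        have hkc := continuousOn_forceH P.s F (H := H) (j := j) (I := Ioi 0)
          fun k h1 h2 => hHc k h2 h1
        obtain ⟨hvc, hv0, h, hhc, hhR, hhd⟩ := (hV.higher j hj2 hjN).exists_res hu hkc
          fun t ht => iota_forceH_ae hF fun k h1 h2 => hHV k h2 h1 t ht
        refine ⟨fun t => P.resS hk (h t), (P.resS hk).continuous.comp_continuousOn hhc,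
          fun t ht => by rw [P.iota_resS, hhR t ht], fun T hT => ?_⟩
        have hj0 : (2 : ℝ) ≤ j := by exact_mod_cast hj2
        -- This is where `j ≥ 2` and the fraction `3/4 > 1/2` matter.
        have hrate : lamM / 2 ≤ j * (3 / 4 * lamM) - lamM := by nlinarith
        have hforce : ∀ t ∈ Ioc 0 T, ‖forceH P.s F (fun k => H k t) j‖ ≤
            G * θ ^ 2 * (((j : ℝ) ^ 2)⁻¹ * (ρ * E T) ^ j) *
              Real.exp (-(j * (3 / 4 * lamM)) * (T - t)) := by
          intro t ht
          refine (norm_forceH_le P.s F hθ0.le hθ1 (mul_nonneg hρ0.le (hE0 t))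
            fun k h1 h2 => hHb k h2 h1 t ht.1).trans ?_
          have h1 : (ρ * E t) ^ j ≤
              (ρ * E T) ^ j * Real.exp (-(j * (3 / 4 * lamM)) * (T - t)) := by
            have h2 := mul_le_mul_of_nonneg_left (growth_le hQ hl hlow ht.2) hρ0.le
            refine (pow_le_pow_left₀ (mul_nonneg hρ0.le (hE0 t)) h2 j).trans_eq ?_
            rw [mul_left_comm, mul_pow, ← Real.exp_nat_mul, mul_comm]
            congr 2
            ring
          rw [mul_assoc (G * θ ^ 2), mul_assoc ((j : ℝ) ^ 2)⁻¹]
          refine mul_le_mul_of_nonneg_left ?_ (by positivity)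
          exact mul_le_mul_of_nonneg_left h1 (by positivity)
        have hX0 : 0 ≤ ((j : ℝ) ^ 2)⁻¹ * (ρ * E T) ^ j :=
          mul_nonneg (by positivity) (pow_nonneg (mul_nonneg hρ0.le (hE0 T)) j)
        have h1 := hB hT (μ := j * (3 / 4 * lamM)) (by linarith)
          (mul_nonneg (by positivity) hX0) hvc hv0 hhR hhd hhc hforce
        refine h1.trans ?_
        -- With `X = j⁻²(ρE(T))^j` it remains to see that `BGθ²X ≤ θX·(rate gap)`; the left side is
        -- at most `θX lamM/2` by the choice of `θ`.
        rw [div_le_iff₀ (by linarith)]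
        have h2 : θ * (2 * (B * G) * θ) ≤ θ * lamM := mul_le_mul_of_nonneg_left hθB hθ0.le
        have h3 := mul_le_mul_of_nonneg_right h2 hX0
        have h4 := mul_le_mul_of_nonneg_left hrate (mul_nonneg hθ0.le hX0)
        nlinarith
      · obtain rfl : j = 1 := le_antisymm hj1 hj
        have h1 := hΦ (V 1) (hV.first hjN)
        refine ⟨fun t => Φ (amp hQ hl t), ?_, fun t ht => h1 t ht.le, fun t ht => ?_⟩
        · exact fun t _ => (Φ.continuous.continuousAt.comp
            (hasDerivAt_amp hQ hl t).continuousAt).continuousWithinAt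
        · simpa using hfirst t ht.le
  intro j hj hjN t ht
  have hr : ∀ t, 0 ≤ (ρ * E t) ^ j := fun t => pow_nonneg (mul_nonneg hρ0.le (hE0 t)) j
  rcases ht.lt_or_eq with ht0 | rfl
  · obtain ⟨H, -, hHV, hHb⟩ := hmain j hj hjN
    refine ⟨H t, hHV t ht0, (hHb t ht0).trans ?_⟩
    have h1 : ((j : ℝ) ^ 2)⁻¹ ≤ 1 := inv_le_one_of_one_le₀ (one_le_pow₀ (by exact_mod_cast hj))
    have h2 := mul_le_of_le_one_left (hr t) h1
    exact (mul_le_of_le_one_left (mul_nonneg (by positivity) (hr t)) hθ1).trans h2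
  -- The equation holds only for `t > 0`, so `t = 0` is read off the initial data.
  · rcases Nat.lt_or_ge 1 j with hj2 | hj1
    · refine ⟨0, ?_, by simpa using hr 0⟩
      obtain ⟨-, hv0, -⟩ := hV.higher j hj2 hjN
      rw [map_zero]
      apply Lp.ext
      filter_upwards [hv0, Lp.coeFn_zero ℂ 2 (volume : Measure Plane)] with z h1 h2
      rw [h1, h2, Pi.zero_apply]
    · obtain rfl : j = 1 := le_antisymm hj1 hj
      refine ⟨_, hΦ (V 1) (hV.first hjN) 0 le_rfl, (hfirst 0 le_rfl).trans ?_⟩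
      rw [pow_one]
      exact mul_le_of_le_one_left (mul_nonneg hρ0.le (hE0 0)) hθ1

/-! ### Choice of the square and conclusion -/

theorem isCompact_square (σ : ℝ × ℝ) (c : ℝ) : IsCompact (square σ c) :=
  isCompact_Icc.prod isCompact_Icc

/-- Continuity of `lam` at `σbar` together with positivity there; any fraction strictly between
`1/2` and `1` would serve. -/
theorem IsMostUnstableBranch.exists_square {σbar : ℝ × ℝ} {S : Set (ℝ × ℝ)}
    (h : P.IsMostUnstableBranch u σbar S lam) :
    ∃ cbar : ℝ, 0 < cbar ∧ ∀ c, c ≤ cbar →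
      ∀ σ ∈ square σbar c, σ ∈ S ∧ 3 / 4 * lam σbar ≤ lam σ := by
  have h1 : ∀ᶠ σ in 𝓝 σbar, σ ∈ S ∧ 3 / 4 * lam σbar < lam σ := by
    have h2 := (h.analytic σbar h.mem).continuousAt
    have h3 : 3 / 4 * lam σbar < lam σbar := by linarith [(h.unstable σbar h.mem).1]
    exact Filter.Eventually.and (h.isOpen.mem_nhds h.mem) (h2.eventually (lt_mem_nhds h3))
  obtain ⟨r, hr, hball⟩ := Metric.eventually_nhds_iff_ball.1 h1
  refine ⟨r / 2, by positivity, fun c hc σ hσ => ?_⟩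
  obtain ⟨⟨h4, h5⟩, h6, h7⟩ := hσ
  have h8 : σ ∈ Metric.ball σbar r := by
    rw [Metric.mem_ball, Prod.dist_eq, max_lt_iff, Real.dist_eq, Real.dist_eq, abs_lt, abs_lt]
    refine ⟨⟨?_, ?_⟩, ?_, ?_⟩ <;> linarith
  exact ⟨(hball σ h8).1, (hball σ h8).2.le⟩

end Params

end GSHE

end

theorem lemma4p1 (P : GSHE.Params)
    (hb : P.b ≠ 0) (hs : 0 < 27 * P.s - 38 * P.b ^ 2)
    (hε : 0 < P.ε) (hω : P.ω ∈ Set.Ioo (-(1 / 2) : ℝ) (1 / 2)) (hk : 0 < P.kSq)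
    (u : ℝ → ℝ) (hu : P.IsRoll u)
    (σbar : ℝ × ℝ) (S : Set (ℝ × ℝ)) (lam : ℝ × ℝ → ℝ)
    (hlam : P.IsMostUnstableBranch u σbar S lam) :
    ∃ cbar : ℝ, 0 < cbar ∧ ∀ c₀ : ℝ, 0 < c₀ → c₀ ≤ cbar →
      GSHE.Params.square σbar c₀ ⊆ S ∧
      ∀ W : ℝ × ℝ → ℝ → ℂ, P.IsEigenfamily u lam (GSHE.Params.square σbar c₀) W →
        ∃ ρ : ℝ, 0 < ρ ∧ ∀ (N : ℕ) (V : ℕ → ℝ → GSHE.L2),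
          P.AreCorrections u
            (GSHE.Params.wavePacket (GSHE.Params.square σbar c₀) W) N V →
          ∀ j : ℕ, 1 ≤ j → j ≤ N → ∀ t : ℝ, 0 ≤ t →
            GSHE.sobolevNorm 2 (V j t) ≤
              ENNReal.ofReal ((ρ * Real.exp (lam σbar * t) *
                GSHE.Params.prefactor (GSHE.Params.square σbar c₀) lam (lam σbar) t) ^ j) := by
  obtain ⟨cbar, hc, hsq⟩ := hlam.exists_square
  refine ⟨cbar, hc, fun c₀ _ hc₀ => ⟨fun σ hσ => (hsq c₀ hc₀ σ hσ).1, fun W hW => ?_⟩⟩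
  obtain ⟨ρ, hρ, h⟩ := GSHE.Params.AreCorrections.exists_bound hk hu
    (hlam.unstable σbar hlam.mem).1 hlam.maximal (GSHE.Params.isCompact_square σbar c₀)
    (fun σ hσ => (hlam.analytic σ (hsq c₀ hc₀ σ hσ).1).continuousAt.continuousWithinAt)
    (fun σ hσ => (hsq c₀ hc₀ σ hσ).2) hW
  refine ⟨ρ, hρ, fun N V hV j hj hjN t ht => ?_⟩
  obtain ⟨H, hH, hle⟩ := h N V hV j hj hjN t ht
  rw [hH, GSHE.sobolevNorm_iota, mul_assoc, ← GSHE.Params.growth_eq]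
  exact ENNReal.ofReal_le_ofReal hle
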